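/- Let $\bar{\mathbb Z}=\mathbb Z\setminus\{0\}$ and, for $p>0$, let $h_p$ be the complex Hilbert space of sequences $z=(z_j)_{j\in\bar{\mathbb Z}}$, $z_j\in\mathbb C$, with $\|z\|_p^2=\sum_{j}|z_j|^2|j|^{2p}<\infty$; call $z$ real if $z_{-j}=\bar z_j$ for all $j$. Equip $h_p$ with the symplectic form $\omega=-i\sum_{j\ge1}dz_j\wedge dz_{-j}$; the Hamiltonian vector field $X_F$ of a function $F$ is given by $dF(z)v=\omega(v,X_F(z))$, i.e. $(X_F)_{j}=-i\,\partial F/\partial z_{-j}$ and $(X_F)_{-j}=i\,\partial F/\partial z_{j}$ for $j\ge1$. Put $\lambda_j=\frac{j}{1+j^2}$, $\delta_j=\sqrt{\frac{|j|}{1+j^2}}$ and $$H=\Lambda+G,\qquad \Lambda=\sum_{j\ge1}\lambda_jz_jz_{-j},\qquad G=\frac1{120\pi^2}\sum_{j_1+\dots+j_6=0}\delta_{j_1}\cdots\delta_{j_6}\,z_{j_1}\cdots z_{j_6}\quad(j_1,\dots,j_6\in\bar{\mathbb Z}).$$ For positive integers $n_1,n_2$ let $S=\{\pm n_1,\pm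 n_2\}$ and let $\hat z=(z_j)_{j\notin S}$. For $k=0,1,2$ let $\Delta_k\subset\bar{\mathbb Z}^6$ be the set of $(j_1,\dots,j_6)$ with exactly $k$ components outside $S$, let $\Delta_3$ be the set of those with at least three components outside $S$, and let $\mathcal N$ be the set of all permutations of tuples $(a,-a,b,-b,c,-c)$. Let $\bar G$ and $\hat G$ be the parts of the sum $G$ over the indices in $(\Delta_0\cup\Delta_1\cup\Delta_2)\cap\mathcal N$ and in $\Delta_3$, respectively. Then, for all sufficiently large $n_1$ and all $n_2$ sufficiently large depending on $n_1$, the following holds for every $p>0$, with $q=p+1$. There are a continuous homogeneous polynomial $F$ of degree six on $h_p$, real-valued on real points, whose Hamiltonian vector field $X_F$ is analytic from $h_p$ to $h_q$, and a symplectic coordinate transformation $\Phi_1$ (bijective onto its image, analytic together with its inverse) from an open neighbourhood $U$ of the origin in $h_p$ onto an open subset of $h_p$, with $\Phi_1(0)=0$, such that: $\Phi_1$ is the time-1 map of the flow of $X_F$; $\Phi_1$ is real analytic, i.e. it is analytic on $U$ and, for $z\in U$, $\Phi_1(z)$ is real if and only if $z$ is; $\Phi_1-\mathrm{id}$ maps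 $U$ analytically into $h_q$; and on $U$ $$H\circ\Phi_1=\Lambda+\bar G+\hat G+R,\qquad |\hat G(z)|\le C\|z\|_p^3\|\hat z\|_p^3,\qquad |R(z)|\le C\|z\|_p^{10}$$ with a constant $C$ independent of $z$. -/

import Mathlib

namespace GBBM

/-- The index set of nonzero integers. -/
abbrev Zbar : Type := {j : ℤ // j ≠ 0}

instance : Neg Zbar := ⟨fun j => ⟨-j.1, neg_ne_zero.2 j.2⟩⟩

/-- The weight `|j|`, as a real number. -/
noncomputable def absIdx (j : Zbar) : ℝ := |((j : ℤ) : ℝ)|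

theorem one_le_absIdx (j : Zbar) : 1 ≤ absIdx j := by
  have h := Int.one_le_abs j.2
  unfold absIdx
  exact_mod_cast h

theorem absIdx_pos (j : Zbar) : 0 < absIdx j := zero_lt_one.trans_le (one_le_absIdx j)

theorem memlp_iff (p : ℝ) (z : Zbar → ℂ) :
    Memℓp (fun j => ((absIdx j ^ p : ℝ) : ℂ) * z j) 2 ↔
      Summable fun j => ‖z j‖ ^ 2 * absIdx j ^ (2 * p) := by
  rw [memℓp_gen_iff (by norm_num)]
  refine summable_congr fun j => ?_
  have h0 := (absIdx_pos j).le
  rw [norm_mul, Complex.norm_real, Real.norm_of_nonneg (Real.rpow_nonneg h0 p)]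
  simp only [ENNReal.toReal_ofNat, Real.rpow_ofNat]
  rw [mul_pow, mul_comm, ← Real.rpow_natCast (absIdx j ^ p) 2, ← Real.rpow_mul h0]
  norm_num [mul_comm]

/-- The sequences `(z_j)` with `∑ |z_j|² |j|^{2p} < ∞`. -/
noncomputable def seqSubmodule (p : ℝ) : Submodule ℂ (Zbar → ℂ) where
  carrier := {z | Summable fun j => ‖z j‖ ^ 2 * absIdx j ^ (2 * p)}
  zero_mem' := by simp [summable_zero]
  add_mem' := by
    intro a b ha hb
    rw [Set.mem_ofPred_eq, ← memlp_iff] at *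
    convert ha.add hb using 1
    funext j
    simp [mul_add]
  smul_mem' := by
    intro c a ha
    rw [Set.mem_ofPred_eq, ← memlp_iff] at *
    convert ha.const_smul c using 1
    funext j
    simp only [Pi.smul_apply, smul_eq_mul]
    ring

/-- The space `h_p` (a type synonym, so that it carries its own norm topology and not the
product topology). -/
def SeqSpace (p : ℝ) : Type := seqSubmodule p

noncomputable instance (p : ℝ) : AddCommGroup (SeqSpace p) :=
  inferInstanceAs (AddCommGroup (seqSubmodule p))

noncomputable instance (p : ℝ) : Module ℂ (SeqSpace p) :=
  inferInstanceAs (Module ℂ (seqSubmodule p))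

instance (p : ℝ) : CoeFun (SeqSpace p) (fun _ => Zbar → ℂ) := ⟨fun z => z.1⟩

/-- The embedding `(z_j) ↦ (|j|^p z_j)` of `h_p` into `ℓ²`. -/
noncomputable def toL2 (p : ℝ) : SeqSpace p →ₗ[ℂ] lp (fun _ : Zbar => ℂ) 2 where
  toFun z := ⟨fun j => ((absIdx j ^ p : ℝ) : ℂ) * z j, (memlp_iff p z.1).2 z.2⟩
  map_add' a b := by
    ext j
    exact mul_add _ _ _
  map_smul' c a := by
    ext j
    exact mul_left_comm _ _ _

theorem toL2_injective (p : ℝ) : Function.Injective (toL2 p) := by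
  intro a b hab
  apply Subtype.ext
  funext j
  have h : ((absIdx j ^ p : ℝ) : ℂ) * a j = ((absIdx j ^ p : ℝ) : ℂ) * b j :=
    congrFun (congrArg Subtype.val hab) j
  have hne : ((absIdx j ^ p : ℝ) : ℂ) ≠ 0 :=
    Complex.ofReal_ne_zero.2 (Real.rpow_pos_of_pos (absIdx_pos j) p).ne'
  exact mul_left_cancel₀ hne h

/-- The norm of `h_p`, which is `(∑ |z_j|² |j|^{2p})^{1/2}` by `norm_sq_eq`. -/
noncomputable instance (p : ℝ) : NormedAddCommGroup (SeqSpace p) :=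
  NormedAddCommGroup.induced (SeqSpace p) (lp (fun _ : Zbar => ℂ) 2) (toL2 p) (toL2_injective p)

noncomputable instance (p : ℝ) : NormedSpace ℂ (SeqSpace p) :=
  NormedSpace.induced ℂ (SeqSpace p) (lp (fun _ : Zbar => ℂ) 2) (toL2 p)

theorem norm_sq_eq (p : ℝ) (z : SeqSpace p) :
    ‖z‖ ^ 2 = ∑' j, ‖z j‖ ^ 2 * absIdx j ^ (2 * p) := by
  have h1 : ‖z‖ = ‖toL2 p z‖ := rfl
  have h2 := lp.norm_rpow_eq_tsum (p := 2) (by norm_num) (toL2 p z)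
  simp only [ENNReal.toReal_ofNat, Real.rpow_ofNat] at h2
  rw [h1, h2]
  refine tsum_congr fun j => ?_
  have h0 := (absIdx_pos j).le
  have h3 : (toL2 p z) j = ((absIdx j ^ p : ℝ) : ℂ) * z j := rfl
  rw [h3, norm_mul, Complex.norm_real, Real.norm_of_nonneg (Real.rpow_nonneg h0 p),
    mul_pow, mul_comm, ← Real.rpow_natCast (absIdx j ^ p) 2, ← Real.rpow_mul h0]
  norm_num [mul_comm]

/-- The inclusion `h_{p+1} ⊆ h_p`. -/
noncomputable def incl (p : ℝ) (z : SeqSpace (p + 1)) : SeqSpace p :=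
  ⟨z.1, Summable.of_nonneg_of_le
    (fun j => mul_nonneg (sq_nonneg _) (Real.rpow_nonneg (absIdx_pos j).le _))
    (fun j => mul_le_mul_of_nonneg_left
      (Real.rpow_le_rpow_of_exponent_le (one_le_absIdx j) (by linarith)) (sq_nonneg _))
    z.2⟩

/-- The tangential sites `S = {±n₁, ±n₂}`. -/
def tangSites (n₁ n₂ : ℕ) : Set ℤ := {(n₁ : ℤ), -(n₁ : ℤ), (n₂ : ℤ), -(n₂ : ℤ)}

open Classical in
/-- The part `ẑ = (z_j)_{j ∉ S}` of `z`, extended by `0` to the sites in `S`. -/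
noncomputable def hatPart {p : ℝ} (S : Set ℤ) (z : SeqSpace p) : SeqSpace p :=
  ⟨fun j => if (j : ℤ) ∈ S then 0 else z j, Summable.of_nonneg_of_le
    (fun j => mul_nonneg (sq_nonneg _) (Real.rpow_nonneg (absIdx_pos j).le _))
    (fun j => by
      have h0 := Real.rpow_nonneg (absIdx_pos j).le (2 * p)
      beta_reduce
      split_ifs
      · simpa using mul_nonneg (sq_nonneg ‖z j‖) h0
      · exact le_rfl)
    z.2⟩

/-- The real points of `h_p`: the sequences with `z_{-j} = conj z_j`. -/
def IsReal {p : ℝ} (z : SeqSpace p) : Prop := ∀ j : Zbar, z (-j) = (starRingEnd ℂ) (z j)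

/-- The frequency `λ_j = j / (1 + j²)`. -/
noncomputable def freq (j : Zbar) : ℝ := ((j : ℤ) : ℝ) / (1 + ((j : ℤ) : ℝ) ^ 2)

/-- The weight `δ_j = (|j| / (1 + j²))^{1/2}`. -/
noncomputable def wt (j : Zbar) : ℝ := Real.sqrt (absIdx j / (1 + ((j : ℤ) : ℝ) ^ 2))

/-- The complex symplectic form `-i ∑_{j ≥ 1} dz_j ∧ dz_{-j}`. -/
noncomputable def symp (v w : Zbar → ℂ) : ℂ :=
  -Complex.I * ∑' j : {j : Zbar // 0 < (j : ℤ)}, (v j * w (-j.1) - v (-j.1) * w j)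

/-- `Λ = ∑_{j ≥ 1} λ_j z_j z_{-j}`. -/
noncomputable def quadHam (z : Zbar → ℂ) : ℂ :=
  ∑' j : {j : Zbar // 0 < (j : ℤ)}, (freq j : ℂ) * z j * z (-j.1)

/-- The part of the sextic term
`(1 / 120π²) ∑_{j₁ + ⋯ + j₆ = 0} δ_{j₁} ⋯ δ_{j₆} z_{j₁} ⋯ z_{j₆}` with `(j₁, …, j₆) ∈ A`. -/
noncomputable def sexticPart (A : Set (Fin 6 → Zbar)) (z : Zbar → ℂ) : ℂ :=
  (1 / (120 * (Real.pi : ℂ) ^ 2)) *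
    ∑' J : {J : Fin 6 → Zbar // J ∈ A ∧ ∑ i, (J i : ℤ) = 0}, ∏ i, ((wt (J.1 i) : ℂ) * z (J.1 i))

theorem summable_wt_mul {p : ℝ} (hp : 0 < p) (z : SeqSpace p) :
    Summable fun j => ‖(wt j : ℂ) * z j‖ := by
  have h1 : Summable fun j : Zbar => absIdx j ^ (-(1 + 2 * p)) :=
    (Real.summable_abs_int_rpow (b := 1 + 2 * p) (by linarith)).comp_injective
      Subtype.val_injective
  refine Summable.of_nonneg_of_le (fun _ => norm_nonneg _) (fun j => ?_) (h1.add z.2)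
  have h0 := absIdx_pos j
  have hsq : absIdx j ^ 2 = ((j : ℤ) : ℝ) ^ 2 := sq_abs _
  have hw0 : 0 ≤ wt j := Real.sqrt_nonneg _
  have hw : wt j ^ 2 ≤ absIdx j ^ (-1 : ℝ) := by
    unfold wt
    rw [Real.sq_sqrt (by positivity), Real.rpow_neg_one, ← hsq, div_le_iff₀ (by positivity),
      inv_mul_eq_div, le_div_iff₀ h0]
    nlinarith
  rw [norm_mul, Complex.norm_real, Real.norm_of_nonneg hw0]
  have ha : absIdx j ^ (-(1 + 2 * p)) = absIdx j ^ (-1 : ℝ) * (absIdx j ^ (-p)) ^ 2 := by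
    rw [← Real.rpow_natCast (absIdx j ^ (-p)) 2, ← Real.rpow_mul h0.le, ← Real.rpow_add h0]
    congr 1
    push_cast
    ring
  have hb : absIdx j ^ (2 * p) = (absIdx j ^ p) ^ 2 := by
    rw [← Real.rpow_natCast (absIdx j ^ p) 2, ← Real.rpow_mul h0.le]
    congr 1
    push_cast
    ring
  have hc : absIdx j ^ (-p) * absIdx j ^ p = 1 := by
    rw [← Real.rpow_add h0]
    simp
  have hd : (wt j * absIdx j ^ (-p)) ^ 2 ≤ absIdx j ^ (-(1 + 2 * p)) := by
    rw [ha, mul_pow]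
    exact mul_le_mul_of_nonneg_right hw (sq_nonneg _)
  have he : wt j * ‖z j‖ = (wt j * absIdx j ^ (-p)) * (‖z j‖ * absIdx j ^ p) := by
    linear_combination (-(wt j * ‖z j‖)) * hc
  rw [he, hb, ← mul_pow]
  nlinarith [sq_nonneg (wt j * absIdx j ^ (-p) - ‖z j‖ * absIdx j ^ p),
    sq_nonneg (wt j * absIdx j ^ (-p)), sq_nonneg (‖z j‖ * absIdx j ^ p)]

theorem summable_prod_pow {ι : Type*} {f : ι → ℝ} (h0 : ∀ j, 0 ≤ f j) (hf : Summable f) (n : ℕ) :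
    Summable fun J : Fin n → ι => ∏ i, f (J i) := by
  induction n with
  | zero => exact Summable.of_finite
  | succ n ih =>
    rw [← (Fin.consEquiv fun _ : Fin (n + 1) => ι).summable_iff]
    have h := hf.mul_of_nonneg ih h0 fun J => Finset.prod_nonneg fun i _ => h0 (J i)
    refine h.congr fun x => ?_
    simp [Fin.prod_univ_succ, Fin.consEquiv]

/-- The series `sexticPart A z` converges absolutely for every `z ∈ h_p`, `p > 0`. -/
theorem summable_sexticPart {p : ℝ} (hp : 0 < p) (A : Set (Fin 6 → Zbar)) (z : SeqSpace p) :
    Summable fun J : {J : Fin 6 → Zbar // J ∈ A ∧ ∑ i, (J i : ℤ) = 0} =>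
      ∏ i, ((wt (J.1 i) : ℂ) * z (J.1 i)) := by
  have h := summable_prod_pow (fun _ => norm_nonneg _) (summable_wt_mul hp z) 6
  refine Summable.of_norm ?_
  simp_rw [norm_prod]
  exact h.comp_injective Subtype.val_injective

/-- The series in `symp` and in `quadHam` converge absolutely on `h_p`, `p ≥ 0`. -/
theorem summable_mul_neg {p : ℝ} (hp : 0 ≤ p) (v w : SeqSpace p) :
    Summable fun j : Zbar => ‖v j‖ * ‖w (-j)‖ := by
  have key : ∀ u : SeqSpace p, Summable fun j : Zbar => ‖u j‖ ^ 2 := fun u =>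
    Summable.of_nonneg_of_le (fun _ => sq_nonneg _) (fun j => le_mul_of_one_le_right (sq_nonneg _)
      (Real.one_le_rpow (one_le_absIdx j) (by linarith))) u.2
  have hinj : Function.Injective fun j : Zbar => -j := by
    intro a b hab
    have h : -(a : ℤ) = -(b : ℤ) := congrArg Subtype.val hab
    exact Subtype.ext (neg_injective h)
  refine Summable.of_nonneg_of_le (fun j => mul_nonneg (norm_nonneg _) (norm_nonneg _))
    (fun j => ?_) ((key v).add ((key w).comp_injective hinj))
  simp only [Function.comp]
  nlinarith [sq_nonneg (‖v j‖ - ‖w (-j)‖), sq_nonneg (‖v j‖), sq_nonneg (‖w (-j)‖)]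

/-- The Hamiltonian `H = Λ + G`. -/
noncomputable def ham (z : Zbar → ℂ) : ℂ := quadHam z + sexticPart Set.univ z

/-- The number of components of `J` outside `S`. -/
noncomputable def numOutside (S : Set ℤ) (J : Fin 6 → Zbar) : ℕ := {i | (J i : ℤ) ∉ S}.ncard

/-- `Δ_k` for `k = 0, 1, 2`: exactly `k` components are outside `S`. -/
def Delta (S : Set ℤ) (k : ℕ) : Set (Fin 6 → Zbar) := {J | numOutside S J = k}

/-- `Δ₃`: at least three components are outside `S`. -/
def Delta3 (S : Set ℤ) : Set (Fin 6 → Zbar) := {J | 3 ≤ numOutside S J}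

/-- The normal form set `𝒩`: the permutations of `(a, -a, b, -b, c, -c)`. -/
def normalSet : Set (Fin 6 → Zbar) :=
  {J | ∃ (a b c : Zbar) (τ : Equiv.Perm (Fin 6)), J ∘ τ = ![a, -a, b, -b, c, -c]}

/-- `Ḡ`. -/
noncomputable def Gbar (n₁ n₂ : ℕ) : (Zbar → ℂ) → ℂ :=
  sexticPart ((Delta (tangSites n₁ n₂) 0 ∪ Delta (tangSites n₁ n₂) 1 ∪
    Delta (tangSites n₁ n₂) 2) ∩ normalSet)

/-- `Ĝ`. -/
noncomputable def Ghat (n₁ n₂ : ℕ) : (Zbar → ℂ) → ℂ := sexticPart (Delta3 (tangSites n₁ n₂))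

/-- `X` is the Hamiltonian vector field of `F`: `dF(z) v = ω(v, X(z))`, which in coordinates is
`X(z)_j = -i ∂F/∂z_{-j}` and `X(z)_{-j} = i ∂F/∂z_j` for `j ≥ 1`. -/
def IsHamiltonianField {p q : ℝ} (F : SeqSpace p → ℂ) (X : SeqSpace p → SeqSpace q) : Prop :=
  Differentiable ℂ F ∧ ∀ z v : SeqSpace p, fderiv ℂ F z v = symp v (X z)

/-- On `U`, the map `Φ` is the time-1 map of the flow of the vector field `X`. -/
def IsTimeOneMap {p : ℝ} (X : SeqSpace p → SeqSpace (p + 1)) (U : Set (SeqSpace p))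
    (Φ : SeqSpace p → SeqSpace p) : Prop :=
  ∀ z ∈ U, ∃ γ : ℝ → SeqSpace p, γ 0 = z ∧ γ 1 = Φ z ∧
    ∀ t ∈ Set.Icc (0 : ℝ) 1,
      HasDerivWithinAt γ (incl p (X (γ t))) (Set.Icc (0 : ℝ) 1) t

/-- `Φ` preserves the symplectic form on `U`. -/
def IsSymplecticOn {p : ℝ} (U : Set (SeqSpace p)) (Φ : SeqSpace p → SeqSpace p) : Prop :=
  ∀ z ∈ U, ∀ v w : SeqSpace p, symp (fderiv ℂ Φ z v) (fderiv ℂ Φ z w) = symp v w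

end GBBM

/-! This is one step of Birkhoff normalization. Let `F` have the coefficients of the nonresonant
part of `G` (at most two entries outside `S`, not in normal form) multiplied by `i / (λ_{j₁} + ⋯ +
λ_{j₆})`. Then `dΛ(X_F)` is minus that part (`homological_equation`, `quadHam_bracket`), so the
time-1 map removes it from `H`. The field has degree five, so it moves points by `O(‖z‖⁵)` and
changes a sextic by `O(‖z‖¹⁰)` (`norm_remainder_le`).

The divisors must stay away from zero (`exists_divisor_bound`). With four entries in `S` the divisor
is `a λ_{n₁} + b λ_{n₂} + λ_j + λ_k`, where `j + k` is fixed by `a` and `b`. Its zeros are excluded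
by integer arithmetic: quadratic equations whose discriminants lie between consecutive squares,
together with the separation of the scales `n₁` and `n₂` (`resonance_cases`). Uniformity is then
soft: as `j → ∞` the divisor tends to `a λ_{n₁} + b λ_{n₂}`, which is nonzero unless `a = b = 0`,
and only finitely many pairs `(a, b)` occur.

For the gain of one derivative, `δ_j ≤ |j|^{-1/2}` places `δ z` in `ℓ¹` when `p > 0`. In the
gradient the `δ_j` of the output index absorbs half a power. The relation `∑ jᵢ = 0` moves the
remaining weight to the largest input index, whose own `δ` absorbs another half, and Young's
inequality `ℓ² * ℓ¹ ⊆ ℓ²` closes the estimate (`weighted_modeForm_le`, `tsum_convAt_sq_le`).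

The flow comes from the analytic inverse function theorem on the space of paths, applied to `γ ↦ γ -
∫ X(γ)` (`exists_integralCurves`). Local uniqueness there makes the flow commute with conjugation,
and the variational equation makes it symplectic (`exists_timeOneMap`). -/

namespace GBBM

open Filter Topology

/-! ### Paths on the unit interval, and polynomials given by multilinear maps. -/

section Flow

variable {E E₁ : Type*} [NormedAddCommGroup E] [NormedSpace ℂ E]
  [NormedAddCommGroup E₁] [NormedSpace ℂ E₁]

/-- Continuous paths over the unit interval, with the supremum norm. -/
abbrev Path (E : Type*) [TopologicalSpace E] : Type _ := C(Set.Icc (0 : ℝ) 1, E)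

/-- The path as a function on the line, constant outside the unit interval. -/
noncomputable def Path.ext {E : Type*} [TopologicalSpace E] (γ : Path E) : ℝ → E :=
  Set.IccExtend zero_le_one γ

theorem Path.continuous_ext {E : Type*} [TopologicalSpace E] (γ : Path E) : Continuous γ.ext :=
  γ.continuous.Icc_extend'

theorem Path.ext_coe {E : Type*} [TopologicalSpace E] (γ : Path E) (t : Set.Icc (0 : ℝ) 1) :
    γ.ext t = γ t := Set.IccExtend_val _ _ _

theorem Path.norm_ext_le {E : Type*} [NormedAddCommGroup E] (γ : Path E) (t : ℝ) :
    ‖γ.ext t‖ ≤ ‖γ‖ := γ.norm_coe_le_norm _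

/-- The primitive of a path that vanishes at `0`. -/
noncomputable def primitive : Path E →L[ℂ] Path E :=
  LinearMap.mkContinuous
    { toFun := fun γ => ⟨fun t => ∫ s in (0 : ℝ)..t, γ.ext s,
        (intervalIntegral.continuous_primitive
          (fun a b => γ.continuous_ext.intervalIntegrable a b) 0).comp continuous_subtype_val⟩
      map_add' := fun γ η => by
        ext t
        exact intervalIntegral.integral_add (γ.continuous_ext.intervalIntegrable _ _)
          (η.continuous_ext.intervalIntegrable _ _)
      map_smul' := fun c γ => by
        ext t
        exact intervalIntegral.integral_smul c γ.ext } 1 (fun γ => by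
    refine (ContinuousMap.norm_le _ (by positivity)).2 fun t => ?_
    have h := intervalIntegral.norm_integral_le_of_norm_le_const (a := (0 : ℝ)) (b := t)
      (f := γ.ext) (C := ‖γ‖) fun s _ => γ.norm_ext_le s
    refine h.trans ?_
    have h1 : |(t : ℝ) - 0| ≤ 1 := by rw [sub_zero, abs_of_nonneg t.2.1]; exact t.2.2
    rw [one_mul]
    exact mul_le_of_le_one_right (norm_nonneg _) h1)

theorem primitive_apply (γ : Path E) (t : Set.Icc (0 : ℝ) 1) :
    primitive γ t = ∫ s in (0 : ℝ)..t, γ.ext s := rfl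

/-- A path of the form `z + ∫₀ᵗ g` has derivative `g`. -/
theorem hasDerivWithinAt_of_eq_primitive [CompleteSpace E] {γ g : Path E} {z : E}
    (h : γ = ContinuousMap.const _ z + primitive g) {t : ℝ} (ht : t ∈ Set.Icc (0 : ℝ) 1) :
    HasDerivWithinAt γ.ext (g.ext t) (Set.Icc (0 : ℝ) 1) t := by
  have h1 : HasDerivAt (fun t => z + ∫ s in (0 : ℝ)..t, g.ext s) (g.ext t) t :=
    (intervalIntegral.integral_hasDerivAt_right (g.continuous_ext.intervalIntegrable _ _)
      (g.continuous_ext.stronglyMeasurableAtFilter _ _)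
      g.continuous_ext.continuousAt).const_add z
  refine h1.hasDerivWithinAt.congr (fun s hs => ?_) ?_
  · rw [Path.ext_coe γ ⟨s, hs⟩, h]; rfl
  · rw [Path.ext_coe γ ⟨t, ht⟩, h]; rfl

variable {n : ℕ}

/-- A multilinear map applied to paths pointwise. -/
noncomputable def pointwise (N : ContinuousMultilinearMap ℂ (fun _ : Fin n => E) E₁) :
    ContinuousMultilinearMap ℂ (fun _ : Fin n => Path E) (Path E₁) :=
  MultilinearMap.mkContinuous
    { toFun := fun γ => ⟨fun t => N fun i => γ i t,
        N.cont.comp (continuous_pi fun i => (γ i).continuous)⟩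
      map_update_add' := fun {inst} γ i x y => by
        obtain rfl := Subsingleton.elim inst (instDecidableEqFin n)
        ext t
        have key : ∀ w : Path E, (fun k => Function.update γ i w k t) =
            Function.update (fun k => γ k t) i (w t) := fun w => by
          funext k
          rcases eq_or_ne k i with rfl | h
          · simp
          · simp [h]
        simp only [ContinuousMap.coe_mk, ContinuousMap.add_apply, key, N.map_update_add]
      map_update_smul' := fun {inst} γ i c x => by
        obtain rfl := Subsingleton.elim inst (instDecidableEqFin n)
        ext t
        have key : ∀ w : Path E, (fun k => Function.update γ i w k t) =
            Function.update (fun k => γ k t) i (w t) := fun w => by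
          funext k
          rcases eq_or_ne k i with rfl | h
          · simp
          · simp [h]
        simp only [ContinuousMap.coe_mk, ContinuousMap.smul_apply, key, N.map_update_smul] }
    ‖N‖ (fun γ => by
      refine (ContinuousMap.norm_le _ (by positivity)).2 fun t => ?_
      refine (N.le_opNorm _).trans ?_
      gcongr with i
      exact (γ i).norm_coe_le_norm t)

theorem pointwise_apply (N : ContinuousMultilinearMap ℂ (fun _ : Fin n => E) E₁)
    (γ : Fin n → Path E) (t : Set.Icc (0 : ℝ) 1) :
    pointwise N γ t = N fun i => γ i t := rfl

/-- The homogeneous polynomial of a multilinear map. -/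
def diag (N : ContinuousMultilinearMap ℂ (fun _ : Fin n => E) E₁) (z : E) : E₁ := N fun _ => z

/-- The derivative of the homogeneous polynomial of a multilinear map. -/
noncomputable def diagDeriv (N : ContinuousMultilinearMap ℂ (fun _ : Fin n => E) E₁) (z : E) :
    E →L[ℂ] E₁ :=
  (N.linearDeriv fun _ => z).comp (ContinuousLinearMap.pi fun _ => ContinuousLinearMap.id ℂ E)

theorem diagDeriv_apply (N : ContinuousMultilinearMap ℂ (fun _ : Fin n => E) E₁) (z v : E) :
    diagDeriv N z v = ∑ i, N (Function.update (fun _ => z) i v) := by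
  simp [diagDeriv, ContinuousMultilinearMap.linearDeriv_apply]

theorem hasFDerivAt_diag (N : ContinuousMultilinearMap ℂ (fun _ : Fin n => E) E₁) (z : E) :
    HasFDerivAt (diag N) (diagDeriv N z) z :=
  (N.hasFDerivAt _).comp z
    (ContinuousLinearMap.pi fun _ : Fin n => ContinuousLinearMap.id ℂ E).hasFDerivAt

theorem analyticAt_diag (N : ContinuousMultilinearMap ℂ (fun _ : Fin n => E) E₁) (z : E) :
    AnalyticAt ℂ (diag N) z :=
  N.analyticAt.comp
    ((ContinuousLinearMap.pi fun _ : Fin n => ContinuousLinearMap.id ℂ E).analyticAt z)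

/-- With at least two slots, changing one slot of the zero tuple leaves another one zero. Hence the
linearizations at the origin below are the identity. -/
theorem diagDeriv_zero (N : ContinuousMultilinearMap ℂ (fun _ : Fin n => E) E₁) (hn : 2 ≤ n) :
    diagDeriv N 0 = 0 := by
  ext v
  rw [diagDeriv_apply]
  refine Finset.sum_eq_zero fun i _ => ?_
  have : Nontrivial (Fin n) := Fin.nontrivial_iff_two_le.2 hn
  obtain ⟨k, hk⟩ := exists_ne i
  exact N.map_coord_zero k (by simp [hk])

theorem diag_zero (N : ContinuousMultilinearMap ℂ (fun _ : Fin n => E) E₁) (hn : n ≠ 0) :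
    diag N 0 = 0 :=
  N.map_coord_zero ⟨0, Nat.pos_of_ne_zero hn⟩ rfl

theorem norm_diag_le (N : ContinuousMultilinearMap ℂ (fun _ : Fin n => E) E₁) (z : E) :
    ‖diag N z‖ ≤ ‖N‖ * ‖z‖ ^ n := by
  simpa [diag] using N.le_opNorm fun _ => z

/-- The factor `r ^ (n - 1)` supplies five of the ten powers in the final remainder. -/
theorem norm_diag_sub_le (N : ContinuousMultilinearMap ℂ (fun _ : Fin n => E) E₁) {r : ℝ}
    {z w : E} (hz : ‖z‖ ≤ r) (hw : ‖w‖ ≤ r) :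
    ‖diag N z - diag N w‖ ≤ ‖N‖ * n * r ^ (n - 1) * ‖z - w‖ := by
  -- For `n = 0` the right side is zero, and the polynomial is constant.
  rcases Nat.eq_zero_or_pos n with rfl | hn
  · have : (fun _ : Fin 0 => z) = fun _ => w := Subsingleton.elim _ _
    simp [diag, this]
  have : Nonempty (Fin n) := ⟨⟨0, hn⟩⟩
  have h := N.norm_image_sub_le (fun _ => z) (fun _ => w)
  have e : (fun _ : Fin n => z) - (fun _ => w) = fun _ => z - w := rfl
  rw [e, pi_norm_const, pi_norm_const, pi_norm_const, Fintype.card_fin] at h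
  refine h.trans ?_
  gcongr
  exact max_le hz hw

/-- Evaluation at a time commutes with linearization. This is how the derivative of the solution map
becomes the variational equation. -/
theorem diagDeriv_pointwise (N : ContinuousMultilinearMap ℂ (fun _ : Fin n => E) E₁)
    (γ η : Path E) (t : Set.Icc (0 : ℝ) 1) :
    diagDeriv (pointwise N) γ η t = diagDeriv N (γ t) (η t) := by
  rw [diagDeriv_apply, diagDeriv_apply, ContinuousMap.sum_apply]
  refine Finset.sum_congr rfl fun i _ => ?_
  rw [pointwise_apply]
  congr 1
  funext k
  rcases eq_or_ne k i with rfl | h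
  · simp
  · simp [h]

end Flow

end GBBM

namespace GBBM

open Filter Topology

/-! ### Integral curves by inverting the defect map on paths. -/

section Flow

variable {E E₁ : Type*} [NormedAddCommGroup E] [NormedSpace ℂ E]
  [NormedAddCommGroup E₁] [NormedSpace ℂ E₁] {n : ℕ}

/-- The vector field `z ↦ ι N(z, …, z)` along a path. -/
noncomputable def fieldAlong (N : ContinuousMultilinearMap ℂ (fun _ : Fin n => E) E₁)
    (ι : E₁ →L[ℂ] E) (γ : Path E) : Path E :=
  ι.compLeftContinuous ℂ _ (diag (pointwise N) γ)

theorem fieldAlong_ext (N : ContinuousMultilinearMap ℂ (fun _ : Fin n => E) E₁)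
    (ι : E₁ →L[ℂ] E) (γ : Path E) (t : ℝ) :
    (fieldAlong N ι γ).ext t = ι (diag N (γ.ext t)) := rfl

/-- The defect `γ - ∫ X(γ)` of a path, constant exactly for integral curves. -/
noncomputable def defect (N : ContinuousMultilinearMap ℂ (fun _ : Fin n => E) E₁)
    (ι : E₁ →L[ℂ] E) (γ : Path E) : Path E :=
  γ - primitive (fieldAlong N ι γ)

/-- The derivative of the defect. -/
noncomputable def defectDeriv (N : ContinuousMultilinearMap ℂ (fun _ : Fin n => E) E₁)
    (ι : E₁ →L[ℂ] E) (γ : Path E) : Path E →L[ℂ] Path E :=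
  ContinuousLinearMap.id ℂ _ -
    primitive.comp ((ι.compLeftContinuous ℂ _).comp (diagDeriv (pointwise N) γ))

theorem hasFDerivAt_defect (N : ContinuousMultilinearMap ℂ (fun _ : Fin n => E) E₁)
    (ι : E₁ →L[ℂ] E) (γ : Path E) : HasFDerivAt (defect N ι) (defectDeriv N ι γ) γ :=
  (hasFDerivAt_id γ).sub ((primitive.comp (ι.compLeftContinuous ℂ _)).hasFDerivAt.comp γ
    (hasFDerivAt_diag (pointwise N) γ))

theorem analyticAt_defect (N : ContinuousMultilinearMap ℂ (fun _ : Fin n => E) E₁)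
    (ι : E₁ →L[ℂ] E) (γ : Path E) : AnalyticAt ℂ (defect N ι) γ :=
  analyticAt_id.sub (((primitive.comp (ι.compLeftContinuous ℂ _)).analyticAt _).comp
    (analyticAt_diag (pointwise N) γ))

theorem defect_zero (N : ContinuousMultilinearMap ℂ (fun _ : Fin n => E) E₁)
    (ι : E₁ →L[ℂ] E) (hn : 2 ≤ n) : defect N ι 0 = 0 := by
  simp [defect, fieldAlong, diag_zero (pointwise N) (by omega)]

theorem eq_add_primitive_of_defect_eq {N : ContinuousMultilinearMap ℂ (fun _ : Fin n => E) E₁}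
    {ι : E₁ →L[ℂ] E} {γ : Path E} {z : E} (h : defect N ι γ = ContinuousMap.const _ z) :
    γ = ContinuousMap.const _ z + primitive (fieldAlong N ι γ) := by
  rw [← h, defect, sub_add_cancel]

/-- An inverse function theorem in the analytic category. -/
theorem exists_analytic_inverse [CompleteSpace E] {f : E → E} (hf : AnalyticAt ℂ f 0)
    (hf0 : f 0 = 0) (hd : HasFDerivAt f (ContinuousLinearMap.id ℂ E) 0) :
    ∃ e : OpenPartialHomeomorph E E, ⇑e = f ∧ 0 ∈ e.source ∧ AnalyticAt ℂ e.symm 0 := by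
  have hd' : HasFDerivAt f ((ContinuousLinearEquiv.refl ℂ E : E ≃L[ℂ] E) : E →L[ℂ] E) 0 := hd
  have hs : HasStrictFDerivAt f ((ContinuousLinearEquiv.refl ℂ E : E ≃L[ℂ] E) : E →L[ℂ] E) 0 := by
    have := hf.hasStrictFDerivAt
    rwa [hd'.fderiv] at this
  refine ⟨hs.toOpenPartialHomeomorph f, rfl, hs.mem_toOpenPartialHomeomorph_source, ?_⟩
  have h := (hs.toOpenPartialHomeomorph f).analyticAt_symm'
    hs.mem_toOpenPartialHomeomorph_source hf hd'.fderiv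
  rwa [hs.toOpenPartialHomeomorph_coe, hf0] at h

/-- The integral curves of a polynomial vector field, for small initial values, as an analytic
function of the initial value. -/
theorem exists_integralCurves [CompleteSpace E]
    (N : ContinuousMultilinearMap ℂ (fun _ : Fin n => E) E₁) (ι : E₁ →L[ℂ] E) (hn : 2 ≤ n) :
    ∃ σ : E → Path E, AnalyticAt ℂ σ 0 ∧ σ 0 = 0 ∧
      (∀ᶠ z in 𝓝 0, defect N ι (σ z) = ContinuousMap.const _ z) ∧
      ∀ᶠ γ in 𝓝 (0 : Path E), ∀ z, defect N ι γ = ContinuousMap.const _ z → γ = σ z := by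
  -- A field of degree at least two has no linear part at `0`, so the defect is tangent to the
  -- identity at the zero path.
  have hd : HasFDerivAt (defect N ι) (ContinuousLinearMap.id ℂ (Path E)) 0 := by
    have h := hasFDerivAt_defect N ι 0
    rwa [defectDeriv, diagDeriv_zero _ hn, ContinuousLinearMap.comp_zero,
      ContinuousLinearMap.comp_zero, sub_zero] at h
  obtain ⟨e, he, h0, hsymm⟩ := exists_analytic_inverse (analyticAt_defect N ι 0)
    (defect_zero N ι hn) hd
  have hc0 : ContinuousLinearMap.const ℂ (Set.Icc (0 : ℝ) 1) (0 : E) = 0 := map_zero _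
  have he0 : e 0 = 0 := by rw [he, defect_zero N ι hn]
  -- The curve starting at `z` is the preimage of the constant path `z`.
  refine ⟨fun z => e.symm (ContinuousLinearMap.const ℂ _ z), ?_, ?_, ?_, ?_⟩
  · refine AnalyticAt.comp (g := e.symm) ?_ (ContinuousLinearMap.analyticAt _ _)
    rwa [hc0]
  · simp only [hc0]
    have := e.left_inv h0
    rwa [he0] at this
  · have ht : e.target ∈ 𝓝 (ContinuousLinearMap.const ℂ (Set.Icc (0 : ℝ) 1) (0 : E)) := by
      rw [hc0]
      refine e.open_target.mem_nhds ?_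
      rw [← he0]
      exact e.map_source h0
    filter_upwards [(ContinuousLinearMap.continuous _).continuousAt.eventually ht] with z hz
    have := e.right_inv hz
    rwa [he] at this
  -- Injectivity of the defect near the zero path is the local uniqueness of integral curves.
  · filter_upwards [e.open_source.mem_nhds h0] with γ hγ z hz
    have := e.left_inv hγ
    rw [he, hz] at this
    exact this.symm

end Flow

end GBBM

namespace GBBM

open Filter Topology

/-! ### The time-one map: analyticity, symplecticity and reality. -/

section Flow

variable {E E₁ : Type*} [NormedAddCommGroup E] [NormedSpace ℂ E]
  [NormedAddCommGroup E₁] [NormedSpace ℂ E₁] {n : ℕ}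

/-- If a vector field `X` is Hamiltonian, then its derivative is skew for the symplectic form. -/
theorem symplectic_deriv_add_eq_zero {ω : E →L[ℂ] E →L[ℂ] ℂ} (hω : ∀ v w, ω v w = -ω w v)
    {F : E → ℂ} {X : E → E} (hF : ∀ z, HasFDerivAt F (ω.flip (X z)) z) {z : E} {A : E →L[ℂ] E}
    (hX : HasFDerivAt X A z) (v w : E) : ω (A v) w + ω v (A w) = 0 := by
  have h : HasFDerivAt (fun y => ω.flip (X y)) (ω.flip.comp A) z := ω.flip.hasFDerivAt.comp z hX
  -- The skewness is the symmetry of the second derivative of `F`.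
  have hs := second_derivative_symmetric hF h v w
  simp only [ContinuousLinearMap.comp_apply, ContinuousLinearMap.flip_apply] at hs
  rw [hω (A v) w, hs, neg_add_cancel]

/-- The variational equation preserves the symplectic form. -/
theorem symplectic_of_variational [CompleteSpace E] {ω : E →L[ℂ] E →L[ℂ] ℂ}
    {A : ℝ → E →L[ℂ] E} (hA : ∀ t v w, ω (A t v) w + ω v (A t w) = 0) {V W : ℝ → E}
    (hV : ∀ t ∈ Set.Icc (0 : ℝ) 1, HasDerivWithinAt V (A t (V t)) (Set.Icc 0 1) t)
    (hW : ∀ t ∈ Set.Icc (0 : ℝ) 1, HasDerivWithinAt W (A t (W t)) (Set.Icc 0 1) t) :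
    ω (V 1) (W 1) = ω (V 0) (W 0) := by
  have hd : ∀ t ∈ Set.Icc (0 : ℝ) 1,
      HasDerivWithinAt (fun s => ω (V s) (W s)) 0 (Set.Icc 0 1) t := fun t ht => by
    have h1 := (((ω.restrictScalars ℝ).hasFDerivAt).comp_hasDerivWithinAt t (hV t ht))
    have h2 : HasDerivWithinAt (fun s => (ω (V s)).restrictScalars ℝ)
        ((ω (A t (V t))).restrictScalars ℝ) (Set.Icc 0 1) t :=
      ((ContinuousLinearMap.restrictScalarsL ℂ E ℂ ℝ ℝ).hasFDerivAt).comp_hasDerivWithinAt t h1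
    have h3 := h2.clm_apply (hW t ht)
    simp only [ContinuousLinearMap.coe_restrictScalars'] at h3
    rwa [hA] at h3
  refine constant_of_has_deriv_right_zero (f := fun s => ω (V s) (W s))
    (fun t ht => (hd t ht).continuousWithinAt) (fun t ht => ?_) 1 ⟨zero_le_one, le_rfl⟩
  exact (hd t ⟨ht.1, ht.2.le⟩).mono_of_mem_nhdsWithin (Icc_mem_nhdsGE_of_mem ht)

/-- A map that commutes with the field passes under the time integral, so it sends integral curves
to integral curves. Only real linearity is assumed, since `κ` will be a conjugation. -/
theorem defect_comp {N : ContinuousMultilinearMap ℂ (fun _ : Fin n => E) E₁} {ι : E₁ →L[ℂ] E}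
    [CompleteSpace E] {κ : E →L[ℝ] E} (hκ : ∀ z, κ (ι (diag N z)) = ι (diag N (κ z))) (γ : Path E) :
    defect N ι (κ.compLeftContinuous ℝ _ γ) = κ.compLeftContinuous ℝ _ (defect N ι γ) := by
  rw [defect, defect, map_sub]
  congr 1
  ext t
  have h := κ.intervalIntegral_comp_comm (a := (0 : ℝ)) (b := t)
    ((fieldAlong N ι γ).continuous_ext.intervalIntegrable (μ := MeasureTheory.volume) _ _)
  rw [primitive_apply]
  refine Eq.trans ?_ h
  refine intervalIntegral.integral_congr fun s _ => ?_
  simp only [fieldAlong_ext, hκ]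
  rfl

/-- The time-one map of a homogeneous polynomial Hamiltonian vector field is an analytic symplectic
change of coordinates near the origin, and it commutes with the conjugations that leave the field
invariant. -/
theorem exists_timeOneMap [CompleteSpace E] [CompleteSpace E₁]
    (N : ContinuousMultilinearMap ℂ (fun _ : Fin n => E) E₁) (ι : E₁ →L[ℂ] E) (hn : 2 ≤ n)
    {ω : E →L[ℂ] E →L[ℂ] ℂ} (hω : ∀ v w, ω v w = -ω w v) {F : E → ℂ}
    (hF : ∀ z, HasFDerivAt F (ω.flip (ι (diag N z))) z)
    {κ : E →L[ℝ] E} (hκ : ∀ z, ‖κ z‖ = ‖z‖) (hκN : ∀ z, κ (ι (diag N z)) = ι (diag N (κ z))) :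
    ∃ (Φ : OpenPartialHomeomorph E E) (Ψ : E → E₁) (C : ℝ), 0 ∈ Φ.source ∧ Φ 0 = 0 ∧
      (∀ z ∈ Φ.source, ∃ γ : ℝ → E, γ 0 = z ∧ γ 1 = Φ z ∧ ∀ t ∈ Set.Icc (0 : ℝ) 1,
        HasDerivWithinAt γ (ι (diag N (γ t))) (Set.Icc 0 1) t ∧ ‖γ t‖ ≤ C * ‖z‖) ∧
      AnalyticOnNhd ℂ Φ Φ.source ∧ AnalyticOnNhd ℂ Φ.symm Φ.target ∧
      (∀ z ∈ Φ.source, κ z = z ↔ κ (Φ z) = Φ z) ∧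
      (∀ z ∈ Φ.source, ∀ v w, ω (fderiv ℂ Φ z v) (fderiv ℂ Φ z w) = ω v w) ∧
      AnalyticOnNhd ℂ Ψ Φ.source ∧ ∀ z ∈ Φ.source, Φ z = z + ι (Ψ z) := by
  obtain ⟨σ, hσ, hσ0, hσd, hσu⟩ := exists_integralCurves N ι hn
  let one : Set.Icc (0 : ℝ) 1 := ⟨1, zero_le_one, le_rfl⟩
  -- The time integral is taken in `E₁` and only then mapped to `E`, so that `Φ - id` factors
  -- through the smoother space.
  let L : Path E₁ →L[ℂ] E₁ := (ContinuousMap.evalCLM ℂ one).comp primitive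
  let Ψ : E → E₁ := fun z => L (diag (pointwise N) (σ z))
  let f : E → E := fun z => z + ι (Ψ z)
  have hΨ : ∀ z, AnalyticAt ℂ σ z → AnalyticAt ℂ Ψ z := fun z hz =>
    (L.analyticAt _).comp ((analyticAt_diag (pointwise N) (σ z)).comp hz)
  have hf : ∀ z, AnalyticAt ℂ σ z → AnalyticAt ℂ f z := fun z hz =>
    analyticAt_id.add ((ι.analyticAt _).comp (hΨ z hz))
  have hf0 : f 0 = 0 := by
    simp [f, Ψ, hσ0, diag_zero (pointwise N) (show n ≠ 0 by omega)]
  have hfd : HasFDerivAt f (ContinuousLinearMap.id ℂ E) 0 := by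
    have h1 : HasFDerivAt (diag (pointwise N)) (0 : Path E →L[ℂ] Path E₁) (σ 0) := by
      rw [hσ0, ← diagDeriv_zero (pointwise N) hn]
      exact hasFDerivAt_diag _ _
    have h2 := (hasFDerivAt_id (𝕜 := ℂ) (0 : E)).add
      ((ι.comp L).hasFDerivAt.comp (0 : E) (h1.comp (0 : E) hσ.differentiableAt.hasFDerivAt))
    rwa [ContinuousLinearMap.zero_comp, ContinuousLinearMap.comp_zero, add_zero] at h2
  have hfσ : ∀ z, defect N ι (σ z) = ContinuousMap.const _ z → f z = σ z one := fun z hz => by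
    have h1 := congrArg (fun γ : Path E => γ one) (eq_add_primitive_of_defect_eq hz)
    have h2 := ι.intervalIntegral_comp_comm (a := (0 : ℝ)) (b := one)
      ((diag (pointwise N) (σ z)).continuous_ext.intervalIntegrable
        (μ := MeasureTheory.volume) _ _)
    refine Eq.trans ?_ h1.symm
    exact congrArg (fun x => z + x) h2.symm
  obtain ⟨e, he, he0, hes⟩ := exists_analytic_inverse (hf 0 hσ) hf0 hfd
  -- Differentiability at `0`, in the supremum norm of paths, bounds the whole curve by a multiple
  -- of its initial value.
  obtain ⟨C, hC⟩ := hσ.differentiableAt.hasFDerivAt.isBigO_sub.bound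
  simp only [hσ0, sub_zero] at hC
  have hsymm : ∀ᶠ z in 𝓝 (0 : E), AnalyticAt ℂ e.symm (e z) := by
    have h1 : ContinuousAt e 0 := e.continuousAt he0
    refine h1.eventually ?_
    rw [he, hf0]
    exact hes.eventually_analyticAt
  -- The conjugated curve is a small solution with initial value `κ z`, so uniqueness identifies it
  -- with `σ (κ z)`.
  have hconj : ∀ᶠ z in 𝓝 (0 : E), κ.compLeftContinuous ℝ _ (σ z) = σ (κ z) := by
    have h1 : ContinuousAt (fun z => κ.compLeftContinuous ℝ (Set.Icc (0 : ℝ) 1) (σ z)) 0 :=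
      (ContinuousLinearMap.continuous _).continuousAt.comp hσ.continuousAt
    have h2 : Tendsto (fun z => κ.compLeftContinuous ℝ (Set.Icc (0 : ℝ) 1) (σ z)) (𝓝 0) (𝓝 0) := by
      have h3 := h1.tendsto
      rwa [hσ0, map_zero] at h3
    filter_upwards [h2.eventually hσu, hσd] with z hz hz'
    refine hz (κ z) ?_
    rw [defect_comp hκN, hz']
    rfl
  -- A ball is chosen as domain because the isometry `κ` preserves it.
  obtain ⟨r, hr, hball⟩ := Metric.eventually_nhds_iff_ball.1
    ((hσ.eventually_analyticAt.and hσd).and ((hC.and hsymm).and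
      (hconj.and (e.open_source.mem_nhds he0))))
  have hsrc : (e.restrOpen (Metric.ball 0 r) Metric.isOpen_ball).source = Metric.ball 0 r := by
    rw [e.restrOpen_source]
    exact Set.inter_eq_right.2 fun z hz => (hball z hz).2.2.2
  have hκr : ∀ z ∈ Metric.ball (0 : E) r, κ z ∈ Metric.ball (0 : E) r := fun z hz => by
    rw [mem_ball_zero_iff] at *
    rwa [hκ]
  have hcurve : ∀ z ∈ Metric.ball (0 : E) r, f z = σ z one := fun z hz =>
    hfσ z (hball z hz).1.2
  refine ⟨e.restrOpen (Metric.ball 0 r) Metric.isOpen_ball, Ψ, C, ?_, ?_, ?_, ?_, ?_, ?_, ?_, ?_, ?_⟩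
  · rw [hsrc]
    exact Metric.mem_ball_self hr
  · change e 0 = 0
    rw [he, hf0]
  · rw [hsrc]
    intro z hz
    have hd := eq_add_primitive_of_defect_eq (hball z hz).1.2
    refine ⟨(σ z).ext, ?_, ?_, fun t ht => ⟨hasDerivWithinAt_of_eq_primitive hd ht, ?_⟩⟩
    · have h1 := congrArg (fun γ : Path E => γ ⟨0, le_rfl, zero_le_one⟩) hd
      refine ((σ z).ext_coe ⟨0, le_rfl, zero_le_one⟩).trans (h1.trans ?_)
      simp [primitive_apply]
    · refine ((σ z).ext_coe one).trans ?_
      rw [← hcurve z hz]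
      exact (congrFun he z).symm
    · exact ((σ z).norm_ext_le t).trans (hball z hz).2.1.1
  · rw [hsrc]
    intro z hz
    change AnalyticAt ℂ e z
    rw [he]
    exact hf z (hball z hz).1.1
  · intro y hy
    have h1 := (e.restrOpen (Metric.ball 0 r) Metric.isOpen_ball).map_target hy
    have h2 := (e.restrOpen (Metric.ball 0 r) Metric.isOpen_ball).right_inv hy
    rw [hsrc] at h1
    have h3 := (hball _ h1).2.1.2
    change e _ = y at h2
    rw [h2] at h3
    exact h3
  · rw [hsrc]
    intro z hz
    change κ z = z ↔ κ (e z) = e z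
    have h1 : κ (e z) = e (κ z) := by
      rw [he, hcurve z hz, hcurve _ (hκr z hz), ← (hball z hz).2.2.1]
      rfl
    rw [h1]
    exact (e.injOn.eq_iff (hball _ (hκr z hz)).2.2.2 (hball z hz).2.2.2).symm
  · rw [hsrc]
    intro z hz v w
    change ω (fderiv ℂ e z v) (fderiv ℂ e z w) = ω v w
    set D : E →L[ℂ] Path E := fderiv ℂ σ z with hD
    have hσz : HasFDerivAt σ D z := (hball z hz).1.1.differentiableAt.hasFDerivAt
    have hnhds : Metric.ball (0 : E) r ∈ 𝓝 z := Metric.isOpen_ball.mem_nhds hz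
    have hfd : ∀ v, fderiv ℂ e z v = (D v).ext 1 := fun v => by
      have h1 : HasFDerivAt f ((ContinuousMap.evalCLM ℂ one).comp D) z :=
        ((ContinuousMap.evalCLM ℂ one).hasFDerivAt.comp z hσz).congr_of_eventuallyEq
          (by filter_upwards [hnhds] with y hy using hcurve y hy)
      rw [he, h1.fderiv]
      exact ((D v).ext_coe one).symm
    -- Differentiating `defect (σ y) = y` in `y` gives the variational equation in integral form.
    have hvar : ∀ v, D v = ContinuousMap.const _ v +
        primitive (ι.compLeftContinuous ℂ _ (diagDeriv (pointwise N) (σ z) (D v))) := fun v => by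
      have h1 : HasFDerivAt (fun y => defect N ι (σ y)) ((defectDeriv N ι (σ z)).comp D) z :=
        (hasFDerivAt_defect N ι (σ z)).comp z hσz
      have h0 : (fun y => defect N ι (σ y)) =ᶠ[𝓝 z]
          ContinuousLinearMap.const ℂ (Set.Icc (0 : ℝ) 1) := by
        filter_upwards [hnhds] with y hy using (hball y hy).1.2
      have h2 := (ContinuousLinearMap.hasFDerivAt _).congr_of_eventuallyEq h0
      have h3 := congrArg (fun A : E →L[ℂ] Path E => A v) (h1.unique h2)
      exact sub_eq_iff_eq_add.1 h3
    have hder : ∀ v, ∀ t ∈ Set.Icc (0 : ℝ) 1, HasDerivWithinAt (D v).ext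
        ((ι.comp (diagDeriv N ((σ z).ext t))) ((D v).ext t)) (Set.Icc 0 1) t := fun v t ht => by
      have h1 := hasDerivWithinAt_of_eq_primitive (hvar v) ht
      have h2 := diagDeriv_pointwise N (σ z) (D v) (Set.projIcc 0 1 zero_le_one t)
      have h3 := congrArg ι h2
      exact h1.congr_deriv h3
    have hinit : ∀ v, (D v).ext 0 = v := fun v => by
      have h1 := congrArg (fun γ : Path E => γ ⟨0, le_rfl, zero_le_one⟩) (hvar v)
      refine ((D v).ext_coe ⟨0, le_rfl, zero_le_one⟩).trans (h1.trans ?_)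
      simp [primitive_apply]
    rw [hfd, hfd, symplectic_of_variational (A := fun t => ι.comp (diagDeriv N ((σ z).ext t)))
      (fun t => symplectic_deriv_add_eq_zero hω hF
        (ι.hasFDerivAt.comp _ (hasFDerivAt_diag N ((σ z).ext t)))) (hder v) (hder w), hinit, hinit]
  · rw [hsrc]
    exact fun z hz => hΨ z (hball z hz).1.1
  · intro z _
    exact congrFun he z

end Flow

end GBBM

namespace GBBM

/-! ### Arithmetic of resonances of the dispersion relation. -/

section Divisors

/-- The dispersion relation `x / (1 + x²)` on the integers. -/
noncomputable def disp (x : ℤ) : ℝ := (x : ℝ) / (1 + (x : ℝ) ^ 2)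

theorem disp_neg (x : ℤ) : disp (-x) = -disp x := by
  simp [disp, neg_div]

theorem abs_disp_mul_le (x : ℤ) : |disp x| * |(x : ℝ)| ≤ 1 := by
  have h : (0 : ℝ) < 1 + (x : ℝ) ^ 2 := by positivity
  rw [disp, abs_div, abs_of_pos h, div_mul_eq_mul_div, div_le_one h, abs_mul_abs_self]
  nlinarith

theorem abs_disp_le {x : ℤ} {c : ℝ} (hc : 0 < c) (hx : c ≤ |(x : ℝ)|) : |disp x| ≤ 1 / c := by
  rw [le_div_iff₀ hc]
  exact (mul_le_mul_of_nonneg_left hx (abs_nonneg _)).trans (abs_disp_mul_le x)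

theorem le_disp {n : ℤ} (hn : 1 ≤ n) : 1 / (2 * (n : ℝ)) ≤ disp n := by
  have h : (1 : ℝ) ≤ n := by exact_mod_cast hn
  rw [disp, div_le_div_iff₀ (by positivity) (by positivity)]
  nlinarith

/-- Two squares that differ by less than a gap are equal. -/
theorem not_sq_of_between {x m c : ℤ} (hm : 0 ≤ m) (h1 : m ^ 2 < c) (h2 : c < (m + 1) ^ 2) :
    x ^ 2 ≠ c := by
  intro h
  have h3 : |x| < m + 1 := by
    apply abs_lt_of_sq_lt_sq _ (by omega)
    rwa [h]
  have h4 : m < |x| := by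
    apply lt_of_pow_lt_pow_left₀ 2 (abs_nonneg _)
    rwa [sq_abs, h]
  omega

/-- If `j + k = a n` then a resonance `λ_j + λ_k = a λ_n` is a polynomial identity. -/
theorem resonance_poly {a n j k : ℤ} (ha : a ≠ 0) (hn : n ≠ 0) (hs : j + k = a * n)
    (h : disp j + disp k = a * disp n) :
    (1 + j ^ 2) * (1 + k ^ 2) = (1 + j * k) * (1 + n ^ 2) := by
  have hj : (1 : ℝ) + (j : ℝ) ^ 2 ≠ 0 := by positivity
  have hk : (1 : ℝ) + (k : ℝ) ^ 2 ≠ 0 := by positivity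
  have hn' : (1 : ℝ) + (n : ℝ) ^ 2 ≠ 0 := by positivity
  unfold disp at h
  field_simp at h
  have h1 : (j * (1 + k ^ 2) + k * (1 + j ^ 2)) * (1 + n ^ 2) =
      a * n * ((1 + j ^ 2) * (1 + k ^ 2)) := by
    have : (((j * (1 + k ^ 2) + k * (1 + j ^ 2)) * (1 + n ^ 2) : ℤ) : ℝ) =
        ((a * n * ((1 + j ^ 2) * (1 + k ^ 2)) : ℤ) : ℝ) := by
      push_cast
      linear_combination h
    exact_mod_cast this
  -- The numerator of `λ_j + λ_k` is `(j + k)(1 + j k)`, and `j + k = a n` cancels.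
  have h2 : (a * n) * ((1 + j ^ 2) * (1 + k ^ 2)) = (a * n) * ((1 + j * k) * (1 + n ^ 2)) := by
    rw [← h1, ← hs]
    ring
  exact mul_left_cancel₀ (mul_ne_zero ha hn) h2

/-- With `P = j k` the resonance polynomial factors as `(P - n²)(P - 3)`. The first root gives `(j -
n)² = 0`; the second would make `n² - 3` a square. -/
theorem resonance_two {n j k : ℤ} (hn : 20 ≤ n) (hs : j + k = 2 * n)
    (h : disp j + disp k = 2 * disp n) : j = n ∧ k = n := by
  have hp := resonance_poly (a := 2) two_ne_zero (by omega) hs (by exact_mod_cast h)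
  obtain rfl : k = 2 * n - j := by omega
  have h1 : (j * (2 * n - j) - n ^ 2) * (j * (2 * n - j) - 3) = 0 := by
    linear_combination hp
  rcases mul_eq_zero.1 h1 with h2 | h2
  · have h3 : (j - n) ^ 2 = 0 := by linear_combination -h2
    have h4 := pow_eq_zero_iff (two_ne_zero) |>.1 h3
    omega
  · exact absurd (show (j - n) ^ 2 = n ^ 2 - 3 by linear_combination -h2)
      (not_sq_of_between (m := n - 1) (by omega) (by nlinarith) (by nlinarith))

/-- The quadratic for `j k` has discriminant `n⁴ - 54 n² + 9`, which lies strictly between `(n² -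
28)²` and `(n² - 27)²`. The lower inequality requires `2 n² > 775`, so `20` is the first admissible
`n`. -/
theorem resonance_four {n j k : ℤ} (hn : 20 ≤ n) (hs : j + k = 4 * n) :
    disp j + disp k ≠ 4 * disp n := by
  intro h
  have hp := resonance_poly (a := 4) four_ne_zero (by omega) hs (by exact_mod_cast h)
  obtain rfl : k = 4 * n - j := by omega
  exact not_sq_of_between (m := n ^ 2 - 28) (by nlinarith) (by nlinarith) (by nlinarith)
    (show (2 * (j * (4 * n - j)) - (n ^ 2 + 3)) ^ 2 = n ^ 4 - 54 * n ^ 2 + 9 by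
      linear_combination 4 * hp)

theorem disp_add_poly {a n j : ℤ} :
    a * disp n + disp j =
      ((a * n * (1 + j ^ 2) + j * (1 + n ^ 2) : ℤ) : ℝ) / ((1 + (n : ℝ) ^ 2) * (1 + (j : ℝ) ^ 2)) := by
  have hj : (1 : ℝ) + (j : ℝ) ^ 2 ≠ 0 := by positivity
  have hn' : (1 : ℝ) + (n : ℝ) ^ 2 ≠ 0 := by positivity
  unfold disp
  push_cast
  field_simp

theorem poly_of_disp_add_eq_zero {a n j : ℤ} (h : a * disp n + disp j = 0) :
    a * n * (1 + j ^ 2) + j * (1 + n ^ 2) = 0 := by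
  rw [disp_add_poly, div_eq_zero_iff] at h
  rcases h with h | h
  · exact_mod_cast h
  · exact absurd h (by positivity)

/-- A nonzero fraction with integer numerator is at least the reciprocal of its denominator. -/
theorem le_abs_disp_add {a n j : ℤ} (h : a * disp n + disp j ≠ 0) :
    1 / ((1 + (n : ℝ) ^ 2) * (1 + (j : ℝ) ^ 2)) ≤ |a * disp n + disp j| := by
  have h0 : (0 : ℝ) < (1 + (n : ℝ) ^ 2) * (1 + (j : ℝ) ^ 2) := by positivity
  rw [disp_add_poly] at h ⊢
  rw [abs_div, abs_of_pos h0]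
  gcongr
  have h1 : a * n * (1 + j ^ 2) + j * (1 + n ^ 2) ≠ 0 := by
    intro h2
    rw [h2] at h
    simp at h
  have h2 := Int.one_le_abs h1
  exact_mod_cast h2

/-- A single mode resonates with a multiple `a` of the mode `n` only if it is the mode itself. -/
theorem eq_of_disp_add_eq_zero {a n j : ℤ} (hn : 20 ≤ n) (ha0 : a ≠ 0) (ha : |a| ≤ 3)
    (h : a * disp n + disp j = 0) : (a = 1 ∧ j = -n) ∨ (a = -1 ∧ j = n) := by
  have hp := poly_of_disp_add_eq_zero h
  -- Completing the square in the quadratic for `j`: for `|a| = 2, 3` the discriminant falls between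
  -- consecutive squares, while for `|a| = 1` the quadratic factors.
  have hsq : (2 * a * n * j + (1 + n ^ 2)) ^ 2 = (1 + n ^ 2) ^ 2 - 4 * a ^ 2 * n ^ 2 := by
    linear_combination 4 * a * n * hp
  rw [abs_le] at ha
  have hcase : a = 1 ∨ a = -1 ∨ a ^ 2 = 4 ∨ a ^ 2 = 9 := by
    have : a = 1 ∨ a = -1 ∨ a = 2 ∨ a = -2 ∨ a = 3 ∨ a = -3 := by omega
    rcases this with rfl | rfl | rfl | rfl | rfl | rfl <;> norm_num
  rcases hcase with rfl | rfl | h4 | h9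
  · left
    have h1 : (n * j + 1) * (j + n) = 0 := by linear_combination hp
    rcases mul_eq_zero.1 h1 with h2 | h2
    · have h3 : n ∣ 1 := ⟨-j, by linear_combination h2⟩
      have := Int.le_of_dvd one_pos h3
      omega
    · exact ⟨rfl, by omega⟩
  · right
    have h1 : (n * j - 1) * (j - n) = 0 := by linear_combination -hp
    rcases mul_eq_zero.1 h1 with h2 | h2
    · have h3 : n ∣ 1 := ⟨j, by linear_combination -h2⟩
      have := Int.le_of_dvd one_pos h3
      omega
    · exact ⟨rfl, by omega⟩
  · rw [h4] at hsq
    exact absurd hsq (not_sq_of_between (m := n ^ 2 - 8) (by nlinarith) (by nlinarith)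
      (by nlinarith))
  · rw [h9] at hsq
    exact absurd hsq (not_sq_of_between (m := n ^ 2 - 18) (by nlinarith) (by nlinarith)
      (by nlinarith))

/-- A lower bound for the second tangential site in terms of the first one. -/
def siteBound (n : ℤ) : ℤ := 8 * ((1 + n ^ 2) * (1 + 16 * n ^ 2))

theorem siteBound_ge {n : ℤ} (hn : 20 ≤ n) : 100 * n ≤ siteBound n := by
  unfold siteBound
  nlinarith [mul_pos (show (0 : ℤ) < n by omega) (show (0 : ℤ) < n by omega), sq_nonneg (n ^ 2)]

/-- Separation of scales. As `b ≠ 0`, the larger mode has size at least `m / 4`, so `b λ_m + λ_k` is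
at most `7 / m`. A nonzero `a λ_n + λ_j` is at least `1 / ((1 + n²)(1 + 16 n²))`, which is at least
`8 / m` by the choice of `siteBound`. -/
theorem disp_add_eq_zero_of_resonance {a b n m j k : ℤ} (hn : 20 ≤ n) (hm : siteBound n ≤ m)
    (ha0 : a ≠ 0) (hb0 : b ≠ 0) (ha : |a| ≤ 3) (hb : |b| ≤ 3) (hs : j + k + a * n + b * m = 0)
    (hjk : |j| ≤ |k|) (h : a * disp n + b * disp m + disp j + disp k = 0) :
    a * disp n + disp j = 0 := by
  by_contra hne
  have hmn := (siteBound_ge hn).trans hm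
  have hk : m ≤ 4 * |k| := by
    have h1 : |b| * m ≤ |j| + |k| + |a| * n := by
      have e : b * m = -(j + k + a * n) := by linarith
      calc |b| * m = |b * m| := by rw [abs_mul, abs_of_pos (show (0 : ℤ) < m by omega)]
        _ ≤ |j| + |k| + |a * n| := by
          rw [e, abs_neg]
          exact abs_add_three _ _ _
        _ = _ := by rw [abs_mul a, abs_of_pos (show (0 : ℤ) < n by omega)]
    have h2 : m ≤ |b| * m := le_mul_of_one_le_left (by omega) (Int.one_le_abs hb0)
    have h3 : |a| * n ≤ 3 * n := mul_le_mul_of_nonneg_right ha (by omega)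
    omega
  have hnR : (20 : ℝ) ≤ n := by exact_mod_cast hn
  have hmR : 8 * ((1 + (n : ℝ) ^ 2) * (1 + 16 * (n : ℝ) ^ 2)) ≤ m := by
    have : ((siteBound n : ℤ) : ℝ) ≤ m := by exact_mod_cast hm
    simpa [siteBound] using this
  have hm0 : (0 : ℝ) < m := lt_of_lt_of_le (by positivity) hmR
  have hkR : (m : ℝ) / 4 ≤ |(k : ℝ)| := by
    have : (m : ℝ) ≤ 4 * |(k : ℝ)| := by exact_mod_cast hk
    linarith
  have hrest : |a * disp n + disp j| ≤ 7 / m := by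
    have e : a * disp n + disp j = -(b * disp m + disp k) := by linarith
    have h1 : |disp k| ≤ 4 / m := by
      have := abs_disp_le (by positivity) hkR
      rwa [one_div_div] at this
    have h2 : |(b : ℝ) * disp m| ≤ 3 * (1 / m) := by
      rw [abs_mul]
      have hb' : |(b : ℝ)| ≤ 3 := by exact_mod_cast hb
      have := abs_disp_le hm0 (le_abs_self (m : ℝ))
      gcongr
    rw [e, abs_neg]
    calc _ ≤ |(b : ℝ) * disp m| + |disp k| := abs_add_le _ _
      _ ≤ 3 * (1 / m) + 4 / m := add_le_add h2 h1
      _ = 7 / m := by ring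
  have hlow : 1 / ((1 + (n : ℝ) ^ 2) * (1 + 16 * (n : ℝ) ^ 2)) ≤ |a * disp n + disp j| := by
    -- For `|j| ≤ 4 n` integrality of the numerator suffices; beyond that `λ_j` is at most half of
    -- the lower bound `1 / (2 n)` for `|a λ_n|`.
    rcases le_or_gt |(j : ℝ)| (4 * n) with hj | hj
    · refine le_trans ?_ (le_abs_disp_add hne)
      have : (j : ℝ) ^ 2 ≤ 16 * (n : ℝ) ^ 2 := by
        rw [← sq_abs (j : ℝ)]
        nlinarith [abs_nonneg (j : ℝ)]
      gcongr
    · have h1 := abs_disp_le (by positivity) hj.le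
      have h2 : 1 / (2 * (n : ℝ)) ≤ |(a : ℝ) * disp n| := by
        rw [abs_mul]
        have h3 := le_disp (show 1 ≤ n by omega)
        have h4 : (1 : ℝ) ≤ |(a : ℝ)| := by exact_mod_cast Int.one_le_abs ha0
        have h5 := le_abs_self (disp n)
        have h6 : (0 : ℝ) < 1 / (2 * (n : ℝ)) := by positivity
        nlinarith
      have h3 : |(a : ℝ) * disp n| ≤ |a * disp n + disp j| + |disp j| := by
        have := abs_sub (a * disp n + disp j) (disp j)
        rwa [add_sub_cancel_right] at this
      have h4 : 1 / (2 * (n : ℝ)) = 1 / (4 * n) + 1 / (4 * n) := by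
        field_simp
        norm_num
      have h5 : 1 / ((1 + (n : ℝ) ^ 2) * (1 + 16 * (n : ℝ) ^ 2)) ≤ 1 / (4 * n) :=
        one_div_le_one_div_of_le (by positivity) (by nlinarith [sq_nonneg ((n : ℝ) ^ 2)])
      linarith
  have h1 := hlow.trans hrest
  rw [div_le_div_iff₀ (by positivity) hm0] at h1
  nlinarith [show (0 : ℝ) < (1 + (n : ℝ) ^ 2) * (1 + 16 * (n : ℝ) ^ 2) by positivity]

/-- The scale `n` resonates by itself, which forces `a = ±1` and `j = -a n`. Momentum then gives `k
= -b m`, and the remaining equation reduces to `b m³ (b² - 1) = 0`. -/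
theorem resonance_mixed {a b n m j k : ℤ} (hn : 20 ≤ n) (hm : siteBound n ≤ m)
    (ha0 : a ≠ 0) (hb0 : b ≠ 0) (hab : |a| + |b| ≤ 4) (hpar : 2 ∣ a + b)
    (hs : j + k + a * n + b * m = 0)
    (hjk : |j| ≤ |k|) (h : a * disp n + b * disp m + disp j + disp k = 0) :
    (j = n ∨ j = -n) ∧ (k = m ∨ k = -m) := by
  have ha1 := Int.one_le_abs ha0
  have hb1 := Int.one_le_abs hb0
  have hmn := (siteBound_ge hn).trans hm
  have h1 := disp_add_eq_zero_of_resonance hn hm ha0 hb0 (by omega) (by omega) hs hjk h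
  have h2 := eq_of_disp_add_eq_zero hn ha0 (by omega) h1
  have hk : k = -b * m := by
    rcases h2 with ⟨rfl, rfl⟩ | ⟨rfl, rfl⟩ <;> linarith
  have h3 : disp k + b * disp m = 0 := by linarith
  have hb : b = 1 ∨ b = -1 ∨ b = 3 ∨ b = -3 := by
    have hb3 := abs_le.1 (show |b| ≤ 3 by omega)
    rcases h2 with ⟨rfl, -⟩ | ⟨rfl, -⟩ <;> omega
  have h4 : (b ^ 2 - 1) = 0 := by
    have hm0 : m ≠ 0 := by omega
    have h5 := poly_of_disp_add_eq_zero (a := b) (n := m) (j := k) (by linarith)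
    rw [hk] at h5
    have h6 : (b * m ^ 3) * (b ^ 2 - 1) = 0 := by linear_combination h5
    exact (mul_eq_zero.1 h6).resolve_left (mul_ne_zero hb0 (pow_ne_zero 3 hm0))
  refine ⟨by omega, ?_⟩
  rcases hb with rfl | rfl | rfl | rfl
  · right; linarith
  · left; linarith
  · norm_num at h4
  · norm_num at h4

/-- Parity leaves `a = ±2, ±4`, and oddness of the dispersion relation reduces these to
`resonance_two` and `resonance_four`. -/
theorem resonance_single {a n j k : ℤ} (hn : 20 ≤ n) (ha0 : a ≠ 0) (ha : |a| ≤ 4) (hpar : 2 ∣ a)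
    (hs : j + k + a * n = 0) (h : a * disp n + disp j + disp k = 0) :
    (j = n ∨ j = -n) ∧ (k = n ∨ k = -n) := by
  rw [abs_le] at ha
  have : a = 2 ∨ a = -2 ∨ a = 4 ∨ a = -4 := by omega
  rcases this with rfl | rfl | rfl | rfl
  · have := resonance_two (n := n) (j := -j) (k := -k) hn (by omega)
      (by rw [disp_neg, disp_neg]; push_cast at h; linarith)
    omega
  · have := resonance_two (n := n) (j := j) (k := k) hn (by omega) (by push_cast at h; linarith)
    omega
  · exact absurd (by rw [disp_neg, disp_neg]; push_cast at h; linarith)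
      (resonance_four (n := n) (j := -j) (k := -k) hn (by omega))
  · exact absurd (by push_cast at h; linarith)
      (resonance_four (n := n) (j := j) (k := k) hn (by omega))

/-- The resonances between four tangential modes, which add up to `a` times the first and `b` times
the second site, and two further modes. -/
theorem resonance_cases {a b n m j k : ℤ} (hn : 20 ≤ n) (hm : siteBound n ≤ m)
    (hab : |a| + |b| ≤ 4) (hpar : 2 ∣ a + b) (hs : j + k + a * n + b * m = 0)
    (h : a * disp n + b * disp m + disp j + disp k = 0) :
    (a = 0 ∧ b = 0) ∨
      ((j = n ∨ j = -n ∨ j = m ∨ j = -m) ∧ (k = n ∨ k = -n ∨ k = m ∨ k = -m)) := by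
  have hmn := (siteBound_ge hn).trans hm
  have ha' := abs_nonneg a
  have hb' := abs_nonneg b
  rcases eq_or_ne a 0 with rfl | ha
  · rcases eq_or_ne b 0 with rfl | hb
    · exact Or.inl ⟨rfl, rfl⟩
    · have := resonance_single (a := b) (n := m) (j := j) (k := k) (by omega) hb (by omega)
        (by simpa using hpar) (by linarith) (by push_cast at h; linarith)
      omega
  · rcases eq_or_ne b 0 with rfl | hb
    · have := resonance_single (a := a) (n := n) (j := j) (k := k) (by omega) ha (by omega)
        (by simpa using hpar) (by linarith) (by push_cast at h; linarith)
      omega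
    · rcases le_total |j| |k| with hjk | hjk
      · have := resonance_mixed hn hm ha hb hab hpar hs hjk h
        omega
      · have := resonance_mixed (j := k) (k := j) hn hm ha hb hab hpar (by linarith) hjk
          (by linarith)
        omega

end Divisors

end GBBM

namespace GBBM

open Filter Topology

/-! ### Resonant sextuples and the uniform lower bound for the divisors. -/

section Resonances

/-- The coefficient of the site `n` in an element of `{±n, ±m}`. -/
def siteCoeff (n x : ℤ) : ℤ := if x = n then 1 else if x = -n then -1 else 0

variable {n₁ n₂ : ℕ}

theorem mem_tangSites {x : ℤ} :
    x ∈ tangSites n₁ n₂ ↔ x = n₁ ∨ x = -n₁ ∨ x = n₂ ∨ x = -n₂ := by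
  simp [tangSites]

theorem siteCoeff_cases (h1 : 0 < n₁) (h12 : n₁ < n₂) {x : ℤ} (hx : x ∈ tangSites n₁ n₂) :
    (x = n₁ ∧ siteCoeff n₁ x = 1 ∧ siteCoeff n₂ x = 0) ∨
    (x = -n₁ ∧ siteCoeff n₁ x = -1 ∧ siteCoeff n₂ x = 0) ∨
    (x = n₂ ∧ siteCoeff n₁ x = 0 ∧ siteCoeff n₂ x = 1) ∨
    (x = -n₂ ∧ siteCoeff n₁ x = 0 ∧ siteCoeff n₂ x = -1) := by
  rw [mem_tangSites] at hx
  unfold siteCoeff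
  split_ifs <;> omega

/-- Summed over four tangential entries, this gives `|a| + |b| ≤ 4` and the evenness of `a + b`. -/
theorem siteCoeff_abs_add (h1 : 0 < n₁) (h12 : n₁ < n₂) {x : ℤ} (hx : x ∈ tangSites n₁ n₂) :
    |siteCoeff n₁ x| + |siteCoeff n₂ x| = 1 ∧
      ∃ c, siteCoeff n₁ x + siteCoeff n₂ x = 2 * c + 1 := by
  rcases siteCoeff_cases h1 h12 hx with ⟨-, h, h'⟩ | ⟨-, h, h'⟩ | ⟨-, h, h'⟩ | ⟨-, h, h'⟩ <;>
    rw [h, h'] <;> refine ⟨by norm_num, ?_⟩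
  exacts [⟨0, rfl⟩, ⟨-1, rfl⟩, ⟨0, rfl⟩, ⟨-1, rfl⟩]

theorem eq_siteCoeff (h1 : 0 < n₁) (h12 : n₁ < n₂) {x : ℤ} (hx : x ∈ tangSites n₁ n₂) :
    x = siteCoeff n₁ x * n₁ + siteCoeff n₂ x * n₂ := by
  rcases siteCoeff_cases h1 h12 hx with ⟨h, h', h''⟩ | ⟨h, h', h''⟩ | ⟨h, h', h''⟩ | ⟨h, h', h''⟩ <;>
    rw [h', h''] <;> omega

theorem disp_siteCoeff (h1 : 0 < n₁) (h12 : n₁ < n₂) {x : ℤ} (hx : x ∈ tangSites n₁ n₂) :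
    disp x = siteCoeff n₁ x * disp n₁ + siteCoeff n₂ x * disp n₂ := by
  rcases siteCoeff_cases h1 h12 hx with ⟨h, h', h''⟩ | ⟨h, h', h''⟩ | ⟨h, h', h''⟩ | ⟨h, h', h''⟩ <;>
    rw [h', h'', h] <;> simp [disp_neg]

theorem abs_siteCoeff_le (n x : ℤ) : |siteCoeff n x| ≤ 1 := by
  unfold siteCoeff
  split_ifs <;> simp

/-- A relation `A n₁ + B n₂ = 0` with `|A| ≤ 6` is trivial because `n₂` exceeds `6 n₁`. -/
theorem siteCoeff_sum_eq_zero (h1 : 0 < n₁) (h12 : 100 * n₁ ≤ n₂) {ι : Type*} {s : Finset ι}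
    (hs : s.card ≤ 6) {J : ι → ℤ} (hJ : ∀ i ∈ s, J i ∈ tangSites n₁ n₂) (h : ∑ i ∈ s, J i = 0) :
    ∑ i ∈ s, siteCoeff n₁ (J i) = 0 ∧ ∑ i ∈ s, siteCoeff n₂ (J i) = 0 := by
  have h12' : n₁ < n₂ := by omega
  set A := ∑ i ∈ s, siteCoeff n₁ (J i) with hA
  set B := ∑ i ∈ s, siteCoeff n₂ (J i) with hB
  have hAB : A * n₁ + B * n₂ = 0 := by
    rw [hA, hB, Finset.sum_mul, Finset.sum_mul, ← Finset.sum_add_distrib, ← h]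
    exact Finset.sum_congr rfl fun i hi => (eq_siteCoeff h1 h12' (hJ i hi)).symm
  have hA6 : |A| ≤ 6 := by
    refine (Finset.abs_sum_le_sum_abs _ _).trans
      ((Finset.sum_le_card_nsmul _ _ 1 fun i _ => abs_siteCoeff_le _ _).trans ?_)
    have : (s.card : ℤ) ≤ 6 := by exact_mod_cast hs
    simpa using this
  have hB0 : B = 0 := by
    by_contra hB0
    have h2 : (n₂ : ℤ) ≤ |B| * n₂ := le_mul_of_one_le_left (by omega) (Int.one_le_abs hB0)
    have h3 : |B| * n₂ = |A| * n₁ := by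
      have : B * n₂ = -(A * n₁) := by linarith
      rw [← Nat.abs_cast n₂, ← abs_mul, this, abs_neg, abs_mul, Nat.abs_cast n₁]
    have h4 : |A| * n₁ ≤ 6 * n₁ := mul_le_mul_of_nonneg_right hA6 (by omega)
    omega
  refine ⟨?_, hB0⟩
  rw [hB0, zero_mul, add_zero] at hAB
  exact (mul_eq_zero.1 hAB).resolve_right (by omega)

/-- Without an opposite entry, all contributions to the coefficient of the site of `J i₀` would have
one sign and one of them would be nonzero, so their sum could not vanish. -/
theorem exists_partner (h1 : 0 < n₁) (h12 : 100 * n₁ ≤ n₂) {ι : Type*} {s : Finset ι}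
    (hs : s.card ≤ 6) {J : ι → ℤ} (hJ : ∀ i ∈ s, J i ∈ tangSites n₁ n₂) (h : ∑ i ∈ s, J i = 0)
    {i₀ : ι} (hi₀ : i₀ ∈ s) : ∃ i ∈ s, J i = -J i₀ := by
  obtain ⟨hA, hB⟩ := siteCoeff_sum_eq_zero h1 h12 hs hJ h
  by_contra! hne
  have key : ∀ f : ℤ → ℤ, 0 < f (J i₀) → (∀ i ∈ s, 0 ≤ f (J i)) → ∑ i ∈ s, f (J i) ≠ 0 :=
    fun f h0 hf => (Finset.sum_pos' hf ⟨i₀, hi₀, h0⟩).ne'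
  have hc : ∀ i ∈ s, _ := fun i hi => siteCoeff_cases h1 (show n₁ < n₂ by omega) (hJ i hi)
  rcases hc i₀ hi₀ with h | h | h | h
  · refine key (siteCoeff n₁) (by omega) (fun i hi => ?_) hA
    have := hc i hi
    have := hne i hi
    omega
  · refine key (fun x => -siteCoeff n₁ x) (by omega) (fun i hi => ?_) (by simpa using hA)
    have := hc i hi
    have := hne i hi
    omega
  · refine key (siteCoeff n₂) (by omega) (fun i hi => ?_) hB
    have := hc i hi
    have := hne i hi
    omega
  · refine key (fun x => -siteCoeff n₂ x) (by omega) (fun i hi => ?_) (by simpa using hB)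
    have := hc i hi
    have := hne i hi
    omega

theorem neg_val (j : Zbar) : ((-j : Zbar) : ℤ) = -(j : ℤ) := rfl

theorem mem_normalSet_of_comp {J : Fin 6 → Zbar} {τ : Equiv.Perm (Fin 6)}
    (h : J ∘ τ ∈ normalSet) : J ∈ normalSet := by
  obtain ⟨a, b, c, ρ, h⟩ := h
  exact ⟨a, b, c, ρ.trans τ, h⟩

theorem mem_normalSet_of_pairs {J : Fin 6 → Zbar} (h0 : (J 0 : ℤ) + J 1 = 0)
    (h2 : (J 2 : ℤ) + J 3 = 0) (h4 : (J 4 : ℤ) + J 5 = 0) : J ∈ normalSet := by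
  have e : ∀ x y : Zbar, (x : ℤ) + y = 0 → y = -x := fun x y h =>
    Subtype.ext (by rw [neg_val]; omega)
  refine ⟨J 0, J 2, J 4, 1, ?_⟩
  funext i
  fin_cases i
  · rfl
  · exact e _ _ h0
  · rfl
  · exact e _ _ h2
  · rfl
  · exact e _ _ h4

/-- The entry `0` has a partner among the four tangential places; once that pair is removed, the
other two tangential entries are opposite. -/
theorem mem_normalSet_of_four (h1 : 0 < n₁) (h12 : 100 * n₁ ≤ n₂) {J : Fin 6 → Zbar}
    (hJ : ∀ i : Fin 6, i < 4 → (J i : ℤ) ∈ tangSites n₁ n₂)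
    (hs : (J 0 : ℤ) + J 1 + J 2 + J 3 = 0) (h4 : (J 4 : ℤ) + J 5 = 0) : J ∈ normalSet := by
  obtain ⟨i, hi, hp⟩ := exists_partner (s := {0, 1, 2, 3}) (J := fun i => (J i : ℤ)) (i₀ := 0)
    h1 h12 (by decide) (fun i hi => hJ i (by fin_cases hi <;> decide))
    (by rw [Finset.sum_insert (by decide), Finset.sum_insert (by decide),
          Finset.sum_insert (by decide), Finset.sum_singleton]
        linarith) (by decide)
  have h0 := (J 0).2
  fin_cases hi
  · change (J 0 : ℤ) = -(J 0 : ℤ) at hp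
    omega
  · change (J 1 : ℤ) = -(J 0 : ℤ) at hp
    exact mem_normalSet_of_pairs (by omega) (by omega) h4
  · change (J 2 : ℤ) = -(J 0 : ℤ) at hp
    refine mem_normalSet_of_comp (τ := Equiv.swap 1 2) (mem_normalSet_of_pairs ?_ ?_ ?_)
    · change (J 0 : ℤ) + J 2 = 0
      omega
    · change (J 1 : ℤ) + J 3 = 0
      omega
    · exact h4
  · change (J 3 : ℤ) = -(J 0 : ℤ) at hp
    refine mem_normalSet_of_comp (τ := Equiv.swap 1 3) (mem_normalSet_of_pairs ?_ ?_ ?_)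
    · change (J 0 : ℤ) + J 3 = 0
      omega
    · change (J 2 : ℤ) + J 1 = 0
      omega
    · exact h4

theorem mem_normalSet_of_six (h1 : 0 < n₁) (h12 : 100 * n₁ ≤ n₂) {J : Fin 6 → Zbar}
    (hJ : ∀ i : Fin 6, (J i : ℤ) ∈ tangSites n₁ n₂)
    (hs : ∑ i, (J i : ℤ) = 0) : J ∈ normalSet := by
  obtain ⟨i, -, hp⟩ := exists_partner (s := Finset.univ) (J := fun i => (J i : ℤ)) (i₀ := 5)
    h1 h12 (by decide) (fun i _ => hJ i) hs (by simp)
  have hne : i ≠ 5 := by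
    rintro rfl
    have := (J 5).2
    omega
  refine mem_normalSet_of_comp (τ := Equiv.swap 4 i) ?_
  have h5 : (Equiv.swap 4 i) 5 = 5 := Equiv.swap_apply_of_ne_of_ne (by decide) hne.symm
  have h45 : ((J ∘ Equiv.swap 4 i) 4 : ℤ) + (J ∘ Equiv.swap 4 i) 5 = 0 := by
    simp only [Function.comp_apply, Equiv.swap_apply_left, h5] at *
    omega
  have hs' : ∑ k, ((J ∘ Equiv.swap 4 i) k : ℤ) = 0 := by
    exact (Equiv.sum_comp (Equiv.swap 4 i) fun k => (J k : ℤ)).trans hs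
  rw [Fin.sum_univ_six] at hs'
  exact mem_normalSet_of_four h1 h12 (fun k _ => hJ _) (by omega) h45

theorem exists_perm_apply_eq {x y : Fin 6} (h : x ≠ y) :
    ∃ τ : Equiv.Perm (Fin 6), τ 4 = x ∧ τ 5 = y := by
  have h1 : (4 : Fin 6) ≠ Equiv.swap 4 x y := fun h' => h (by
    have := congrArg (Equiv.swap 4 x) h'
    simpa using this)
  refine ⟨(Equiv.swap 5 (Equiv.swap 4 x y)).trans (Equiv.swap 4 x), ?_, ?_⟩
  · rw [Equiv.trans_apply, Equiv.swap_apply_of_ne_of_ne (by decide) h1, Equiv.swap_apply_left]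
  · rw [Equiv.trans_apply, Equiv.swap_apply_left, Equiv.swap_apply_self]

theorem exists_perm_tangential {S : Set ℤ} {J : Fin 6 → Zbar} (h : numOutside S J ≤ 2) :
    ∃ τ : Equiv.Perm (Fin 6), ∀ i : Fin 6, i < 4 → ((J ∘ τ) i : ℤ) ∈ S := by
  classical
  have hO : (Finset.univ.filter fun i => (J i : ℤ) ∉ S).card ≤ 2 := by
    rw [numOutside, Set.ncard_eq_toFinset_card'] at h
    convert h using 2
    ext i
    simp
  -- The set of outside places is enlarged to exactly two places, to which `4` and `5` are sent.
  obtain ⟨T, hT, hcard⟩ := Finset.exists_superset_card_eq hO (by decide)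
  obtain ⟨x, y, hxy, rfl⟩ := Finset.card_eq_two.1 hcard
  obtain ⟨τ, h4, h5⟩ := exists_perm_apply_eq hxy
  refine ⟨τ, fun i hi => ?_⟩
  by_contra hout
  have hmem : τ i ∈ ({x, y} : Finset (Fin 6)) := hT (by simpa using hout)
  rw [Finset.mem_insert, Finset.mem_singleton, ← h4, ← h5, τ.injective.eq_iff,
    τ.injective.eq_iff] at hmem
  rcases hmem with rfl | rfl <;> exact absurd hi (by decide)

theorem freq_eq_disp (j : Zbar) : freq j = disp j := rfl

/-- Permuting four tangential entries to the front, a sextuple has frequency sum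
`a λ_{n₁} + b λ_{n₂} + λ_j + λ_k`. -/
theorem exists_tangential_form (h1 : 0 < n₁) (h12 : n₁ < n₂) {J : Fin 6 → Zbar}
    (hJ : ∀ i : Fin 6, i < 4 → (J i : ℤ) ∈ tangSites n₁ n₂) (hs : ∑ i, (J i : ℤ) = 0) :
    ∃ a b : ℤ, |a| + |b| ≤ 4 ∧ 2 ∣ a + b ∧ (J 0 : ℤ) + J 1 + J 2 + J 3 = a * n₁ + b * n₂ ∧
      (J 4 : ℤ) + J 5 + a * n₁ + b * n₂ = 0 ∧
      ∑ i, freq (J i) = a * disp n₁ + b * disp n₂ + disp (J 4) + disp (J 5) := by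
  have p := fun i hi => siteCoeff_abs_add h1 h12 (hJ i hi)
  have e := fun i hi => eq_siteCoeff h1 h12 (hJ i hi)
  have d := fun i hi => disp_siteCoeff h1 h12 (hJ i hi)
  have e4 : (J 0 : ℤ) + J 1 + J 2 + J 3 =
      (siteCoeff n₁ (J 0) + siteCoeff n₁ (J 1) + siteCoeff n₁ (J 2) + siteCoeff n₁ (J 3)) * n₁ +
      (siteCoeff n₂ (J 0) + siteCoeff n₂ (J 1) + siteCoeff n₂ (J 2) + siteCoeff n₂ (J 3)) * n₂ := by
    linear_combination e 0 (by decide) + e 1 (by decide) + e 2 (by decide) + e 3 (by decide)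
  obtain ⟨a0, c0, p0⟩ := p 0 (by decide)
  obtain ⟨a1, c1, p1⟩ := p 1 (by decide)
  obtain ⟨a2, c2, p2⟩ := p 2 (by decide)
  obtain ⟨a3, c3, p3⟩ := p 3 (by decide)
  refine ⟨_, _, ?_, ?_, e4, ?_, ?_⟩
  · have t1 := abs_add_le (siteCoeff n₁ (J 0) + siteCoeff n₁ (J 1) + siteCoeff n₁ (J 2)) (siteCoeff n₁ (J 3))
    have t2 := abs_add_three (siteCoeff n₁ (J 0)) (siteCoeff n₁ (J 1)) (siteCoeff n₁ (J 2))
    have t3 := abs_add_le (siteCoeff n₂ (J 0) + siteCoeff n₂ (J 1) + siteCoeff n₂ (J 2)) (siteCoeff n₂ (J 3))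
    have t4 := abs_add_three (siteCoeff n₂ (J 0)) (siteCoeff n₂ (J 1)) (siteCoeff n₂ (J 2))
    linarith
  · exact ⟨c0 + c1 + c2 + c3 + 2, by linarith⟩
  · rw [Fin.sum_univ_six] at hs
    linarith
  · rw [Fin.sum_univ_six]
    simp only [freq_eq_disp]
    rw [d 0 (by decide), d 1 (by decide), d 2 (by decide), d 3 (by decide)]
    push_cast
    ring

/-- Off a finite set `|f|` exceeds `|L| / 2`, and finitely many nonzero values are bounded below.
The form "for all small `c`" lets finitely many functions share one constant. -/
theorem exists_lower_bound_of_tendsto {f : ℤ → ℝ} {L : ℝ} (h : Tendsto f cofinite (𝓝 L))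
    (hL : L ≠ 0) : ∀ᶠ c in 𝓝[>] (0 : ℝ), ∀ j, f j ≠ 0 → c ≤ |f j| := by
  have hL' : 0 < |L| / 2 := by positivity
  have hfin : {j | ¬ |L| / 2 < |f j|}.Finite :=
    h.abs.eventually (lt_mem_nhds (half_lt_self (abs_pos.2 hL)))
  have h1 : ∀ᶠ c in 𝓝[>] (0 : ℝ), ∀ j ∈ {j | ¬ |L| / 2 < |f j|}, f j ≠ 0 → c ≤ |f j| := by
    refine (eventually_all_finite hfin).2 fun j _ => ?_
    by_cases hj : f j = 0
    · exact Eventually.of_forall fun c h => absurd hj h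
    · filter_upwards [Ioo_mem_nhdsGT (abs_pos.2 hj)] with c hc _ using hc.2.le
  filter_upwards [h1, Ioo_mem_nhdsGT hL'] with c hc hc' j hj
  by_cases hj' : |L| / 2 < |f j|
  · exact hc'.2.le.trans hj'.le
  · exact hc j hj' hj

theorem tendsto_disp : Tendsto disp cofinite (𝓝 0) := by
  have h1 : Tendsto (fun x : ℤ => ((x : ℝ))⁻¹) cofinite (𝓝 0) :=
    (tendsto_inv₀_cobounded (α := ℝ)).comp (by
      rw [Metric.cobounded_eq_cocompact]
      exact Int.tendsto_coe_cofinite)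
  refine squeeze_zero_norm (fun x => ?_) (tendsto_norm_zero.comp h1)
  rcases eq_or_ne x 0 with rfl | hx
  · simp [disp]
  · have hx' : 0 < |(x : ℝ)| := abs_pos.2 (by exact_mod_cast hx)
    have := abs_disp_le hx' le_rfl
    simpa [Real.norm_eq_abs] using this

/-- This is the limit of the divisor as `j → ∞`. If `a ≠ 0`, then `|a λ_n| ≥ 1 / (2 n)` dominates
`|b λ_m| ≤ 4 / (100 n)`. -/
theorem tangential_disp_ne_zero {a b n m : ℤ} (hn : 20 ≤ n) (hm : siteBound n ≤ m)
    (hb : |b| ≤ 4) (hab : ¬(a = 0 ∧ b = 0)) : a * disp n + b * disp m ≠ 0 := by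
  have hmn := (siteBound_ge hn).trans hm
  have hnR : (20 : ℝ) ≤ n := by exact_mod_cast hn
  have hmR : 100 * (n : ℝ) ≤ m := by exact_mod_cast hmn
  intro h
  rcases eq_or_ne a 0 with rfl | ha
  · have hb0 : (b : ℝ) ≠ 0 := by
      have : b ≠ 0 := fun hb0 => hab ⟨rfl, hb0⟩
      exact_mod_cast this
    have h1 := le_disp (show 1 ≤ m by omega)
    have h2 : 0 < 1 / (2 * (m : ℝ)) := by
      have : (0 : ℝ) < m := by linarith
      positivity
    push_cast at h
    rw [zero_mul, zero_add] at h
    exact mul_ne_zero hb0 (by linarith) h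
  · have h1 := le_disp (show 1 ≤ n by omega)
    have h2 := abs_disp_le (x := m) (c := 100 * n) (by linarith) (hmR.trans (le_abs_self _))
    have h3 : (1 : ℝ) ≤ |(a : ℝ)| := by exact_mod_cast Int.one_le_abs ha
    have h4 : |(b : ℝ)| ≤ 4 := by exact_mod_cast hb
    have h5 : |(a : ℝ)| * |disp n| = |(b : ℝ)| * |disp m| := by
      rw [← abs_mul, ← abs_mul, ← abs_neg ((b : ℝ) * disp m)]
      congr 1
      linarith
    have h6 : |(b : ℝ)| * |disp m| ≤ 4 * (1 / (100 * n)) := by gcongr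
    have h7 : 1 / (2 * (n : ℝ)) ≤ |(a : ℝ)| * |disp n| := by
      have := le_abs_self (disp n)
      have h8 : (0 : ℝ) < 1 / (2 * (n : ℝ)) := by positivity
      nlinarith
    have h8 : 4 * (1 / (100 * (n : ℝ))) < 1 / (2 * n) := by
      rw [mul_one_div, div_lt_div_iff₀ (by positivity) (by positivity)]
      linarith
    linarith

/-- Either `a = b = 0`, so the four tangential entries and the other two have zero sum separately,
or all six entries are tangential. Opposite pairs result in both cases. -/
theorem mem_normalSet_of_resonance (h1 : 20 ≤ n₁) (h2 : siteBound n₁ ≤ n₂) {J : Fin 6 → Zbar}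
    (hJ : ∀ i : Fin 6, i < 4 → (J i : ℤ) ∈ tangSites n₁ n₂) (hs : ∑ i, (J i : ℤ) = 0)
    (h : ∑ i, freq (J i) = 0) : J ∈ normalSet := by
  have h1' : (20 : ℤ) ≤ n₁ := by exact_mod_cast h1
  have h12 := (siteBound_ge h1').trans h2
  obtain ⟨a, b, hab, hpar, e, hs', hd⟩ :=
    exists_tangential_form (n₁ := n₁) (n₂ := n₂) (by omega) (by omega) hJ hs
  rcases resonance_cases h1' h2 hab hpar hs' (by rw [← hd, h]) with ⟨rfl, rfl⟩ | ⟨h4, h5⟩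
  · exact mem_normalSet_of_four (n₁ := n₁) (n₂ := n₂) (by omega) (by omega) hJ (by simpa using e)
      (by simpa using hs')
  · refine mem_normalSet_of_six (n₁ := n₁) (n₂ := n₂) (by omega) (by omega) (fun i => ?_) hs
    by_cases hi : i < 4
    · exact hJ i hi
    · have : i = 4 ∨ i = 5 := by omega
      rcases this with rfl | rfl
      · exact mem_tangSites.2 h4
      · exact mem_tangSites.2 h5

/-- The small divisors of the nonresonant sextuples with at most two entries outside of the
tangential sites are bounded away from zero. -/
theorem exists_divisor_bound (h1 : 20 ≤ n₁) (h2 : siteBound n₁ ≤ n₂) :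
    ∃ c > 0, ∀ J : Fin 6 → Zbar, numOutside (tangSites n₁ n₂) J ≤ 2 → ∑ i, (J i : ℤ) = 0 →
      J ∉ normalSet → c ≤ |∑ i, freq (J i)| := by
  have h1' : (20 : ℤ) ≤ n₁ := by exact_mod_cast h1
  have h12 := (siteBound_ge h1').trans h2
  -- Momentum determines `k` from `j`, so the divisors are finitely many functions of the single
  -- integer `j`.
  have key : ∀ᶠ c in 𝓝[>] (0 : ℝ), ∀ q ∈ Finset.Icc (-4 : ℤ) 4 ×ˢ Finset.Icc (-4 : ℤ) 4,
      ∀ j, q.1 * disp n₁ + q.2 * disp n₂ + disp j + disp (-(q.1 * n₁ + q.2 * n₂) - j) ≠ 0 →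
        c ≤ |q.1 * disp n₁ + q.2 * disp n₂ + disp j + disp (-(q.1 * n₁ + q.2 * n₂) - j)| := by
    refine (eventually_all_finset _).2 fun q hq => ?_
    rw [Finset.mem_product, Finset.mem_Icc, Finset.mem_Icc] at hq
    -- For `a = b = 0` one has `k = -j` and the expression vanishes identically, leaving nothing to
    -- bound.
    by_cases h0 : q.1 = 0 ∧ q.2 = 0
    · refine Eventually.of_forall fun c j hj => absurd ?_ hj
      rw [h0.1, h0.2]
      simp [disp_neg]
    · refine exists_lower_bound_of_tendsto ?_
        (tangential_disp_ne_zero h1' h2 (abs_le.2 hq.2) h0)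
      have hinj : Function.Injective fun j : ℤ => -(q.1 * n₁ + q.2 * n₂) - j :=
        fun _ _ h => sub_right_injective h
      have := (tendsto_disp.const_add (q.1 * disp n₁ + q.2 * disp n₂)).add
        (tendsto_disp.comp hinj.tendsto_cofinite)
      simpa using this
  obtain ⟨c, hc, hc0⟩ := (key.and self_mem_nhdsWithin).exists
  refine ⟨c, hc0, fun J hout hs hN => ?_⟩
  obtain ⟨τ, hτ⟩ := exists_perm_tangential hout
  have hs' : ∑ i, ((J ∘ τ) i : ℤ) = 0 := (Equiv.sum_comp τ fun i => (J i : ℤ)).trans hs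
  have hf : ∑ i, freq ((J ∘ τ) i) = ∑ i, freq (J i) := Equiv.sum_comp τ fun i => freq (J i)
  obtain ⟨a, b, hab, hpar, e, hs'', hd⟩ :=
    exists_tangential_form (n₁ := n₁) (n₂ := n₂) (by omega) (by omega) hτ hs'
  have hne : ∑ i, freq (J i) ≠ 0 := fun h0 =>
    hN (mem_normalSet_of_comp (mem_normalSet_of_resonance h1 h2 hτ hs' (hf.trans h0)))
  have h5 : ((J ∘ τ) 5 : ℤ) = -(a * n₁ + b * n₂) - (J ∘ τ) 4 := by linarith
  rw [h5] at hd
  have ha := abs_nonneg a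
  have hb := abs_nonneg b
  rw [← hf, hd] at hne ⊢
  refine hc (a, b) ?_ _ hne
  rw [Finset.mem_product, Finset.mem_Icc, Finset.mem_Icc, ← abs_le, ← abs_le]
  constructor <;> dsimp only <;> omega

end Resonances

end GBBM

namespace GBBM

open scoped ENNReal

/-! ### Cauchy–Schwarz and Young inequalities in `ℝ≥0∞`, where series always converge. -/

section Young

theorem tsum_pair {α β : Type*} (F : α × β → ℝ≥0∞) : ∑' x, F x = ∑' a, ∑' b, F (a, b) :=
  ENNReal.tsum_prod (f := fun a b => F (a, b))

theorem tsum_mul_sq_le {ι : Type*} (w f : ι → ℝ≥0∞) :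
    (∑' i, w i * f i) ^ 2 ≤ (∑' i, w i) * ∑' i, w i * f i ^ 2 := by
  have h : ∑' i, w i * f i ≤ ((∑' i, w i) * ∑' i, w i * f i ^ 2) ^ (2⁻¹ : ℝ) := by
    rw [ENNReal.tsum_eq_iSup_sum]
    refine iSup_le fun s => ?_
    refine (ENNReal.inner_le_weight_mul_Lp_of_nonneg s one_le_two w f).trans ?_
    rw [ENNReal.mul_rpow_of_nonneg _ _ (by norm_num), show (1 : ℝ) - 2⁻¹ = 2⁻¹ by norm_num]
    simp only [ENNReal.rpow_two]
    gcongr <;> exact ENNReal.sum_le_tsum s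
  calc _ ≤ (((∑' i, w i) * ∑' i, w i * f i ^ 2) ^ (2⁻¹ : ℝ)) ^ 2 := by gcongr
    _ = _ := by rw [← ENNReal.rpow_two, ← ENNReal.rpow_mul]; norm_num

theorem tsum_mul_sq_le_sq {ι : Type*} (f g : ι → ℝ≥0∞) :
    (∑' i, f i * g i) ^ 2 ≤ (∑' i, f i ^ 2) * ∑' i, g i ^ 2 := by
  have h : ∑' i, f i * g i ≤ ((∑' i, f i ^ 2) * ∑' i, g i ^ 2) ^ (2⁻¹ : ℝ) := by
    rw [ENNReal.tsum_eq_iSup_sum]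
    refine iSup_le fun s => ?_
    refine (ENNReal.inner_le_Lp_mul_Lq s f g Real.HolderConjugate.two_two).trans ?_
    rw [ENNReal.mul_rpow_of_nonneg _ _ (by norm_num)]
    simp only [ENNReal.rpow_two, one_div]
    gcongr <;> exact ENNReal.sum_le_tsum s
  calc _ ≤ (((∑' i, f i ^ 2) * ∑' i, g i ^ 2) ^ (2⁻¹ : ℝ)) ^ 2 := by gcongr
    _ = _ := by rw [← ENNReal.rpow_two, ← ENNReal.rpow_mul]; norm_num

theorem sum_sq_le_card_mul {ι : Type*} [Fintype ι] (f : ι → ℝ≥0∞) :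
    (∑ i, f i) ^ 2 ≤ Fintype.card ι * ∑ i, f i ^ 2 := by
  have h := tsum_mul_sq_le (fun _ => 1) f
  simpa [tsum_fintype] using h

theorem tsum_ite_le {α : Type*} {P : α → Prop} [DecidablePred P] (hP : ∀ a b, P a → P b → a = b)
    (c : ℝ≥0∞) :
    ∑' a, (if P a then c else 0) ≤ c := by
  by_cases h : ∃ a, P a
  · obtain ⟨a, ha⟩ := h
    rw [tsum_eq_single a fun b hb => if_neg fun hb' => hb (hP b a hb' ha), if_pos ha]
  · push Not at h
    simp [h]

/-- Young's inequality `ℓ² * ℓ¹ ⊆ ℓ²`, for the sum over a relation any two of whose entries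
determine the third one. -/
theorem young_le {α β γ : Type*} {P : γ → α → β → Prop}
    [∀ c a b, Decidable (P c a b)] (h1 : ∀ c b a a', P c a b → P c a' b → a = a')
    (h2 : ∀ a b c c', P c a b → P c' a b → c = c') (f : α → ℝ≥0∞) (w : β → ℝ≥0∞) :
    ∑' c, (∑' x : α × β, if P c x.1 x.2 then f x.1 * w x.2 else 0) ^ 2 ≤
      (∑' a, f a ^ 2) * (∑' b, w b) ^ 2 := by
  -- Cauchy–Schwarz with weight `w`: for given `c` and `b` at most one `a` contributes, so the total
  -- weight is at most `∑ w`. The later sum over `c` uses the uniqueness of `c` for given `a` and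
  -- `b`.
  have hstep : ∀ c, (∑' x : α × β, if P c x.1 x.2 then f x.1 * w x.2 else 0) ^ 2 ≤
      (∑' b, w b) * ∑' x : α × β, if P c x.1 x.2 then f x.1 ^ 2 * w x.2 else 0 := fun c => by
    have h := tsum_mul_sq_le (fun x : α × β => if P c x.1 x.2 then w x.2 else 0) fun x => f x.1
    simp only [ite_mul, zero_mul] at h
    have e1 : (∑' x : α × β, if P c x.1 x.2 then f x.1 * w x.2 else 0) =
        ∑' x : α × β, if P c x.1 x.2 then w x.2 * f x.1 else 0 :=
      tsum_congr fun x => by rw [mul_comm]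
    have e2 : (∑' x : α × β, if P c x.1 x.2 then f x.1 ^ 2 * w x.2 else 0) =
        ∑' x : α × β, if P c x.1 x.2 then w x.2 * f x.1 ^ 2 else 0 :=
      tsum_congr fun x => by rw [mul_comm]
    rw [e1, e2]
    refine h.trans ?_
    gcongr
    rw [tsum_pair, ENNReal.tsum_comm]
    exact ENNReal.tsum_le_tsum fun b => tsum_ite_le (h1 c b) _
  calc _ ≤ ∑' c, (∑' b, w b) * ∑' x : α × β, if P c x.1 x.2 then f x.1 ^ 2 * w x.2 else 0 :=
        ENNReal.tsum_le_tsum hstep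
    _ = (∑' b, w b) * ∑' x : α × β, ∑' c, if P c x.1 x.2 then f x.1 ^ 2 * w x.2 else 0 := by
        rw [ENNReal.tsum_mul_left, ENNReal.tsum_comm]
    _ ≤ (∑' b, w b) * ∑' x : α × β, f x.1 ^ 2 * w x.2 := by
        gcongr with x
        exact tsum_ite_le (h2 x.1 x.2) _
    _ = _ := by
        rw [tsum_pair]
        simp only [ENNReal.tsum_mul_left, ENNReal.tsum_mul_right]
        ring

theorem tsum_pi_prod {ι : Type*} {n : ℕ} (f : Fin n → ι → ℝ≥0∞) :
    ∑' J : Fin n → ι, ∏ i, f i (J i) = ∏ i, ∑' j, f i j := by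
  induction n with
  | zero => simp
  | succ n ih =>
    rw [← (Fin.consEquiv fun _ : Fin (n + 1) => ι).tsum_eq, tsum_pair]
    simp only [Fin.consEquiv_apply, Fin.prod_univ_succ, Fin.cons_zero, Fin.cons_succ,
      ENNReal.tsum_mul_left, ENNReal.tsum_mul_right, ih fun i => f i.succ]

theorem summable_of_tsum_enorm_ne_top {ι : Type*} {f : ι → ℂ} (h : ∑' i, ‖f i‖ₑ ≠ ∞) :
    Summable f := by
  refine Summable.of_norm ?_
  have := ENNReal.summable_toReal h
  simpa using this

end Young

/-! ### The spaces `h_p`: completeness and the embedding of `δ h_p` in `ℓ¹`. -/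

section Space

theorem wt_nonneg (j : Zbar) : 0 ≤ wt j := Real.sqrt_nonneg _

/-- This half power of decay, used twice in the gradient, produces the passage from `h_p` to
`h_{p+1}`. -/
theorem wt_le (j : Zbar) : wt j ≤ absIdx j ^ (-(1 / 2) : ℝ) := by
  have h0 := absIdx_pos j
  have hsq : absIdx j ^ 2 = ((j : ℤ) : ℝ) ^ 2 := sq_abs _
  have h : absIdx j / (1 + ((j : ℤ) : ℝ) ^ 2) ≤ absIdx j ^ (-1 : ℝ) := by
    rw [Real.rpow_neg_one, ← hsq, div_le_iff₀ (by positivity), inv_mul_eq_div, le_div_iff₀ h0]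
    nlinarith
  calc wt j ≤ Real.sqrt (absIdx j ^ (-1 : ℝ)) := Real.sqrt_le_sqrt h
    _ = _ := by
      rw [Real.sqrt_eq_rpow, ← Real.rpow_mul h0.le]
      norm_num

variable {p : ℝ}

theorem SeqSpace.ext {a b : SeqSpace p} (h : ∀ j, a j = b j) : a = b := Subtype.ext (funext h)

theorem SeqSpace.add_apply (a b : SeqSpace p) (j : Zbar) : (a + b) j = a j + b j := rfl

theorem SeqSpace.smul_apply (c : ℂ) (a : SeqSpace p) (j : Zbar) : (c • a) j = c * a j := rfl

/-- The element of `h_p` with given coordinates. -/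
def SeqSpace.mk (y : Zbar → ℂ) (h : y ∈ seqSubmodule p) : SeqSpace p := ⟨y, h⟩

theorem SeqSpace.mk_apply (y : Zbar → ℂ) (h : y ∈ seqSubmodule p) (j : Zbar) :
    SeqSpace.mk y h j = y j := rfl

/-- The coordinates as linear forms. -/
def coord (p : ℝ) (j : Zbar) : SeqSpace p →ₗ[ℂ] ℂ where
  toFun z := z j
  map_add' _ _ := rfl
  map_smul' _ _ := rfl

theorem coord_apply (j : Zbar) (z : SeqSpace p) : coord p j z = z j := rfl

theorem enorm_sq_eq (z : SeqSpace p) :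
    ‖z‖ₑ ^ 2 = ∑' j, ENNReal.ofReal (absIdx j ^ p * ‖z j‖) ^ 2 := by
  rw [← ofReal_norm, ← ENNReal.ofReal_pow (norm_nonneg _), norm_sq_eq,
    ENNReal.ofReal_tsum_of_nonneg (fun j => by have := absIdx_pos j; positivity) z.2]
  refine tsum_congr fun j => ?_
  have h0 := (absIdx_pos j).le
  rw [← ENNReal.ofReal_pow (by positivity), mul_pow, mul_comm,
    ← Real.rpow_natCast (absIdx j ^ p) 2, ← Real.rpow_mul h0]
  norm_num [mul_comm]

theorem mem_seqSubmodule_of_tsum_ne_top {y : Zbar → ℂ}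
    (h : ∑' j, ENNReal.ofReal (absIdx j ^ p * ‖y j‖) ^ 2 ≠ ∞) : y ∈ seqSubmodule p := by
  have h1 := ENNReal.summable_toReal h
  refine h1.congr fun j => ?_
  have h0 := (absIdx_pos j).le
  rw [← ENNReal.ofReal_pow (by positivity), ENNReal.toReal_ofReal (by positivity), mul_pow,
    mul_comm, ← Real.rpow_natCast (absIdx j ^ p) 2, ← Real.rpow_mul h0]
  norm_num [mul_comm]

theorem norm_le_of_enorm_sq_le {z : SeqSpace p} {r : ℝ} (hr : 0 ≤ r)
    (h : ‖z‖ₑ ^ 2 ≤ ENNReal.ofReal r ^ 2) : ‖z‖ ≤ r := by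
  rw [← ofReal_norm, ← ENNReal.ofReal_pow (norm_nonneg _), ← ENNReal.ofReal_pow hr,
    ENNReal.ofReal_le_ofReal_iff (by positivity)] at h
  exact le_of_sq_le_sq h hr

/-- Dividing by the weights shows that the isometry `toL2` is onto `ℓ²`. -/
instance : CompleteSpace (SeqSpace p) := by
  have hs : Function.Surjective (toL2 p) := fun x => by
    have e : ∀ j, ((absIdx j ^ p : ℝ) : ℂ) * (((absIdx j ^ p : ℝ) : ℂ)⁻¹ * x j) = x j := fun j =>
      mul_inv_cancel_left₀
        (Complex.ofReal_ne_zero.2 (Real.rpow_pos_of_pos (absIdx_pos j) p).ne') _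
    refine ⟨⟨fun j => ((absIdx j ^ p : ℝ) : ℂ)⁻¹ * x j, (memlp_iff p _).1 ?_⟩, ?_⟩
    · simp only [e]
      exact x.2
    · exact Subtype.ext (funext e)
  have hi : Isometry (toL2 p) := AddMonoidHomClass.isometry_of_norm _ fun _ => rfl
  have hr : IsComplete (Set.range (toL2 p)) := by
    rw [hs.range_eq]
    exact isComplete_univ
  exact (completeSpace_iff_isComplete_range hi.isUniformInducing).2 hr

/-- The norm of the inclusion of `δ h_p` in `ℓ¹`. -/
noncomputable def l1Const (p : ℝ) : ℝ := Real.sqrt (∑' j : Zbar, absIdx j ^ (-(1 + 2 * p)))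

/-- Cauchy–Schwarz for `|j|^{-(1/2+p)}` against `|j|^p |z_j|`; the first factor is square summable
exactly because `p > 0`. -/
theorem tsum_wt_le (hp : 0 < p) (z : SeqSpace p) :
    ∑' j, ‖(wt j : ℂ) * z j‖ₑ ≤ ENNReal.ofReal (l1Const p) * ‖z‖ₑ := by
  have hsum : Summable fun j : Zbar => absIdx j ^ (-(1 + 2 * p)) :=
    (Real.summable_abs_int_rpow (b := 1 + 2 * p) (by linarith)).comp_injective
      Subtype.val_injective
  have h1 : ∀ j, ‖(wt j : ℂ) * z j‖ₑ ≤
      ENNReal.ofReal (absIdx j ^ (-(1 / 2 + p))) * ENNReal.ofReal (absIdx j ^ p * ‖z j‖) := by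
    intro j
    have h0 := absIdx_pos j
    rw [← ENNReal.ofReal_mul (by positivity), ← ofReal_norm, norm_mul, Complex.norm_real,
      Real.norm_of_nonneg (wt_nonneg j), ← mul_assoc, ← Real.rpow_add h0]
    refine ENNReal.ofReal_le_ofReal ?_
    rw [show -(1 / 2 + p) + p = -(1 / 2) by ring]
    exact mul_le_mul_of_nonneg_right (wt_le j) (norm_nonneg _)
  have h2 : (∑' j, ‖(wt j : ℂ) * z j‖ₑ) ^ 2 ≤ (ENNReal.ofReal (l1Const p) * ‖z‖ₑ) ^ 2 := by
    calc _ ≤ (∑' j, ENNReal.ofReal (absIdx j ^ (-(1 / 2 + p))) *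
          ENNReal.ofReal (absIdx j ^ p * ‖z j‖)) ^ 2 := by
          gcongr with j
          exact h1 j
      _ ≤ _ := tsum_mul_sq_le_sq _ _
      _ = _ := by
          rw [mul_pow, ← enorm_sq_eq]
          congr 1
          rw [l1Const, ← ENNReal.ofReal_pow (Real.sqrt_nonneg _),
            Real.sq_sqrt (tsum_nonneg fun j => by have := absIdx_pos j; positivity),
            ENNReal.ofReal_tsum_of_nonneg (fun j => by have := absIdx_pos j; positivity) hsum]
          refine tsum_congr fun j => ?_
          have h0 := absIdx_pos j
          rw [← ENNReal.ofReal_pow (by positivity), ← Real.rpow_natCast, ← Real.rpow_mul h0.le]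
          congr 2
          push_cast
          ring
  exact (ENNReal.pow_le_pow_left_iff two_ne_zero).1 h2

end Space

end GBBM

namespace GBBM

open scoped ENNReal

/-! ### Multilinear forms with bounded coefficients and their smoothing gradients. -/

section Forms

variable {p : ℝ} {n : ℕ}

/-- The monomial `∏ δ_{J_i} z_{J_i}` as a multilinear form. -/
noncomputable def monomialForm (p : ℝ) (J : Fin n → Zbar) :
    MultilinearMap ℂ (fun _ : Fin n => SeqSpace p) ℂ :=
  (MultilinearMap.mkPiAlgebra ℂ (Fin n) ℂ).compLinearMap fun i => (wt (J i) : ℂ) • coord p (J i)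

theorem monomialForm_apply (J : Fin n → Zbar) (z : Fin n → SeqSpace p) :
    monomialForm p J z = ∏ i, (wt (J i) : ℂ) * z i (J i) := by
  simp [monomialForm, coord_apply]

theorem enorm_monomialForm (J : Fin n → Zbar) (z : Fin n → SeqSpace p) :
    ‖monomialForm p J z‖ₑ = ∏ i, ‖(wt (J i) : ℂ) * z i (J i)‖ₑ := by
  rw [monomialForm_apply, ← ofReal_norm, norm_prod,
    ENNReal.ofReal_prod_of_nonneg fun i _ => norm_nonneg _]
  simp only [ofReal_norm]

theorem enorm_le_ofReal {x : ℂ} {K : ℝ} (h : ‖x‖ ≤ K) : ‖x‖ₑ ≤ ENNReal.ofReal K := by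
  rw [← ofReal_norm]
  exact ENNReal.ofReal_le_ofReal h

theorem tsum_monomialForm_le (hp : 0 < p) {c : (Fin n → Zbar) → ℂ} {K : ℝ}
    (hc : ∀ J, ‖c J‖ ≤ K) (z : Fin n → SeqSpace p) :
    ∑' J, ‖c J * monomialForm p J z‖ₑ ≤
      ENNReal.ofReal K * ∏ i, (ENNReal.ofReal (l1Const p) * ‖z i‖ₑ) := by
  calc _ ≤ ∑' J : Fin n → Zbar, ENNReal.ofReal K * ∏ i, ‖(wt (J i) : ℂ) * z i (J i)‖ₑ := by
        refine ENNReal.tsum_le_tsum fun J => ?_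
        rw [enorm_mul, enorm_monomialForm]
        gcongr
        exact enorm_le_ofReal (hc J)
    _ = ENNReal.ofReal K * ∏ i, ∑' j, ‖(wt j : ℂ) * z i j‖ₑ := by
        rw [ENNReal.tsum_mul_left, tsum_pi_prod fun i j => ‖(wt j : ℂ) * z i j‖ₑ]
    _ ≤ _ := by
        gcongr with i
        exact tsum_wt_le hp (z i)

theorem summable_monomialForm (hp : 0 < p) {c : (Fin n → Zbar) → ℂ} {K : ℝ}
    (hc : ∀ J, ‖c J‖ ≤ K) (z : Fin n → SeqSpace p) :
    Summable fun J => c J * monomialForm p J z := by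
  refine summable_of_tsum_enorm_ne_top (ne_top_of_le_ne_top ?_ (tsum_monomialForm_le hp hc z))
  exact ENNReal.mul_ne_top ENNReal.ofReal_ne_top (ENNReal.prod_ne_top fun i _ =>
    ENNReal.mul_ne_top ENNReal.ofReal_ne_top enorm_ne_top)

theorem l1Const_nonneg (p : ℝ) : 0 ≤ l1Const p := Real.sqrt_nonneg _

theorem ofReal_mul_prod_enorm {K A : ℝ} (hK : 0 ≤ K) (hA : 0 ≤ A) (z : Fin n → SeqSpace p) :
    ENNReal.ofReal K * ∏ i, (ENNReal.ofReal A * ‖z i‖ₑ) =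
      ENNReal.ofReal (K * A ^ n * ∏ i, ‖z i‖) := by
  rw [Finset.prod_mul_distrib, Finset.prod_const, Finset.card_univ, Fintype.card_fin,
    ENNReal.ofReal_mul (by positivity), ENNReal.ofReal_mul hK, ENNReal.ofReal_pow hA,
    ENNReal.ofReal_prod_of_nonneg fun i _ => norm_nonneg _, mul_assoc]
  simp only [ofReal_norm]

theorem norm_le_of_enorm_le_prod {F : Type*} [NormedAddCommGroup F] {x : F} {K A : ℝ} (hK : 0 ≤ K)
    (hA : 0 ≤ A) {z : Fin n → SeqSpace p}
    (h : ‖x‖ₑ ≤ ENNReal.ofReal K * ∏ i, (ENNReal.ofReal A * ‖z i‖ₑ)) :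
    ‖x‖ ≤ K * A ^ n * ∏ i, ‖z i‖ := by
  rw [ofReal_mul_prod_enorm hK hA, ← ofReal_norm, ENNReal.ofReal_le_ofReal_iff (by positivity)] at h
  exact h

/-- The multilinear form `∑_J c_J ∏ δ_{J_i} z_{J_i}` with bounded coefficients. -/
noncomputable def modeForm (hp : 0 < p) (c : (Fin n → Zbar) → ℂ) {K : ℝ} (hc : ∀ J, ‖c J‖ ≤ K) :
    ContinuousMultilinearMap ℂ (fun _ : Fin n => SeqSpace p) ℂ :=
  MultilinearMap.mkContinuous
    { toFun := fun z => ∑' J, c J * monomialForm p J z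
      map_update_add' := fun z i x y => by
        simp only [MultilinearMap.map_update_add, mul_add]
        exact (summable_monomialForm hp hc _).tsum_add (summable_monomialForm hp hc _)
      map_update_smul' := fun z i a x => by
        simp only [MultilinearMap.map_update_smul, smul_eq_mul, mul_left_comm _ a, tsum_mul_left] }
    (K * l1Const p ^ n) (fun z =>
      norm_le_of_enorm_le_prod ((norm_nonneg _).trans (hc fun _ => ⟨1, one_ne_zero⟩))
        (l1Const_nonneg p) (enorm_tsum_le_tsum_enorm.trans (tsum_monomialForm_le hp hc z)))

theorem modeForm_apply (hp : 0 < p) (c : (Fin n → Zbar) → ℂ) {K : ℝ} (hc : ∀ J, ‖c J‖ ≤ K)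
    (z : Fin n → SeqSpace p) : modeForm hp c hc z = ∑' J, c J * monomialForm p J z := rfl

/-- By the momentum relation `|j|` is at most `n + 1` times the largest input index, which can
therefore carry the weight of the output index. -/
theorem absIdx_rpow_le {r : ℝ} (hr : 0 ≤ r) {j : Zbar} {J : Fin (n + 1) → Zbar}
    (h : (j : ℤ) + ∑ i, (J i : ℤ) = 0) :
    ∃ i, absIdx j ^ r ≤ ((n + 1 : ℕ) : ℝ) ^ r * absIdx (J i) ^ r := by
  obtain ⟨i, -, hi⟩ := Finset.exists_max_image Finset.univ (fun i => absIdx (J i))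
    Finset.univ_nonempty
  refine ⟨i, ?_⟩
  rw [← Real.mul_rpow (by positivity) (absIdx_pos _).le]
  refine Real.rpow_le_rpow (absIdx_pos _).le ?_ hr
  have e : ((j : ℤ) : ℝ) = -∑ i, ((J i : ℤ) : ℝ) := by
    have : (j : ℤ) = -∑ i, (J i : ℤ) := by linarith
    rw [this]
    push_cast
    rfl
  calc absIdx j = |∑ i, ((J i : ℤ) : ℝ)| := by rw [absIdx, e, abs_neg]
    _ ≤ ∑ i, absIdx (J i) := Finset.abs_sum_le_sum_abs _ _
    _ ≤ ∑ _k : Fin (n + 1), absIdx (J i) := Finset.sum_le_sum fun k hk => hi k hk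
    _ = _ := by simp

theorem ofReal_rpow_mul_enorm_le (z : SeqSpace p) (x : Zbar) :
    ENNReal.ofReal (absIdx x ^ (p + 1 / 2)) * ‖(wt x : ℂ) * z x‖ₑ ≤
      ENNReal.ofReal (absIdx x ^ p * ‖z x‖) := by
  have h0 := absIdx_pos x
  rw [← ofReal_norm, ← ENNReal.ofReal_mul (by positivity), norm_mul, Complex.norm_real,
    Real.norm_of_nonneg (wt_nonneg x), ← mul_assoc]
  refine ENNReal.ofReal_le_ofReal (mul_le_mul_of_nonneg_right ?_ (norm_nonneg _))
  calc absIdx x ^ (p + 1 / 2) * wt x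
      ≤ absIdx x ^ (p + 1 / 2) * absIdx x ^ (-(1 / 2) : ℝ) := by gcongr; exact wt_le x
    _ = absIdx x ^ p := by
      rw [← Real.rpow_add h0]
      congr 1
      ring

/-- The convolution of the weights `|x|^p |z_i|` in the place `i` and `δ |z_k|` in the other
places. -/
noncomputable def convAt (z : Fin (n + 1) → SeqSpace p) (i : Fin (n + 1)) (j : Zbar) : ℝ≥0∞ :=
  ∑' J : Fin (n + 1) → Zbar, if (j : ℤ) + ∑ k, (J k : ℤ) = 0 then
    ENNReal.ofReal (absIdx (J i) ^ p * ‖z i (J i)‖) *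
      ∏ k, ‖(wt (J (i.succAbove k)) : ℂ) * z (i.succAbove k) (J (i.succAbove k))‖ₑ else 0

/-- Young's inequality, with the place `i` in `ℓ²` and the other `n` places jointly in `ℓ¹`. The
momentum relation determines the output index, or the entry at `i`, from the rest. -/
theorem tsum_convAt_sq_le (hp : 0 < p) (z : Fin (n + 1) → SeqSpace p) (i : Fin (n + 1)) :
    ∑' j, convAt z i j ^ 2 ≤ (ENNReal.ofReal (l1Const p) ^ n * ∏ k, ‖z k‖ₑ) ^ 2 := by
  have e : ∀ j, convAt z i j = ∑' x : Zbar × (Fin n → Zbar),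
      if (j : ℤ) + x.1 + ∑ k, (x.2 k : ℤ) = 0 then
        ENNReal.ofReal (absIdx x.1 ^ p * ‖z i x.1‖) *
          ∏ k, ‖(wt (x.2 k) : ℂ) * z (i.succAbove k) (x.2 k)‖ₑ else 0 := fun j => by
    rw [convAt, ← (Fin.insertNthEquiv (fun _ => Zbar) i).tsum_eq]
    refine tsum_congr fun x => ?_
    simp only [Fin.insertNthEquiv_apply, Fin.sum_univ_succAbove _ i, Fin.insertNth_apply_same,
      Fin.insertNth_apply_succAbove, add_assoc]
  simp only [e]
  refine (young_le (P := fun (j x : Zbar) (J : Fin n → Zbar) => (j : ℤ) + x + ∑ k, (J k : ℤ) = 0)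
    (fun c b a a' h h' => Subtype.ext (by linarith))
    (fun a b c c' h h' => Subtype.ext (by linarith))
    (fun x => ENNReal.ofReal (absIdx x ^ p * ‖z i x‖))
    (fun J => ∏ k, ‖(wt (J k) : ℂ) * z (i.succAbove k) (J k)‖ₑ)).trans ?_
  rw [← enorm_sq_eq, tsum_pi_prod fun k j => ‖(wt j : ℂ) * z (i.succAbove k) j‖ₑ, ← mul_pow]
  rw [Fin.prod_univ_succAbove (fun k => ‖z k‖ₑ) i, mul_left_comm]
  gcongr
  calc _ ≤ ∏ k, (ENNReal.ofReal (l1Const p) * ‖z (i.succAbove k)‖ₑ) := by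
        gcongr with k
        exact tsum_wt_le hp _
    _ = _ := by
        rw [Finset.prod_mul_distrib, Finset.prod_const, Finset.card_univ, Fintype.card_fin]

/-- Of the `p + 1` powers of `|j|`, the outer `δ_j` absorbs one half and the rest goes to the
largest entry, whose `δ` absorbs another half. The place of that entry depends on the tuple, hence
the sum over all `i`. -/
theorem weighted_modeForm_le (hp : 0 < p) {c : (Fin (n + 2) → Zbar) → ℂ} {K : ℝ}
    (hc : ∀ J, ‖c J‖ ≤ K) (hs : ∀ J, c J ≠ 0 → ∑ i, (J i : ℤ) = 0)
    (z : Fin (n + 1) → SeqSpace p) (j : Zbar) :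
    ENNReal.ofReal (absIdx j ^ (p + 1) *
      ‖(wt j : ℂ) * modeForm hp (fun J => c (Fin.cons j J)) (fun _ => hc _) z‖) ≤
      ENNReal.ofReal (K * ((n + 1 : ℕ) : ℝ) ^ (p + 1 / 2)) * ∑ i, convAt z i j := by
  have h0 := absIdx_pos j
  have hK : 0 ≤ K := (norm_nonneg _).trans (hc fun _ => ⟨1, one_ne_zero⟩)
  have h1 : absIdx j ^ (p + 1) * wt j ≤ absIdx j ^ (p + 1 / 2) := by
    calc absIdx j ^ (p + 1) * wt j ≤ absIdx j ^ (p + 1) * absIdx j ^ (-(1 / 2) : ℝ) := by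
          gcongr
          exact wt_le j
      _ = _ := by
          rw [← Real.rpow_add h0]
          congr 1
          ring
  calc _ ≤ ENNReal.ofReal (absIdx j ^ (p + 1 / 2)) *
        ‖modeForm hp (fun J => c (Fin.cons j J)) (fun _ => hc _) z‖ₑ := by
        rw [← ofReal_norm, ← ENNReal.ofReal_mul (by positivity), norm_mul, Complex.norm_real,
          Real.norm_of_nonneg (wt_nonneg j), ← mul_assoc]
        exact ENNReal.ofReal_le_ofReal (mul_le_mul_of_nonneg_right h1 (norm_nonneg _))
    _ ≤ ENNReal.ofReal (absIdx j ^ (p + 1 / 2)) *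
        ∑' J : Fin (n + 1) → Zbar, ‖c (Fin.cons j J) * monomialForm p J z‖ₑ := by
        gcongr
        exact enorm_tsum_le_tsum_enorm
    _ = ∑' J : Fin (n + 1) → Zbar, ENNReal.ofReal (absIdx j ^ (p + 1 / 2)) *
        ‖c (Fin.cons j J) * monomialForm p J z‖ₑ := by rw [ENNReal.tsum_mul_left]
    _ ≤ ∑' J : Fin (n + 1) → Zbar, ENNReal.ofReal (K * ((n + 1 : ℕ) : ℝ) ^ (p + 1 / 2)) *
        ∑ i, (if (j : ℤ) + ∑ k, (J k : ℤ) = 0 then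
          ENNReal.ofReal (absIdx (J i) ^ p * ‖z i (J i)‖) *
          ∏ k, ‖(wt (J (i.succAbove k)) : ℂ) * z (i.succAbove k) (J (i.succAbove k))‖ₑ else 0) := by
        refine ENNReal.tsum_le_tsum fun J => ?_
        by_cases hcJ : c (Fin.cons j J) = 0
        · simp [hcJ]
        have hsum : (j : ℤ) + ∑ k, (J k : ℤ) = 0 := by
          simpa [Fin.sum_univ_succ] using hs _ hcJ
        simp only [if_pos hsum]
        obtain ⟨i, hi⟩ := absIdx_rpow_le (r := p + 1 / 2) (by linarith) hsum
        refine le_trans ?_ (mul_le_mul_right (Finset.single_le_sum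
          (fun _ _ => zero_le) (Finset.mem_univ i)) _)
        rw [enorm_mul, enorm_monomialForm, Fin.prod_univ_succAbove _ i]
        calc _ ≤ ENNReal.ofReal (((n + 1 : ℕ) : ℝ) ^ (p + 1 / 2) * absIdx (J i) ^ (p + 1 / 2)) *
              (ENNReal.ofReal K * (‖(wt (J i) : ℂ) * z i (J i)‖ₑ *
              ∏ k, ‖(wt (J (i.succAbove k)) : ℂ) * z (i.succAbove k) (J (i.succAbove k))‖ₑ)) := by
              gcongr
              exact enorm_le_ofReal (hc _)
          _ = ENNReal.ofReal (K * ((n + 1 : ℕ) : ℝ) ^ (p + 1 / 2)) *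
              ((ENNReal.ofReal (absIdx (J i) ^ (p + 1 / 2)) * ‖(wt (J i) : ℂ) * z i (J i)‖ₑ) *
              ∏ k, ‖(wt (J (i.succAbove k)) : ℂ) * z (i.succAbove k) (J (i.succAbove k))‖ₑ) := by
              rw [ENNReal.ofReal_mul (by positivity), ENNReal.ofReal_mul hK]
              ring
          _ ≤ _ := by
              gcongr
              exact ofReal_rpow_mul_enorm_le _ _
    _ = _ := by
        rw [ENNReal.tsum_mul_left, Summable.tsum_finsetSum fun _ _ => ENNReal.summable]
        rfl

/-- The bound of `gradForm`. -/
noncomputable def gradConst (p : ℝ) (n : ℕ) (K : ℝ) : ℝ :=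
  K * ((n + 1 : ℕ) : ℝ) ^ (p + 1 / 2) * (n + 1 : ℕ) * l1Const p ^ n

/-- The linear factor `n + 1` in `gradConst` is the square root of two factors: one from squaring
the sum over places, one from summing their bounds. -/
theorem tsum_weighted_modeForm_le (hp : 0 < p) {c : (Fin (n + 2) → Zbar) → ℂ} {K : ℝ}
    (hc : ∀ J, ‖c J‖ ≤ K) (hs : ∀ J, c J ≠ 0 → ∑ i, (J i : ℤ) = 0)
    (z : Fin (n + 1) → SeqSpace p) :
    ∑' j, ENNReal.ofReal (absIdx j ^ (p + 1) *
      ‖(wt j : ℂ) * modeForm hp (fun J => c (Fin.cons j J)) (fun _ => hc _) z‖) ^ 2 ≤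
      ENNReal.ofReal (gradConst p n K * ∏ i, ‖z i‖) ^ 2 := by
  have hK : 0 ≤ K := (norm_nonneg _).trans (hc fun _ => ⟨1, one_ne_zero⟩)
  have hl := l1Const_nonneg p
  set D := ENNReal.ofReal (K * ((n + 1 : ℕ) : ℝ) ^ (p + 1 / 2)) with hD
  calc _ ≤ ∑' j, (D * ∑ i, convAt z i j) ^ 2 := by
        gcongr with j
        exact weighted_modeForm_le hp hc hs z j
    _ ≤ ∑' j, D ^ 2 * ((n + 1 : ℕ) * ∑ i, convAt z i j ^ 2) := by
        gcongr with j
        rw [mul_pow]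
        gcongr
        simpa using sum_sq_le_card_mul fun i => convAt z i j
    _ = D ^ 2 * ((n + 1 : ℕ) * ∑ i, ∑' j, convAt z i j ^ 2) := by
        rw [ENNReal.tsum_mul_left, ENNReal.tsum_mul_left,
          Summable.tsum_finsetSum fun _ _ => ENNReal.summable]
    _ ≤ D ^ 2 * ((n + 1 : ℕ) *
          ∑ _i : Fin (n + 1), (ENNReal.ofReal (l1Const p) ^ n * ∏ k, ‖z k‖ₑ) ^ 2) := by
        gcongr with i
        exact tsum_convAt_sq_le hp z i
    _ = _ := by
        rw [Finset.sum_const, Finset.card_univ, Fintype.card_fin, nsmul_eq_mul, gradConst,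
          ENNReal.ofReal_mul (by positivity), ENNReal.ofReal_mul (by positivity),
          ENNReal.ofReal_mul (by positivity), ENNReal.ofReal_pow hl,
          ENNReal.ofReal_prod_of_nonneg fun i _ => norm_nonneg _, ENNReal.ofReal_natCast, ← hD]
        simp only [ofReal_norm]
        ring

/-- The gradient of the multilinear form with coefficients `c`: the map into `h_{p+1}` whose
`j`-th coordinate is the derivative in the direction of the `j`-th unit vector. -/
noncomputable def gradForm (hp : 0 < p) (c : (Fin (n + 2) → Zbar) → ℂ) {K : ℝ}
    (hc : ∀ J, ‖c J‖ ≤ K) (hs : ∀ J, c J ≠ 0 → ∑ i, (J i : ℤ) = 0) :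
    ContinuousMultilinearMap ℂ (fun _ : Fin (n + 1) => SeqSpace p) (SeqSpace (p + 1)) :=
  MultilinearMap.mkContinuous
    { toFun := fun z =>
        SeqSpace.mk (fun j => (wt j : ℂ) * modeForm hp (fun J => c (Fin.cons j J))
          (fun _ => hc _) z) (mem_seqSubmodule_of_tsum_ne_top (ne_top_of_le_ne_top
            (ENNReal.pow_ne_top ENNReal.ofReal_ne_top)
            (tsum_weighted_modeForm_le hp hc hs z)))
      map_update_add' := fun z i x y => SeqSpace.ext fun j => by
        simp only [SeqSpace.add_apply, SeqSpace.mk_apply, ContinuousMultilinearMap.map_update_add,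
          mul_add]
      map_update_smul' := fun z i a x => SeqSpace.ext fun j => by
        simp only [SeqSpace.smul_apply, SeqSpace.mk_apply,
          ContinuousMultilinearMap.map_update_smul, smul_eq_mul, mul_left_comm _ a] }
    (gradConst p n K) (fun z => by
      have hK : 0 ≤ K := (norm_nonneg _).trans (hc fun _ => ⟨1, one_ne_zero⟩)
      have hl := l1Const_nonneg p
      refine norm_le_of_enorm_sq_le (by unfold gradConst; positivity) ?_
      rw [enorm_sq_eq]
      exact tsum_weighted_modeForm_le hp hc hs z)

theorem gradForm_apply (hp : 0 < p) (c : (Fin (n + 2) → Zbar) → ℂ) {K : ℝ}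
    (hc : ∀ J, ‖c J‖ ≤ K) (hs : ∀ J, c J ≠ 0 → ∑ i, (J i : ℤ) = 0)
    (z : Fin (n + 1) → SeqSpace p) (j : Zbar) :
    gradForm hp c hc hs z j =
      (wt j : ℂ) * modeForm hp (fun J => c (Fin.cons j J)) (fun _ => hc _) z := rfl

end Forms

end GBBM

namespace GBBM

open scoped ENNReal

/-! ### The remainder after one normalization step. -/

section Remainder

variable {E E₁ : Type*} [NormedAddCommGroup E] [NormedSpace ℂ E]
  [NormedAddCommGroup E₁] [NormedSpace ℂ E₁] {m n : ℕ}

/-- An integral curve of a homogeneous vector field of degree `m` that stays in a ball of radius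
`C ‖γ 0‖` moves by at most a multiple of `‖γ 0‖ ^ m`. -/
theorem norm_curve_sub_le {N : ContinuousMultilinearMap ℂ (fun _ : Fin m => E) E₁}
    {ι : E₁ →L[ℂ] E} {C : ℝ} {γ : ℝ → E}
    (hγ : ∀ t ∈ Set.Icc (0 : ℝ) 1,
      HasDerivWithinAt γ (ι (diag N (γ t))) (Set.Icc 0 1) t ∧ ‖γ t‖ ≤ C * ‖γ 0‖)
    {t : ℝ} (ht : t ∈ Set.Icc (0 : ℝ) 1) :
    ‖γ t - γ 0‖ ≤ ‖ι‖ * (‖N‖ * (C * ‖γ 0‖) ^ m) := by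
  have h := norm_image_sub_le_of_norm_deriv_le_segment' (f := γ) (a := 0) (b := 1)
    (C := ‖ι‖ * (‖N‖ * (C * ‖γ 0‖) ^ m)) (fun s hs => (hγ s hs).1) (fun s hs => ?_) t ht
  · refine h.trans (mul_le_of_le_one_right ?_ (by linarith [ht.2]))
    have := (norm_nonneg _).trans (hγ 0 ⟨le_rfl, zero_le_one⟩).2
    positivity
  · refine (ι.le_opNorm _).trans ?_
    gcongr
    refine (norm_diag_le N _).trans ?_
    gcongr
    exact (hγ s ⟨hs.1, hs.2.le⟩).2

/-- The remainder after one step of normalization: if `dΛ(z) X(z) = P(z)`, then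
`(Λ + G)(γ 1) = (Λ + P + G)(γ 0)` up to terms of higher order. -/
theorem norm_remainder_le {N : ContinuousMultilinearMap ℂ (fun _ : Fin m => E) E₁}
    {ι : E₁ →L[ℂ] E} {Λ : E → ℂ} {Λ' : E → E →L[ℂ] ℂ} (hΛ : ∀ z, HasFDerivAt Λ (Λ' z) z)
    {P G : ContinuousMultilinearMap ℂ (fun _ : Fin n => E) ℂ}
    (hP : ∀ z, Λ' z (ι (diag N z)) = diag P z) {C : ℝ} (hC : 1 ≤ C) {γ : ℝ → E}
    (hγ : ∀ t ∈ Set.Icc (0 : ℝ) 1,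
      HasDerivWithinAt γ (ι (diag N (γ t))) (Set.Icc 0 1) t ∧ ‖γ t‖ ≤ C * ‖γ 0‖) :
    ‖Λ (γ 1) + diag G (γ 1) - (Λ (γ 0) + diag P (γ 0) + diag G (γ 0))‖ ≤
      (‖P‖ + ‖G‖) * n * C ^ (n - 1) * (‖ι‖ * (‖N‖ * C ^ m)) * ‖γ 0‖ ^ (n - 1 + m) := by
  have h0 : (0 : ℝ) ∈ Set.Icc (0 : ℝ) 1 := ⟨le_rfl, zero_le_one⟩
  have h1 : (1 : ℝ) ∈ Set.Icc (0 : ℝ) 1 := ⟨zero_le_one, le_rfl⟩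
  have hbound : ∀ (Q : ContinuousMultilinearMap ℂ (fun _ : Fin n => E) ℂ),
      ∀ t ∈ Set.Icc (0 : ℝ) 1, ‖diag Q (γ t) - diag Q (γ 0)‖ ≤
        ‖Q‖ * n * (C * ‖γ 0‖) ^ (n - 1) * (‖ι‖ * (‖N‖ * (C * ‖γ 0‖) ^ m)) := fun Q t ht => by
    refine (norm_diag_sub_le Q (hγ t ht).2 (hγ 0 h0).2).trans ?_
    gcongr
    exact norm_curve_sub_le hγ ht
  -- Subtracting `s P(γ 0)` leaves the derivative `P(γ s) - P(γ 0)`, which is already of higher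
  -- order.
  have hd : ∀ t ∈ Set.Icc (0 : ℝ) 1, HasDerivWithinAt (fun s : ℝ => Λ (γ s) - s • diag P (γ 0))
      (diag P (γ t) - diag P (γ 0)) (Set.Icc 0 1) t := fun t ht => by
    have e1 : HasDerivWithinAt (fun s : ℝ => Λ (γ s)) (Λ' (γ t) (ι (diag N (γ t))))
        (Set.Icc 0 1) t :=
      ((hΛ (γ t)).restrictScalars ℝ).comp_hasDerivWithinAt t (hγ t ht).1
    rw [hP] at e1
    have e2 := ((hasDerivAt_id t).smul_const (diag P (γ 0))).hasDerivWithinAt (s := Set.Icc 0 1)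
    rw [one_smul] at e2
    exact e1.sub e2
  have hmain := norm_image_sub_le_of_norm_deriv_le_segment' (a := 0) (b := 1) hd
    (fun t ht => hbound P t ⟨ht.1, ht.2.le⟩) 1 h1
  simp only [one_smul, zero_smul, sub_zero, mul_one] at hmain
  have e : Λ (γ 1) + diag G (γ 1) - (Λ (γ 0) + diag P (γ 0) + diag G (γ 0)) =
      (Λ (γ 1) - diag P (γ 0) - Λ (γ 0)) + (diag G (γ 1) - diag G (γ 0)) := by ring
  rw [e]
  refine (norm_add_le _ _).trans ((add_le_add hmain (hbound G 1 h1)).trans_eq ?_)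
  rw [pow_add, mul_pow, mul_pow]
  ring

end Remainder

/-! ### Reflection, rotation, conjugation and frequency operators on `h_p`. -/

section Operators

variable {p : ℝ} {n : ℕ}

theorem neg_neg_idx (j : Zbar) : -(-j) = j := Subtype.ext (neg_neg _)

/-- The reflection of the index set. -/
def negEquiv : Zbar ≃ Zbar where
  toFun j := -j
  invFun j := -j
  left_inv := neg_neg_idx
  right_inv := neg_neg_idx

theorem absIdx_neg (j : Zbar) : absIdx (-j) = absIdx j := by
  simp [absIdx, neg_val]

theorem wt_neg (j : Zbar) : wt (-j) = wt j := by
  simp [wt, absIdx_neg, neg_val]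

theorem freq_neg (j : Zbar) : freq (-j) = -freq j := by
  simp [freq, neg_val, neg_div]

theorem abs_freq_le (j : Zbar) : |freq j| ≤ 1 := by
  have h := abs_disp_le (x := (j : ℤ)) one_pos (one_le_absIdx j)
  rwa [div_one] at h

/-- The sign of an index. -/
def sgn (j : Zbar) : ℂ := if 0 < (j : ℤ) then 1 else -1

theorem sgn_of_pos {j : Zbar} (h : 0 < (j : ℤ)) : sgn j = 1 := if_pos h

theorem sgn_neg (j : Zbar) : sgn (-j) = -sgn j := by
  have h := j.2
  unfold sgn
  rw [neg_val]
  split_ifs with h1 h2 <;> first | omega | simp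

theorem norm_sgn (j : Zbar) : ‖sgn j‖ = 1 := by
  unfold sgn
  split_ifs <;> simp

theorem conj_sgn (j : Zbar) : (starRingEnd ℂ) (sgn j) = sgn j := by
  unfold sgn
  split_ifs <;> simp

theorem tsum_reflect (φ : Zbar → ℂ → ℂ) (hφ : ∀ j x, ‖φ j x‖ = ‖x‖) (z : SeqSpace p) :
    ∑' j, ENNReal.ofReal (absIdx j ^ p * ‖φ j (z (-j))‖) ^ 2 = ‖z‖ₑ ^ 2 := by
  rw [enorm_sq_eq, ← negEquiv.tsum_eq]
  refine tsum_congr fun j => ?_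
  change ENNReal.ofReal (absIdx (-j) ^ p * ‖φ (-j) (z (- -j))‖) ^ 2 = _
  rw [hφ, neg_neg_idx, absIdx_neg]

/-- The sequence `φ_j(z_{-j})`, for isometries `φ_j`. -/
def reflect (φ : Zbar → ℂ → ℂ) (hφ : ∀ j x, ‖φ j x‖ = ‖x‖) (z : SeqSpace p) : SeqSpace p :=
  SeqSpace.mk (fun j => φ j (z (-j))) (mem_seqSubmodule_of_tsum_ne_top (by
    rw [tsum_reflect φ hφ z]
    exact ENNReal.pow_ne_top enorm_ne_top))

theorem norm_reflect (φ : Zbar → ℂ → ℂ) (hφ : ∀ j x, ‖φ j x‖ = ‖x‖) (z : SeqSpace p) :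
    ‖reflect φ hφ z‖ = ‖z‖ := by
  have h : ‖reflect φ hφ z‖ₑ ^ 2 = ‖z‖ₑ ^ 2 := by
    rw [enorm_sq_eq]
    exact tsum_reflect φ hφ z
  rw [← ofReal_norm, ← ofReal_norm] at h
  exact le_antisymm (norm_le_of_enorm_sq_le (norm_nonneg _) (by rw [← h, ofReal_norm]))
    (norm_le_of_enorm_sq_le (norm_nonneg _) (by rw [h, ofReal_norm]))

theorem norm_rotation_factor (j : Zbar) (x : ℂ) : ‖-Complex.I * sgn j * x‖ = ‖x‖ := by
  simp [norm_sgn]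

theorem norm_conj_factor (_ : Zbar) (x : ℂ) : ‖(starRingEnd ℂ) x‖ = ‖x‖ := by
  simp

/-- The symplectic rotation `(y_j) ↦ (-i sgn(j) y_{-j})`. -/
noncomputable def rotation (p : ℝ) : SeqSpace p →L[ℂ] SeqSpace p :=
  LinearMap.mkContinuous
    { toFun := reflect (fun j x => -Complex.I * sgn j * x) norm_rotation_factor
      map_add' := fun _ _ => SeqSpace.ext fun _ => mul_add _ _ _
      map_smul' := fun _ _ => SeqSpace.ext fun _ => mul_left_comm _ _ _ } 1 fun z =>
    ((norm_reflect _ norm_rotation_factor z).trans (one_mul _).symm).le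

theorem rotation_apply (y : SeqSpace p) (j : Zbar) :
    rotation p y j = -Complex.I * sgn j * y (-j) := rfl

/-- The conjugation `(z_j) ↦ (conj z_{-j})`, whose fixed points are the real points. -/
noncomputable def conjugation (p : ℝ) : SeqSpace p →L[ℝ] SeqSpace p :=
  LinearMap.mkContinuous
    { toFun := reflect (fun _ x => (starRingEnd ℂ) x) norm_conj_factor
      map_add' := fun _ _ => SeqSpace.ext fun _ => map_add _ _ _
      map_smul' := fun c z => SeqSpace.ext fun j => by
        change (starRingEnd ℂ) ((c : ℂ) * z (-j)) = (c : ℂ) * (starRingEnd ℂ) (z (-j))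
        rw [map_mul, Complex.conj_ofReal] } 1 fun z =>
    ((norm_reflect _ norm_conj_factor z).trans (one_mul _).symm).le

theorem conjugation_apply (z : SeqSpace p) (j : Zbar) :
    conjugation p z j = (starRingEnd ℂ) (z (-j)) := rfl

theorem norm_conjugation (z : SeqSpace p) : ‖conjugation p z‖ = ‖z‖ :=
  norm_reflect _ norm_conj_factor z

theorem isReal_iff (z : SeqSpace p) : IsReal z ↔ conjugation p z = z := by
  constructor
  · intro h
    refine SeqSpace.ext fun j => ?_
    rw [conjugation_apply, ← h (-j), neg_neg_idx]
  · intro h j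
    conv_lhs => rw [← h]
    rw [conjugation_apply, neg_neg_idx]

theorem norm_le_of_forall_le {q : ℝ} {z : SeqSpace p} {w : SeqSpace q}
    (h : ∀ j, absIdx j ^ p * ‖z j‖ ≤ absIdx j ^ q * ‖w j‖) : ‖z‖ ≤ ‖w‖ := by
  refine norm_le_of_enorm_sq_le (norm_nonneg _) ?_
  rw [ofReal_norm, enorm_sq_eq, enorm_sq_eq]
  refine ENNReal.tsum_le_tsum fun j => ?_
  exact pow_le_pow_left' (ENNReal.ofReal_le_ofReal (h j)) 2

/-- The inclusion `h_{p+1} ⊆ h_p` as a continuous linear map. -/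
noncomputable def inclL (p : ℝ) : SeqSpace (p + 1) →L[ℂ] SeqSpace p :=
  LinearMap.mkContinuous
    { toFun := incl p
      map_add' := fun _ _ => SeqSpace.ext fun _ => rfl
      map_smul' := fun _ _ => SeqSpace.ext fun _ => rfl } 1 fun z => by
    rw [one_mul]
    refine norm_le_of_forall_le fun j => ?_
    exact mul_le_mul_of_nonneg_right (Real.rpow_le_rpow_of_exponent_le (one_le_absIdx j)
      (by linarith)) (norm_nonneg _)

theorem inclL_apply (z : SeqSpace (p + 1)) : inclL p z = incl p z := rfl

/-- The multiplication by the frequencies. -/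
noncomputable def freqMul (p : ℝ) : SeqSpace p →L[ℂ] SeqSpace p :=
  LinearMap.mkContinuous
    { toFun := fun z => SeqSpace.mk (fun j => (freq j : ℂ) * z j) (by
        refine mem_seqSubmodule_of_tsum_ne_top (ne_top_of_le_ne_top
          (ENNReal.pow_ne_top (enorm_ne_top (x := z)) (n := 2)) ?_)
        rw [enorm_sq_eq]
        refine ENNReal.tsum_le_tsum fun j => ?_
        have := absIdx_pos j
        gcongr
        rw [norm_mul, Complex.norm_real]
        exact mul_le_of_le_one_left (norm_nonneg _) (abs_freq_le j))
      map_add' := fun _ _ => SeqSpace.ext fun _ => mul_add _ _ _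
      map_smul' := fun _ _ => SeqSpace.ext fun _ => mul_left_comm _ _ _ } 1 fun z => by
    rw [one_mul]
    refine norm_le_of_forall_le fun j => ?_
    have := absIdx_pos j
    change absIdx j ^ p * ‖(freq j : ℂ) * z j‖ ≤ _
    gcongr
    rw [norm_mul, Complex.norm_real]
    exact mul_le_of_le_one_left (norm_nonneg _) (abs_freq_le j)

theorem freqMul_apply (z : SeqSpace p) (j : Zbar) : freqMul p z j = (freq j : ℂ) * z j := rfl

end Operators

end GBBM

namespace GBBM

open scoped ENNReal

/-! ### The symplectic form and the quadratic Hamiltonian. -/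

section Symplectic

variable {p : ℝ} {n : ℕ}

theorem tsum_eq_tsum_pos {g : Zbar → ℂ} (hg : Summable g) :
    ∑' j, g j = ∑' j : {j : Zbar // 0 < (j : ℤ)}, (g j + g (-j.1)) := by
  let s : Set Zbar := {j | 0 < (j : ℤ)}
  let e : s ≃ (sᶜ : Set Zbar) :=
    { toFun := fun j => ⟨-j.1, fun h => by
        have h1 : 0 < ((j : Zbar) : ℤ) := j.2
        have h2 : 0 < -((j : Zbar) : ℤ) := h
        omega⟩
      invFun := fun j => ⟨-j.1, by
        have h1 : ¬ 0 < ((j : Zbar) : ℤ) := j.2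
        have h2 := (j : Zbar).2
        change 0 < -((j : Zbar) : ℤ)
        omega⟩
      left_inv := fun j => Subtype.ext (neg_neg_idx _)
      right_inv := fun j => Subtype.ext (neg_neg_idx _) }
  have h1 : Summable fun j : s => g j := hg.subtype s
  have h2 : Summable fun j : s => g (-j.1) := e.summable_iff.2 (hg.subtype sᶜ)
  have h3 : ∑' j : s, g (-j.1) = ∑' j : (sᶜ : Set Zbar), g j := e.tsum_eq fun j => g j
  rw [← hg.tsum_subtype_add_tsum_subtype_compl s, ← h3]
  exact (h1.tsum_add h2).symm

theorem tsum_enorm_mul_neg_le (hp : 0 ≤ p) (v w : SeqSpace p) :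
    ∑' j, ‖v j‖ₑ * ‖w (-j)‖ₑ ≤ ‖v‖ₑ * ‖w‖ₑ := by
  have key : ∀ u : SeqSpace p, ∑' j, ‖u j‖ₑ ^ 2 ≤ ‖u‖ₑ ^ 2 := fun u => by
    rw [enorm_sq_eq]
    refine ENNReal.tsum_le_tsum fun j => ?_
    rw [← ofReal_norm]
    exact pow_le_pow_left' (ENNReal.ofReal_le_ofReal (le_mul_of_one_le_left (norm_nonneg _)
      (Real.one_le_rpow (one_le_absIdx j) hp))) 2
  refine (ENNReal.pow_le_pow_left_iff two_ne_zero).1 ((tsum_mul_sq_le_sq _ _).trans ?_)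
  rw [mul_pow]
  refine mul_le_mul' (key v) (le_trans (le_of_eq ?_) (key w))
  exact negEquiv.tsum_eq fun j => ‖w j‖ₑ ^ 2

theorem summable_symp (hp : 0 ≤ p) (v w : SeqSpace p) :
    Summable fun j : {j : Zbar // 0 < (j : ℤ)} => v j * w (-j.1) - v (-j.1) * w j := by
  have h : ∀ v w : SeqSpace p, Summable fun j : Zbar => v j * w (-j) := fun v w =>
    Summable.of_norm (by simpa only [norm_mul] using summable_mul_neg hp v w)
  have h1 := (h v w).comp_injective
    (Subtype.val_injective (p := fun j : Zbar => 0 < (j : ℤ)))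
  have h2 := (h w v).comp_injective
    (Subtype.val_injective (p := fun j : Zbar => 0 < (j : ℤ)))
  refine (h1.sub h2).congr fun j => ?_
  simp only [Function.comp_apply]
  ring

theorem norm_symp_le (hp : 0 ≤ p) (v w : SeqSpace p) : ‖symp v w‖ ≤ 2 * ‖v‖ * ‖w‖ := by
  have hsub : ∀ v w : SeqSpace p,
      ∑' j : {j : Zbar // 0 < (j : ℤ)}, ‖v j‖ₑ * ‖w (-j.1)‖ₑ ≤ ‖v‖ₑ * ‖w‖ₑ := fun v w =>
    (ENNReal.tsum_comp_le_tsum_of_injective Subtype.val_injective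
      fun j => ‖v j‖ₑ * ‖w (-j)‖ₑ).trans (tsum_enorm_mul_neg_le hp v w)
  have h : ‖symp v w‖ₑ ≤ ENNReal.ofReal (2 * ‖v‖ * ‖w‖) := by
    rw [symp, enorm_mul]
    calc _ ≤ 1 * ∑' j : {j : Zbar // 0 < (j : ℤ)},
          (‖v j‖ₑ * ‖w (-j.1)‖ₑ + ‖w j‖ₑ * ‖v (-j.1)‖ₑ) := by
          refine mul_le_mul' (by rw [← ofReal_norm]; simp)
            (enorm_tsum_le_tsum_enorm.trans (ENNReal.tsum_le_tsum fun j => ?_))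
          refine (enorm_sub_le).trans ?_
          rw [enorm_mul, enorm_mul, mul_comm ‖v (-j.1)‖ₑ]
      _ ≤ ‖v‖ₑ * ‖w‖ₑ + ‖w‖ₑ * ‖v‖ₑ := by
          rw [one_mul, ENNReal.tsum_add]
          exact add_le_add (hsub v w) (hsub w v)
      _ = _ := by
          rw [ENNReal.ofReal_mul (by positivity), ENNReal.ofReal_mul (by norm_num), ofReal_norm,
            ofReal_norm, mul_comm ‖w‖ₑ, ← two_mul, mul_assoc]
          norm_num
  rw [← ofReal_norm, ENNReal.ofReal_le_ofReal_iff (by positivity)] at h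
  exact h

/-- The symplectic form as a continuous bilinear form. -/
noncomputable def sympL (hp : 0 ≤ p) : SeqSpace p →L[ℂ] SeqSpace p →L[ℂ] ℂ :=
  LinearMap.mkContinuous₂
    (LinearMap.mk₂ ℂ (fun v w : SeqSpace p => symp v w)
      (fun v v' w => by
        rw [symp, symp, symp, ← mul_add, ← (summable_symp hp v w).tsum_add (summable_symp hp v' w)]
        congr 1
        refine tsum_congr fun j => ?_
        simp only [SeqSpace.add_apply]
        ring)
      (fun c v w => by
        rw [symp, symp, smul_eq_mul, mul_left_comm c, ← tsum_mul_left (a := c)]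
        congr 1
        refine tsum_congr fun j => ?_
        simp only [SeqSpace.smul_apply]
        ring)
      (fun v w w' => by
        rw [symp, symp, symp, ← mul_add, ← (summable_symp hp v w).tsum_add (summable_symp hp v w')]
        congr 1
        refine tsum_congr fun j => ?_
        simp only [SeqSpace.add_apply]
        ring)
      (fun c v w => by
        rw [symp, symp, smul_eq_mul, mul_left_comm c, ← tsum_mul_left (a := c)]
        congr 1
        refine tsum_congr fun j => ?_
        simp only [SeqSpace.smul_apply]
        ring)) 2 (norm_symp_le hp)

theorem sympL_apply (hp : 0 ≤ p) (v w : SeqSpace p) : sympL hp v w = symp v w := rfl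

theorem symp_swap (v w : Zbar → ℂ) : symp v w = -symp w v := by
  rw [symp, symp, ← mul_neg, ← tsum_neg]
  congr 1
  refine tsum_congr fun j => ?_
  ring

/-- Since the frequencies are odd, `freqMul` is skew for `symp`; the two terms of the derivative of
`quadHam` therefore coincide. -/
theorem symp_freqMul (z v : SeqSpace p) : symp (freqMul p z) v = symp (freqMul p v) z := by
  unfold symp
  congr 1
  refine tsum_congr fun j => ?_
  simp only [freqMul_apply, freq_neg, Complex.ofReal_neg]
  ring

/-- Writing `Λ` through a bounded bilinear form makes its derivative immediate. -/
theorem quadHam_eq (z : SeqSpace p) : quadHam z = Complex.I / 2 * symp (freqMul p z) z := by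
  unfold symp quadHam
  rw [← mul_assoc, show Complex.I / 2 * -Complex.I = 1 / 2 by
    linear_combination (-1 / 2 : ℂ) * Complex.I_mul_I, ← tsum_mul_left]
  refine tsum_congr fun j => ?_
  simp only [freqMul_apply, freq_neg, Complex.ofReal_neg]
  ring

theorem hasFDerivAt_quadHam (hp : 0 ≤ p) (z : SeqSpace p) :
    HasFDerivAt (fun z : SeqSpace p => quadHam z)
      (Complex.I • sympL hp (freqMul p z)) z := by
  have h1 := (((sympL hp).comp (freqMul p)).hasFDerivAt (x := z)).clm_apply (hasFDerivAt_id z)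
  have h2 := h1.const_mul (Complex.I / 2)
  refine (h2.congr_of_eventuallyEq (Filter.Eventually.of_forall fun y => quadHam_eq y)).congr_fderiv
    ?_
  ext v
  simp only [smul_apply, add_apply,
    ContinuousLinearMap.comp_apply, ContinuousLinearMap.flip_apply, ContinuousLinearMap.coe_id',
    id_eq, smul_eq_mul, sympL_apply]
  rw [symp_freqMul v z]
  ring

/-- The rotation turns the symplectic form into the pairing `∑ v_j y_j`. -/
theorem symp_rotation (hp : 0 ≤ p) (v y : SeqSpace p) :
    symp v (rotation p y) = ∑' j, v j * y j := by
  have hs : Summable fun j => v j * y j := by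
    have h := summable_mul_neg hp v (reflect (fun _ x => (starRingEnd ℂ) x) norm_conj_factor y)
    refine Summable.of_norm (h.congr fun j => ?_)
    change ‖v j‖ * ‖(starRingEnd ℂ) (y (- -j))‖ = _
    rw [neg_neg_idx, norm_conj_factor j, norm_mul]
  rw [tsum_eq_tsum_pos hs, symp, ← tsum_mul_left]
  refine tsum_congr fun j => ?_
  rw [rotation_apply, rotation_apply, sgn_neg, sgn_of_pos j.2, neg_neg_idx]
  linear_combination (-(v j * y j) - v (-j.1) * y (-j.1)) * Complex.I_mul_I

end Symplectic

/-! ### Permutation and conjugation symmetry of the forms. -/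

section Symmetry

variable {p : ℝ} {n : ℕ}

/-- Absolute convergence permits summing over the first index last, which exhibits the gradient. -/
theorem modeForm_cons (hp : 0 < p) {c : (Fin (n + 2) → Zbar) → ℂ} {K : ℝ}
    (hc : ∀ J, ‖c J‖ ≤ K) (hs : ∀ J, c J ≠ 0 → ∑ i, (J i : ℤ) = 0) (v : SeqSpace p)
    (z : Fin (n + 1) → SeqSpace p) :
    modeForm hp c hc (Fin.cons v z) = ∑' j, v j * gradForm hp c hc hs z j := by
  have e : ∀ (j : Zbar) (J : Fin (n + 1) → Zbar),
      c (Fin.cons j J) * monomialForm p (Fin.cons j J) (Fin.cons v z) =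
        v j * (wt j : ℂ) * (c (Fin.cons j J) * monomialForm p J z) := fun j J => by
    rw [monomialForm_apply, monomialForm_apply, Fin.prod_univ_succ]
    simp only [Fin.cons_zero, Fin.cons_succ]
    ring
  have hsum := summable_monomialForm hp hc (Fin.cons v z)
  rw [modeForm_apply, ← (Fin.consEquiv fun _ : Fin (n + 2) => Zbar).tsum_eq]
  rw [← (Fin.consEquiv fun _ : Fin (n + 2) => Zbar).summable_iff] at hsum
  refine (Summable.tsum_prod hsum).trans (tsum_congr fun j => ?_)
  rw [gradForm_apply, modeForm_apply, ← mul_assoc, ← tsum_mul_left]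
  exact tsum_congr fun J => e j J

theorem modeForm_comp_perm (hp : 0 < p) {c : (Fin n → Zbar) → ℂ} {K : ℝ} (hc : ∀ J, ‖c J‖ ≤ K)
    (τ : Equiv.Perm (Fin n)) (hτ : ∀ J, c (J ∘ τ) = c J) (z : Fin n → SeqSpace p) :
    modeForm hp c hc (z ∘ τ) = modeForm hp c hc z := by
  rw [modeForm_apply, modeForm_apply, ← (Equiv.arrowCongr τ.symm (Equiv.refl Zbar)).tsum_eq]
  refine tsum_congr fun J => ?_
  change c (J ∘ τ) * monomialForm p (J ∘ τ) (z ∘ τ) = _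
  rw [hτ, monomialForm_apply, monomialForm_apply]
  congr 1
  exact Equiv.prod_comp τ fun i => (wt (J i) : ℂ) * z i (J i)

theorem modeForm_update (hp : 0 < p) {c : (Fin (n + 1) → Zbar) → ℂ} {K : ℝ} (hc : ∀ J, ‖c J‖ ≤ K)
    (hsymm : ∀ (τ : Equiv.Perm (Fin (n + 1))) J, c (J ∘ τ) = c J) (z v : SeqSpace p)
    (i : Fin (n + 1)) :
    modeForm hp c hc (Function.update (fun _ => z) i v) =
      modeForm hp c hc (Fin.cons v fun _ => z) := by
  rw [← modeForm_comp_perm hp hc (Equiv.swap 0 i) (hsymm _) (Fin.cons v fun _ => z)]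
  congr 1
  funext k
  rcases eq_or_ne k i with rfl | hk
  · simp
  · rw [Function.update_of_ne hk, Function.comp_apply]
    rcases eq_or_ne k 0 with rfl | hk0
    · rw [Equiv.swap_apply_left, ← Fin.succ_pred i hk.symm, Fin.cons_succ]
    · rw [Equiv.swap_apply_of_ne_of_ne hk0 hk, ← Fin.succ_pred k hk0, Fin.cons_succ]

/-- By symmetry all `n + 2` partial derivatives agree, which gives the factor. -/
theorem diagDeriv_modeForm (hp : 0 < p) {c : (Fin (n + 2) → Zbar) → ℂ} {K : ℝ}
    (hc : ∀ J, ‖c J‖ ≤ K) (hs : ∀ J, c J ≠ 0 → ∑ i, (J i : ℤ) = 0)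
    (hsymm : ∀ (τ : Equiv.Perm (Fin (n + 2))) J, c (J ∘ τ) = c J) (z v : SeqSpace p) :
    diagDeriv (modeForm hp c hc) z v =
      (n + 2 : ℕ) * ∑' j, v j * diag (gradForm hp c hc hs) z j := by
  rw [diagDeriv_apply, Finset.sum_congr rfl fun i _ => modeForm_update hp hc hsymm z v i,
    Finset.sum_const, Finset.card_univ, Fintype.card_fin, nsmul_eq_mul, modeForm_cons hp hc hs]
  rfl

/-- The derivative of a form along the multiplication by the frequencies multiplies the
coefficients by the divisors. -/
theorem diagDeriv_modeForm_freqMul (hp : 0 < p) {c : (Fin n → Zbar) → ℂ} {K : ℝ}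
    (hc : ∀ J, ‖c J‖ ≤ K) (z : SeqSpace p) :
    diagDeriv (modeForm hp c hc) z (freqMul p z) =
      ∑' J, (c J * ((∑ i, freq (J i) : ℝ) : ℂ)) * monomialForm p J fun _ => z := by
  have e : ∀ (J : Fin n → Zbar) (i : Fin n),
      monomialForm p J (Function.update (fun _ => z) i (freqMul p z)) =
        (freq (J i) : ℂ) * monomialForm p J fun _ => z := fun J i => by
    rw [monomialForm_apply, monomialForm_apply, ← Finset.mul_prod_erase _ _ (Finset.mem_univ i),
      ← Finset.mul_prod_erase _ (fun k => (wt (J k) : ℂ) * z (J k)) (Finset.mem_univ i),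
      Function.update_self, freqMul_apply]
    rw [Finset.prod_congr rfl fun k hk => by
      rw [Function.update_of_ne (Finset.ne_of_mem_erase hk)]]
    ring
  rw [diagDeriv_apply]
  simp only [modeForm_apply]
  rw [← Summable.tsum_finsetSum fun i _ => summable_monomialForm hp hc _]
  refine tsum_congr fun J => ?_
  simp only [e]
  push_cast
  rw [Finset.mul_sum, Finset.sum_mul]
  exact Finset.sum_congr rfl fun i _ => by ring

/-- Reflect the summation index. Two coefficient families are allowed because the gradient pairs the
slice at `j` with the slice at `-j`. -/
theorem modeForm_conjugation (hp : 0 < p) {c c' : (Fin n → Zbar) → ℂ} {K K' : ℝ}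
    (hc : ∀ J, ‖c J‖ ≤ K) (hc' : ∀ J, ‖c' J‖ ≤ K')
    (h : ∀ J : Fin n → Zbar, c (fun i => -J i) = (starRingEnd ℂ) (c' J)) (z : Fin n → SeqSpace p) :
    modeForm hp c hc (fun i => conjugation p (z i)) = (starRingEnd ℂ) (modeForm hp c' hc' z) := by
  rw [modeForm_apply, modeForm_apply, Complex.conj_tsum,
    ← (Equiv.arrowCongr (Equiv.refl (Fin n)) negEquiv).tsum_eq]
  refine tsum_congr fun J => ?_
  change c (fun i => -J i) * monomialForm p (fun i => -J i) _ = _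
  rw [h, map_mul, monomialForm_apply, monomialForm_apply, map_prod]
  congr 1
  refine Finset.prod_congr rfl fun i _ => ?_
  rw [wt_neg, conjugation_apply, neg_neg_idx, map_mul, Complex.conj_ofReal]

theorem gradForm_conjugation (hp : 0 < p) {c : (Fin (n + 2) → Zbar) → ℂ} {K : ℝ}
    (hc : ∀ J, ‖c J‖ ≤ K) (hs : ∀ J, c J ≠ 0 → ∑ i, (J i : ℤ) = 0)
    (h : ∀ J : Fin (n + 2) → Zbar, c (fun i => -J i) = (starRingEnd ℂ) (c J)) (z : SeqSpace p) :
    diag (gradForm hp c hc hs) (conjugation p z) =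
      conjugation (p + 1) (diag (gradForm hp c hc hs) z) := by
  refine SeqSpace.ext fun j => ?_
  rw [conjugation_apply]
  change (wt j : ℂ) * _ = (starRingEnd ℂ) ((wt (-j) : ℂ) * _)
  rw [map_mul, Complex.conj_ofReal, wt_neg]
  congr 1
  refine modeForm_conjugation hp _ _ (fun J => ?_) fun _ => z
  rw [← h]
  congr 1
  funext i
  refine Fin.cases ?_ (fun k => ?_) i
  · simp [neg_neg_idx]
  · simp

end Symmetry

end GBBM

namespace GBBM

open scoped ENNReal

/-! ### Splitting of the sextic term and the homological equation. -/

section Coefficients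

variable {p : ℝ}

/-- The normalizing factor `1 / 120π²` of the sextic term. -/
noncomputable def sexticConst : ℝ := 1 / (120 * Real.pi ^ 2)

theorem sexticConst_pos : 0 < sexticConst := by
  have := Real.pi_pos
  unfold sexticConst
  positivity

open Classical in
/-- The coefficients of the part of the sextic term with indices in `A`. -/
noncomputable def sexticCoeff (A : Set (Fin 6 → Zbar)) (J : Fin 6 → Zbar) : ℂ :=
  if J ∈ A ∧ ∑ i, (J i : ℤ) = 0 then (sexticConst : ℂ) else 0

theorem norm_sexticCoeff_le (A : Set (Fin 6 → Zbar)) (J : Fin 6 → Zbar) :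
    ‖sexticCoeff A J‖ ≤ sexticConst := by
  have h := sexticConst_pos
  unfold sexticCoeff
  split_ifs
  · rw [Complex.norm_real, Real.norm_of_nonneg h.le]
  · simpa using h.le

theorem sexticCoeff_ne_zero {A : Set (Fin 6 → Zbar)} {J : Fin 6 → Zbar}
    (h : sexticCoeff A J ≠ 0) : J ∈ A ∧ ∑ i, (J i : ℤ) = 0 := by
  by_contra h'
  exact h (if_neg h')

theorem sexticCoeff_of_mem {A : Set (Fin 6 → Zbar)} {J : Fin 6 → Zbar} (hA : J ∈ A)
    (hJ : ∑ i, (J i : ℤ) = 0) : sexticCoeff A J = sexticConst :=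
  if_pos ⟨hA, hJ⟩

theorem sexticCoeff_of_notMem {A : Set (Fin 6 → Zbar)} {J : Fin 6 → Zbar} (hA : J ∉ A) :
    sexticCoeff A J = 0 :=
  if_neg fun h => hA h.1

theorem sexticCoeff_of_sum_ne_zero (A : Set (Fin 6 → Zbar)) {J : Fin 6 → Zbar}
    (hJ : ∑ i, (J i : ℤ) ≠ 0) : sexticCoeff A J = 0 :=
  if_neg fun h => hJ h.2

theorem sexticCoeff_congr {A : Set (Fin 6 → Zbar)} {J J' : Fin 6 → Zbar}
    (hA : J ∈ A ↔ J' ∈ A) (h : ∑ i, (J i : ℤ) = 0 ↔ ∑ i, (J' i : ℤ) = 0) :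
    sexticCoeff A J = sexticCoeff A J' := by
  classical
  exact if_congr (and_congr hA h) rfl rfl

/-- The part of the sextic term with indices in `A` as a multilinear form. -/
noncomputable def sexticForm (hp : 0 < p) (A : Set (Fin 6 → Zbar)) :
    ContinuousMultilinearMap ℂ (fun _ : Fin 6 => SeqSpace p) ℂ :=
  modeForm hp (sexticCoeff A) (norm_sexticCoeff_le A)

theorem sexticPart_eq (hp : 0 < p) (A : Set (Fin 6 → Zbar)) (z : SeqSpace p) :
    sexticPart A z = diag (sexticForm hp A) z := by
  classical
  change _ = ∑' J, sexticCoeff A J * monomialForm p J fun _ => z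
  have h := tsum_subtype {J : Fin 6 → Zbar | J ∈ A ∧ ∑ i, (J i : ℤ) = 0}
    fun J => (sexticConst : ℂ) * ∏ i, ((wt (J i) : ℂ) * z (J i))
  rw [tsum_mul_left] at h
  have e : (1 / (120 * (Real.pi : ℂ) ^ 2)) = (sexticConst : ℂ) := by
    simp [sexticConst]
  rw [sexticPart, e]
  refine Eq.trans h (tsum_congr fun J => ?_)
  rw [monomialForm_apply, sexticCoeff, Set.indicator_apply, ite_mul, zero_mul]
  rfl

theorem sexticForm_add (hp : 0 < p) {A B C D : Set (Fin 6 → Zbar)}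
    (h : ∀ J, sexticCoeff A J = sexticCoeff B J + sexticCoeff C J + sexticCoeff D J)
    (z : SeqSpace p) :
    diag (sexticForm hp A) z =
      diag (sexticForm hp B) z + diag (sexticForm hp C) z + diag (sexticForm hp D) z := by
  have hs := fun A => summable_monomialForm hp (norm_sexticCoeff_le A) fun _ => z
  change ∑' J, sexticCoeff A J * monomialForm p J (fun _ => z) =
    ∑' J, sexticCoeff B J * monomialForm p J (fun _ => z) +
    ∑' J, sexticCoeff C J * monomialForm p J (fun _ => z) +
    ∑' J, sexticCoeff D J * monomialForm p J (fun _ => z)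
  rw [← (hs B).tsum_add (hs C), ← ((hs B).add (hs C)).tsum_add (hs D)]
  refine tsum_congr fun J => ?_
  rw [h]
  ring

theorem numOutside_comp (S : Set ℤ) (J : Fin 6 → Zbar) (τ : Equiv.Perm (Fin 6)) :
    numOutside S (J ∘ τ) = numOutside S J := by
  have h : {i | ((J ∘ τ) i : ℤ) ∉ S} = τ.symm '' {i | (J i : ℤ) ∉ S} := by
    rw [Equiv.image_symm_eq_preimage]
    rfl
  rw [numOutside, numOutside, h, Set.ncard_image_of_injective _ τ.symm.injective]

theorem neg_mem_tangSites {n₁ n₂ : ℕ} {x : ℤ} : -x ∈ tangSites n₁ n₂ ↔ x ∈ tangSites n₁ n₂ := by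
  rw [mem_tangSites, mem_tangSites]
  omega

theorem numOutside_neg (n₁ n₂ : ℕ) (J : Fin 6 → Zbar) :
    numOutside (tangSites n₁ n₂) (fun i => -J i) = numOutside (tangSites n₁ n₂) J := by
  simp only [numOutside, neg_val, neg_mem_tangSites]

theorem comp_mem_normalSet {J : Fin 6 → Zbar} {τ : Equiv.Perm (Fin 6)} :
    J ∘ τ ∈ normalSet ↔ J ∈ normalSet := by
  refine ⟨mem_normalSet_of_comp, fun h => mem_normalSet_of_comp (τ := τ.symm) ?_⟩
  rwa [Function.comp_assoc, Equiv.self_comp_symm, Function.comp_id]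

theorem neg_mem_normalSet {J : Fin 6 → Zbar} : (fun i => -J i) ∈ normalSet ↔ J ∈ normalSet := by
  have key : ∀ J : Fin 6 → Zbar, J ∈ normalSet → (fun i => -J i) ∈ normalSet := by
    rintro J ⟨a, b, c, τ, h⟩
    refine ⟨-a, -b, -c, τ, ?_⟩
    have h' : ∀ i, J (τ i) = ![a, -a, b, -b, c, -c] i := fun i => congrFun h i
    funext i
    change -J (τ i) = _
    rw [h' i]
    fin_cases i <;> rfl
  refine ⟨fun h => ?_, key J⟩
  have h' := key _ h
  simp only [neg_neg_idx] at h'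
  exact h'

/-- The index set of the monomials to be removed. -/
def nonresonant (n₁ n₂ : ℕ) : Set (Fin 6 → Zbar) :=
  {J | numOutside (tangSites n₁ n₂) J ≤ 2 ∧ J ∉ normalSet}

/-- Sextuples with at most two outside entries are divided by membership in `normalSet`; the others
form `Delta3`. -/
theorem sexticCoeff_univ (n₁ n₂ : ℕ) (J : Fin 6 → Zbar) :
    sexticCoeff Set.univ J =
      sexticCoeff ((Delta (tangSites n₁ n₂) 0 ∪ Delta (tangSites n₁ n₂) 1 ∪
        Delta (tangSites n₁ n₂) 2) ∩ normalSet) J +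
      sexticCoeff (Delta3 (tangSites n₁ n₂)) J + sexticCoeff (nonresonant n₁ n₂) J := by
  have hD : J ∈ Delta (tangSites n₁ n₂) 0 ∪ Delta (tangSites n₁ n₂) 1 ∪
      Delta (tangSites n₁ n₂) 2 ↔ numOutside (tangSites n₁ n₂) J ≤ 2 := by
    simp only [Delta, Set.mem_union, Set.mem_ofPred_eq]
    omega
  have h3 : J ∈ Delta3 (tangSites n₁ n₂) ↔ ¬ numOutside (tangSites n₁ n₂) J ≤ 2 := by
    simp only [Delta3, Set.mem_ofPred_eq]
    omega
  have hn : J ∈ nonresonant n₁ n₂ ↔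
    numOutside (tangSites n₁ n₂) J ≤ 2 ∧ J ∉ normalSet := Iff.rfl
  by_cases h0 : ∑ i, (J i : ℤ) = 0
  swap
  · simp only [sexticCoeff_of_sum_ne_zero _ h0, add_zero]
  rw [sexticCoeff_of_mem (Set.mem_univ J) h0]
  by_cases h1 : numOutside (tangSites n₁ n₂) J ≤ 2
  · rw [sexticCoeff_of_notMem (A := Delta3 _) fun h => h3.1 h h1]
    by_cases h2 : J ∈ normalSet
    · rw [sexticCoeff_of_mem (Set.mem_inter (hD.2 h1) h2) h0,
        sexticCoeff_of_notMem fun h => (hn.1 h).2 h2, add_zero, add_zero]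
    · rw [sexticCoeff_of_notMem fun h => h2 h.2, sexticCoeff_of_mem (hn.2 ⟨h1, h2⟩) h0,
        add_zero, zero_add]
  · rw [sexticCoeff_of_notMem fun h => h1 (hD.1 h.1), sexticCoeff_of_mem (h3.2 h1) h0,
      sexticCoeff_of_notMem fun h => h1 (hn.1 h).1, add_zero, zero_add]

/-- The coefficients of the generating Hamiltonian, the solution of the homological equation. -/
noncomputable def homCoeff (n₁ n₂ : ℕ) (J : Fin 6 → Zbar) : ℂ :=
  sexticCoeff (nonresonant n₁ n₂) J * (Complex.I / ((∑ i, freq (J i) : ℝ) : ℂ))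

theorem homCoeff_sum {n₁ n₂ : ℕ} {J : Fin 6 → Zbar} (h : homCoeff n₁ n₂ J ≠ 0) :
    ∑ i, (J i : ℤ) = 0 :=
  (sexticCoeff_ne_zero (left_ne_zero_of_mul h)).2

theorem homCoeff_comp (n₁ n₂ : ℕ) (τ : Equiv.Perm (Fin 6)) (J : Fin 6 → Zbar) :
    homCoeff n₁ n₂ (J ∘ τ) = homCoeff n₁ n₂ J := by
  have h1 : ∑ i, ((J ∘ τ) i : ℤ) = ∑ i, (J i : ℤ) := Equiv.sum_comp τ fun i => (J i : ℤ)
  have h2 : ∑ i, freq ((J ∘ τ) i) = ∑ i, freq (J i) := Equiv.sum_comp τ fun i => freq (J i)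
  have h3 : J ∘ τ ∈ nonresonant n₁ n₂ ↔ J ∈ nonresonant n₁ n₂ := by
    change numOutside _ (J ∘ τ) ≤ 2 ∧ J ∘ τ ∉ normalSet ↔ _
    rw [numOutside_comp, comp_mem_normalSet]
    rfl
  rw [homCoeff, homCoeff, h2, sexticCoeff_congr h3 (by rw [h1])]

/-- The divisor is odd in `J`, and its sign change matches the conjugation of `i`. This makes `F`
real on real points. -/
theorem homCoeff_neg (n₁ n₂ : ℕ) (J : Fin 6 → Zbar) :
    homCoeff n₁ n₂ (fun i => -J i) = (starRingEnd ℂ) (homCoeff n₁ n₂ J) := by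
  have h1 : ∑ i, ((-J i : Zbar) : ℤ) = 0 ↔ ∑ i, (J i : ℤ) = 0 := by
    simp only [neg_val, Finset.sum_neg_distrib, neg_eq_zero]
  have h2 : ∑ i, freq (-J i) = -∑ i, freq (J i) := by
    simp only [freq_neg, Finset.sum_neg_distrib]
  have h3 : (fun i => -J i) ∈ nonresonant n₁ n₂ ↔ J ∈ nonresonant n₁ n₂ := by
    change numOutside _ (fun i => -J i) ≤ 2 ∧ (fun i => -J i) ∉ normalSet ↔ _
    rw [numOutside_neg, neg_mem_normalSet]
    rfl
  have h4 : (starRingEnd ℂ) (sexticCoeff (nonresonant n₁ n₂) J) =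
      sexticCoeff (nonresonant n₁ n₂) J := by
    unfold sexticCoeff
    split_ifs <;> simp
  rw [homCoeff, homCoeff, h2, map_mul, h4, map_div₀, Complex.conj_I, Complex.conj_ofReal,
    Complex.ofReal_neg, div_neg, neg_div]
  rw [sexticCoeff_congr h3 h1]

variable {n₁ n₂ : ℕ} {c₀ : ℝ}

theorem norm_homCoeff_le (hc₀ : 0 < c₀)
    (h : ∀ J : Fin 6 → Zbar, numOutside (tangSites n₁ n₂) J ≤ 2 → ∑ i, (J i : ℤ) = 0 →
      J ∉ normalSet → c₀ ≤ |∑ i, freq (J i)|) (J : Fin 6 → Zbar) :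
    ‖homCoeff n₁ n₂ J‖ ≤ sexticConst / c₀ := by
  have hpos := sexticConst_pos
  by_cases hJ : sexticCoeff (nonresonant n₁ n₂) J = 0
  · rw [homCoeff, hJ, zero_mul, norm_zero]
    positivity
  · obtain ⟨⟨h1, h2⟩, h3⟩ := sexticCoeff_ne_zero hJ
    have hlow := h J h1 h3 h2
    rw [homCoeff, norm_mul, norm_div, Complex.norm_I, Complex.norm_real, Real.norm_eq_abs,
      mul_one_div]
    gcongr
    exact norm_sexticCoeff_le _ _

/-- Where the coefficient is nonzero so is the divisor; elsewhere both sides vanish, so division by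
zero plays no role. -/
theorem homological_equation (hc₀ : 0 < c₀)
    (h : ∀ J : Fin 6 → Zbar, numOutside (tangSites n₁ n₂) J ≤ 2 → ∑ i, (J i : ℤ) = 0 →
      J ∉ normalSet → c₀ ≤ |∑ i, freq (J i)|) (J : Fin 6 → Zbar) :
    Complex.I * (homCoeff n₁ n₂ J * ((∑ i, freq (J i) : ℝ) : ℂ)) =
      -sexticCoeff (nonresonant n₁ n₂) J := by
  by_cases hJ : sexticCoeff (nonresonant n₁ n₂) J = 0
  · rw [homCoeff, hJ]
    simp
  · obtain ⟨⟨h1, h2⟩, h3⟩ := sexticCoeff_ne_zero hJ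
    have hne : ((∑ i, freq (J i) : ℝ) : ℂ) ≠ 0 := by
      rw [Complex.ofReal_ne_zero]
      intro h0
      have := h J h1 h3 h2
      rw [h0, abs_zero] at this
      linarith
    rw [homCoeff, mul_assoc, div_mul_cancel₀ _ hne]
    linear_combination sexticCoeff (nonresonant n₁ n₂) J * Complex.I_mul_I

theorem hatPart_apply (S : Set ℤ) (z : SeqSpace p) {j : Zbar} (h : (j : ℤ) ∉ S) :
    hatPart S z j = z j := if_neg h

/-- The terms with at least three indices outside of `S` are cubic in the normal part. -/
theorem norm_sexticForm_Delta3_le (hp : 0 < p) (S : Set ℤ) (z : SeqSpace p) :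
    ‖diag (sexticForm hp (Delta3 S)) z‖ ≤
      20 * (sexticConst * l1Const p ^ 6) * ‖z‖ ^ 3 * ‖hatPart S z‖ ^ 3 := by
  have hpos := sexticConst_pos
  have hl := l1Const_nonneg p
  -- For each set `T` of three places put `ẑ` there and `z` elsewhere. A sextuple in `Delta3` has
  -- some `T` among its outside places, where its monomial is unchanged; summing over all 20 sets
  -- covers every sextuple.
  let 𝒯 : Finset (Finset (Fin 6)) := Finset.powersetCard 3 Finset.univ
  let u : Finset (Fin 6) → Fin 6 → SeqSpace p := fun T i => if i ∈ T then hatPart S z else z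
  have hterm : ∀ J, ‖sexticCoeff (Delta3 S) J * monomialForm p J fun _ => z‖ₑ ≤
      ∑ T ∈ 𝒯, ‖sexticCoeff (Delta3 S) J * monomialForm p J (u T)‖ₑ := fun J => by
    by_cases hJ : sexticCoeff (Delta3 S) J = 0
    · simp [hJ]
    have h3 : 3 ≤ numOutside S J := (sexticCoeff_ne_zero hJ).1
    obtain ⟨T, hT, hcard⟩ := Set.exists_subset_card_eq h3
    lift T to Finset (Fin 6) using Set.toFinite T
    rw [Set.ncard_coe_finset] at hcard
    refine le_trans (le_of_eq ?_) (Finset.single_le_sum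
      (f := fun T => ‖sexticCoeff (Delta3 S) J * monomialForm p J (u T)‖ₑ)
      (fun _ _ => zero_le) (Finset.mem_powersetCard.2 ⟨Finset.subset_univ T, hcard⟩))
    congr 2
    rw [monomialForm_apply, monomialForm_apply]
    refine Finset.prod_congr rfl fun i _ => ?_
    by_cases hi : i ∈ T
    · simp only [u, if_pos hi]
      rw [hatPart_apply S z (hT hi)]
    · simp only [u, if_neg hi]
  have hprod : ∀ T ∈ 𝒯, ∏ i, ‖u T i‖ = ‖z‖ ^ 3 * ‖hatPart S z‖ ^ 3 := fun T hT => by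
    have hcard := (Finset.mem_powersetCard.1 hT).2
    have hcompl : (Finset.univ.filter fun i => i ∉ T).card = 3 := by
      rw [Finset.filter_notMem_eq_sdiff, ← Finset.compl_eq_univ_sdiff, Finset.card_compl, hcard]
      rfl
    simp only [u, apply_ite norm]
    rw [Finset.prod_ite, Finset.prod_const, Finset.prod_const, hcompl, Finset.filter_univ_mem,
      hcard, mul_comm]
  have h : ‖diag (sexticForm hp (Delta3 S)) z‖ₑ ≤
      ENNReal.ofReal (20 * (sexticConst * l1Const p ^ 6) * ‖z‖ ^ 3 * ‖hatPart S z‖ ^ 3) := by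
    calc _ ≤ ∑' J, ∑ T ∈ 𝒯, ‖sexticCoeff (Delta3 S) J * monomialForm p J (u T)‖ₑ :=
          enorm_tsum_le_tsum_enorm.trans (ENNReal.tsum_le_tsum hterm)
      _ = ∑ T ∈ 𝒯, ∑' J, ‖sexticCoeff (Delta3 S) J * monomialForm p J (u T)‖ₑ :=
          Summable.tsum_finsetSum fun _ _ => ENNReal.summable
      _ ≤ ∑ T ∈ 𝒯, ENNReal.ofReal (sexticConst * l1Const p ^ 6 *
            (‖z‖ ^ 3 * ‖hatPart S z‖ ^ 3)) := by
          refine Finset.sum_le_sum fun T hT => ?_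
          rw [← hprod T hT, ← ofReal_mul_prod_enorm hpos.le hl]
          exact tsum_monomialForm_le hp (norm_sexticCoeff_le _) (u T)
      _ = _ := by
          have hcard : 𝒯.card = 20 := by
            rw [Finset.card_powersetCard, Finset.card_univ, Fintype.card_fin]
            rfl
          rw [Finset.sum_const, hcard, nsmul_eq_mul, ← ENNReal.ofReal_natCast,
            ← ENNReal.ofReal_mul (by positivity)]
          congr 1
          push_cast
          ring
  rw [← ofReal_norm, ENNReal.ofReal_le_ofReal_iff (by positivity)] at h
  exact h

end Coefficients

end GBBM

namespace GBBM

/-! ### The Hamiltonian vector field of a symmetric form. -/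

section HamiltonianField

variable {p : ℝ} {n : ℕ}

theorem coe_inclL (y : SeqSpace (p + 1)) : (inclL p y : Zbar → ℂ) = (y : Zbar → ℂ) := by
  rw [inclL_apply]
  unfold incl
  exact Subtype.coe_mk _ _

theorem sympL_inclL (hp : 0 ≤ p) (v : SeqSpace p) (y : SeqSpace (p + 1)) :
    sympL hp v (inclL p y) = symp v y :=
  (sympL_apply hp v (inclL p y)).trans (congrArg (symp v) (coe_inclL y))

theorem sympL_inclL_rotation_smul (hp : 0 ≤ p) (v : SeqSpace p) (a : ℂ) (y : SeqSpace (p + 1)) :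
    sympL hp v (inclL p (rotation (p + 1) (a • y))) = a * ∑' j, v j * y j := by
  rw [← tsum_mul_left]
  refine (symp_rotation hp v (inclL p (a • y))).trans (tsum_congr fun j => ?_)
  exact mul_left_comm _ _ _

/-- Conjugation changes the sign of `i`, reflection that of `sgn`, and the two signs cancel. -/
theorem conjugation_inclL_rotation_smul (a : ℕ) (y : SeqSpace (p + 1)) :
    conjugation p (inclL p (rotation (p + 1) ((a : ℂ) • y))) =
      inclL p (rotation (p + 1) ((a : ℂ) • conjugation (p + 1) y)) := by
  refine SeqSpace.ext fun j => ?_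
  change (starRingEnd ℂ) (-Complex.I * sgn (-j) * ((a : ℂ) * y (- -j))) =
    -Complex.I * sgn j * ((a : ℂ) * (starRingEnd ℂ) (y (- -j)))
  rw [sgn_neg]
  simp only [map_mul, map_neg, Complex.conj_I, conj_sgn, Complex.conj_natCast]
  ring

/-- The Hamiltonian vector field of the form with coefficients `c`, as a multilinear map. -/
noncomputable def fieldForm (hp : 0 < p) (c : (Fin (n + 2) → Zbar) → ℂ) {K : ℝ}
    (hc : ∀ J, ‖c J‖ ≤ K) (hs : ∀ J, c J ≠ 0 → ∑ i, (J i : ℤ) = 0) :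
    ContinuousMultilinearMap ℂ (fun _ : Fin (n + 1) => SeqSpace p) (SeqSpace (p + 1)) :=
  (rotation (p + 1)).compContinuousMultilinearMap (((n + 2 : ℕ) : ℂ) • gradForm hp c hc hs)

variable (hp : 0 < p) {c : (Fin (n + 2) → Zbar) → ℂ} {K : ℝ} (hc : ∀ J, ‖c J‖ ≤ K)
  (hs : ∀ J, c J ≠ 0 → ∑ i, (J i : ℤ) = 0)

theorem diag_fieldForm (z : SeqSpace p) :
    diag (fieldForm hp c hc hs) z =
      rotation (p + 1) (((n + 2 : ℕ) : ℂ) • diag (gradForm hp c hc hs) z) := rfl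

/-- The rotation turns `ω` into the plain pairing, and the factor `n + 2` in `fieldForm` matches the
one in `diagDeriv_modeForm`. -/
theorem symp_fieldForm (hsymm : ∀ (τ : Equiv.Perm (Fin (n + 2))) J, c (J ∘ τ) = c J)
    (z v : SeqSpace p) :
    sympL hp.le v (inclL p (diag (fieldForm hp c hc hs) z)) =
      diagDeriv (modeForm hp c hc) z v := by
  rw [diagDeriv_modeForm hp hc hs hsymm, diag_fieldForm]
  exact sympL_inclL_rotation_smul hp.le v _ _

theorem hasFDerivAt_modeForm (hsymm : ∀ (τ : Equiv.Perm (Fin (n + 2))) J, c (J ∘ τ) = c J)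
    (z : SeqSpace p) :
    HasFDerivAt (diag (modeForm hp c hc))
      ((sympL hp.le).flip (inclL p (diag (fieldForm hp c hc hs) z))) z := by
  refine (hasFDerivAt_diag (modeForm hp c hc) z).congr_fderiv ?_
  ext v
  rw [ContinuousLinearMap.flip_apply, symp_fieldForm hp hc hs hsymm z v]

theorem isHamiltonianField_fieldForm
    (hsymm : ∀ (τ : Equiv.Perm (Fin (n + 2))) J, c (J ∘ τ) = c J) :
    IsHamiltonianField (diag (modeForm hp c hc)) (diag (fieldForm hp c hc hs)) :=
  ⟨fun z => (hasFDerivAt_modeForm hp hc hs hsymm z).differentiableAt, fun z v => by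
    rw [(hasFDerivAt_modeForm hp hc hs hsymm z).fderiv, ContinuousLinearMap.flip_apply]
    exact sympL_inclL hp.le v _⟩

theorem conjugation_fieldForm
    (h : ∀ J : Fin (n + 2) → Zbar, c (fun i => -J i) = (starRingEnd ℂ) (c J)) (z : SeqSpace p) :
    conjugation p (inclL p (diag (fieldForm hp c hc hs) z)) =
      inclL p (diag (fieldForm hp c hc hs) (conjugation p z)) := by
  rw [diag_fieldForm, diag_fieldForm, gradForm_conjugation hp hc hs h]
  exact conjugation_inclL_rotation_smul (n + 2) _

theorem im_modeForm_eq_zero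
    (h : ∀ J : Fin (n + 2) → Zbar, c (fun i => -J i) = (starRingEnd ℂ) (c J)) {z : SeqSpace p}
    (hz : IsReal z) : (modeForm hp c hc fun _ => z).im = 0 := by
  have e := modeForm_conjugation hp hc hc h fun _ => z
  rw [(isReal_iff z).1 hz] at e
  exact Complex.conj_eq_iff_im.1 e.symm

end HamiltonianField

/-! ### Cancellation of the nonresonant terms. -/

section NormalForm

variable {p : ℝ} {n₁ n₂ : ℕ} {c₀ : ℝ}

/-- The bracket of the quadratic Hamiltonian with the generating Hamiltonian cancels the
nonresonant part of the sextic term. -/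
theorem quadHam_bracket (hp : 0 < p) (hc₀ : 0 < c₀)
    (h : ∀ J : Fin 6 → Zbar, numOutside (tangSites n₁ n₂) J ≤ 2 → ∑ i, (J i : ℤ) = 0 →
      J ∉ normalSet → c₀ ≤ |∑ i, freq (J i)|) (z : SeqSpace p) :
    (Complex.I • sympL hp.le (freqMul p z)) (inclL p (diag (fieldForm (n := 4) hp (homCoeff n₁ n₂)
      (norm_homCoeff_le hc₀ h) fun _ => homCoeff_sum) z)) =
      diag (-sexticForm hp (nonresonant n₁ n₂)) z := by
  -- Here `dΛ(X_F) = i ω(freqMul z, X_F) = i dF(freqMul z)`, and this derivative multiplies each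
  -- coefficient by its divisor.
  rw [smul_apply, symp_fieldForm hp _ _ (homCoeff_comp n₁ n₂),
    diagDeriv_modeForm_freqMul, smul_eq_mul, ← tsum_mul_left]
  change _ = -∑' J, sexticCoeff (nonresonant n₁ n₂) J * monomialForm p J fun _ => z
  rw [← tsum_neg]
  refine tsum_congr fun J => ?_
  rw [← mul_assoc, homological_equation hc₀ h, neg_mul]

theorem ham_eq (hp : 0 < p) (z : SeqSpace p) :
    ham z = quadHam z + diag (sexticForm hp Set.univ) z := by
  rw [ham, sexticPart_eq hp]

theorem normalForm_eq (hp : 0 < p) (z : SeqSpace p) :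
    quadHam z + Gbar n₁ n₂ z + Ghat n₁ n₂ z =
      quadHam z + diag (-sexticForm hp (nonresonant n₁ n₂)) z +
        diag (sexticForm hp Set.univ) z := by
  have e : diag (-sexticForm hp (nonresonant n₁ n₂)) z =
    -diag (sexticForm hp (nonresonant n₁ n₂)) z := rfl
  rw [Gbar, Ghat, sexticPart_eq hp, sexticPart_eq hp, e,
    sexticForm_add hp (sexticCoeff_univ n₁ n₂)]
  ring

end NormalForm

end GBBM

/-! ### Assembly of the normal form theorem. -/

theorem proposition3p2 :
    ∃ N₁ : ℕ, ∀ n₁ : ℕ, N₁ ≤ n₁ → ∃ N₂ : ℕ, ∀ n₂ : ℕ, N₂ ≤ n₂ → ∀ p : ℝ, 0 < p →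
      ∃ (F : ContinuousMultilinearMap ℂ (fun _ : Fin 6 => GBBM.SeqSpace p) ℂ)
        (X : GBBM.SeqSpace p → GBBM.SeqSpace (p + 1))
        (Φ : OpenPartialHomeomorph (GBBM.SeqSpace p) (GBBM.SeqSpace p))
        (Ψ : GBBM.SeqSpace p → GBBM.SeqSpace (p + 1))
        (R : GBBM.SeqSpace p → ℂ) (C : ℝ),
        -- the sextic Hamiltonian `z ↦ F(z, …, z)` is real on real points, and its vector
        -- field is analytic from `h_p` to `h_{p+1}`
        (∀ z : GBBM.SeqSpace p, GBBM.IsReal z → (F fun _ => z).im = 0) ∧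
        AnalyticOnNhd ℂ X Set.univ ∧
        GBBM.IsHamiltonianField (fun z => F fun _ => z) X ∧
        -- `Φ` is a real analytic symplectic change of coordinates near the origin, the time-1
        -- map of that Hamiltonian, and `Φ - id` is analytic from `h_p` to `h_{p+1}`
        0 ∈ Φ.source ∧ Φ 0 = 0 ∧
        GBBM.IsTimeOneMap X Φ.source Φ ∧
        AnalyticOnNhd ℂ Φ Φ.source ∧ AnalyticOnNhd ℂ Φ.symm Φ.target ∧
        (∀ z ∈ Φ.source, GBBM.IsReal z ↔ GBBM.IsReal (Φ z)) ∧
        GBBM.IsSymplecticOn Φ.source Φ ∧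
        AnalyticOnNhd ℂ Ψ Φ.source ∧
        (∀ z ∈ Φ.source, Φ z = z + GBBM.incl p (Ψ z)) ∧
        -- the partial Birkhoff normal form of order six
        ∀ z ∈ Φ.source,
          GBBM.ham (Φ z) =
            GBBM.quadHam z + GBBM.Gbar n₁ n₂ z + GBBM.Ghat n₁ n₂ z + R z ∧
          ‖GBBM.Ghat n₁ n₂ z‖ ≤
            C * ‖z‖ ^ 3 * ‖GBBM.hatPart (GBBM.tangSites n₁ n₂) z‖ ^ 3 ∧
          ‖R z‖ ≤ C * ‖z‖ ^ 10 := by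
  refine ⟨20, fun n₁ h1 => ⟨(GBBM.siteBound n₁).toNat, fun n₂ h2 p hp => ?_⟩⟩
  obtain ⟨c₀, hc₀, hdiv⟩ := GBBM.exists_divisor_bound h1 (Int.toNat_le.1 h2)
  have hc := GBBM.norm_homCoeff_le hc₀ hdiv
  have hs : ∀ J, GBBM.homCoeff n₁ n₂ J ≠ 0 → ∑ i, (J i : ℤ) = 0 := fun _ => GBBM.homCoeff_sum
  have hsymm := GBBM.homCoeff_comp n₁ n₂
  have hneg := GBBM.homCoeff_neg n₁ n₂
  let N := GBBM.fieldForm (n := 4) hp (GBBM.homCoeff n₁ n₂) hc hs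
  let G := GBBM.sexticForm hp Set.univ
  let P := -GBBM.sexticForm hp (GBBM.nonresonant n₁ n₂)
  obtain ⟨Φ, Ψ, C, h0, hΦ0, hflow, hΦ, hΦsymm, hreal, hsymp, hΨ, hΦΨ⟩ :=
    GBBM.exists_timeOneMap N (GBBM.inclL p) (by norm_num) (ω := GBBM.sympL hp.le)
      (fun v w => GBBM.symp_swap v w) (GBBM.hasFDerivAt_modeForm (n := 4) hp hc hs hsymm)
      (κ := GBBM.conjugation p) GBBM.norm_conjugation
      (GBBM.conjugation_fieldForm (n := 4) hp hc hs hneg)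
  -- The constant of `norm_remainder_le` for forms of degree six and a field of degree five, which
  -- yields the exponent `6 - 1 + 5 = 10`; that lemma asks for a growth constant of at least one.
  let B := (‖P‖ + ‖G‖) * (6 : ℕ) * max C 1 ^ (6 - 1) *
    (‖GBBM.inclL p‖ * (‖N‖ * max C 1 ^ 5))
  refine ⟨GBBM.modeForm hp (GBBM.homCoeff n₁ n₂) hc, GBBM.diag N, Φ, Ψ,
    fun z => GBBM.ham (Φ z) - (GBBM.quadHam z + GBBM.Gbar n₁ n₂ z + GBBM.Ghat n₁ n₂ z),
    max (20 * (GBBM.sexticConst * GBBM.l1Const p ^ 6)) B,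
    fun z hz => GBBM.im_modeForm_eq_zero (n := 4) hp hc hneg hz,
    fun z _ => GBBM.analyticAt_diag N z,
    GBBM.isHamiltonianField_fieldForm (n := 4) hp hc hs hsymm, h0, hΦ0,
    fun z hz => ?_, hΦ, hΦsymm, fun z hz => ?_, hsymp, hΨ, hΦΨ, fun z hz => ⟨?_, ?_, ?_⟩⟩
  · obtain ⟨γ, hγ0, hγ1, hγ⟩ := hflow z hz
    exact ⟨γ, hγ0, hγ1, fun t ht => (hγ t ht).1⟩
  · rw [GBBM.isReal_iff, GBBM.isReal_iff, hreal z hz]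
  · ring
  · rw [GBBM.Ghat, GBBM.sexticPart_eq hp]
    refine (GBBM.norm_sexticForm_Delta3_le hp _ z).trans ?_
    gcongr
    exact le_max_left _ _
  -- `R` was defined as the difference of the two sides, so only its size along the curve from `z =
  -- γ 0` has to be estimated.
  · obtain ⟨γ, rfl, hγ1, hγ⟩ := hflow z hz
    have h := GBBM.norm_remainder_le (GBBM.hasFDerivAt_quadHam hp.le) (P := P) (G := G)
      (GBBM.quadHam_bracket hp hc₀ hdiv) (le_max_right C 1) fun t ht =>
        ⟨(hγ t ht).1, (hγ t ht).2.trans (by gcongr; exact le_max_left _ _)⟩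
    rw [hγ1] at h
    beta_reduce
    rw [GBBM.ham_eq hp, GBBM.normalForm_eq hp]
    refine h.trans ?_
    change B * ‖γ 0‖ ^ 10 ≤ _
    gcongr
    exact le_max_right _ _
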